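/- Let $n\ge 1$ and let $\Omega\subset\mathbb R^n$ be a bounded open set. Let $(\mathcal T_h)$ be a shape-regular, quasi-uniform family of triangulations of $\Omega$ with maximum element diameter $h\to 0$. That is, each $\mathcal T_h$ is a finite conforming family of $n$-simplices with union $\overline\Omega$, where $\Omega$ is the interior of this union, and there are constants $C_1,C_2>0$ independent of $h$ such that $h_K/\rho_K\le C_1$ and $h/h_K\le C_2$ for all $K\in\mathcal T_h$, where $h_K$ and $\rho_K$ are the diameter and inradius of $K$. For an integer $r\ge 0$ let $V_h^r=\{f\in L^2(\Omega) : f|_K\in P_r(K)\ \forall K\in\mathcal T_h\}$, where $P_r(K)$ is the space of polynomials of degree at most $r$, let $\langle\cdot,\cdot\rangle$ be the $L^2(\Omega)$ inner product (and the distributional pairing), and let $\mathcal E_h^0$ be the set of interior $(n-1)$-simplices of $\mathcal T_h$. On $e=K_1\cap K_2\in\mathcal E_h^0$ put $[\![f]\!]=f_1n_1+f_2n_2$ and $\{g\}=\frac12(g_1+g_2)$, where $f_i=f|_{K_i}$, $g_i=g|_{K_i}$, and $n_i$ is the unit normal to $e$ pointing out of $K_i$. Let $p\in(2,\infty]$ and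 $u\in H_0(\mathrm{div},\Omega)\cap L^p(\Omega)^n$, i.e. $u\in L^p(\Omega)^n\cap L^2(\Omega)^n$ has weak divergence $\mathrm{div}\,u\in L^2(\Omega)$ and $u\cdot n=0$ on $\partial\Omega$ in the weak sense that $\int_\Omega(u\cdot\nabla w+w\,\mathrm{div}\,u)\,dx=0$ for all $w\in C_0^\infty(\mathbb R^n)$. The distributional directional derivative of $f\in L^2(\Omega)$ is defined by $\langle\nabla_u^{\rm dist}f,g\rangle=-\int_\Omega f\,\mathrm{div}(gu)\,dx$ for $g\in C_0^\infty(\Omega)$. A family of linear operators $A=A_h\in L(V_h^r,V_h^r)$ is called a consistent approximation of $\nabla_u^{\rm dist}$ in $V_h^r$ if, whenever $f\in L^2(\Omega)$ and $f_h\in V_h^r$ satisfy $\|f-f_h\|_{L^2(\Omega)}\to 0$ as $h\to 0$, we have $\langle Af_h-\nabla_u^{\rm dist}f,g\rangle\to 0$ for all $g\in C_0^\infty(\Omega)$. Then there is, for each $h$, exactly one operator $A_u\in L(V_h^r,V_h^r)$ with $$\langle A_uf,g\rangle=\sum_{K\in\mathcal T_h}\int_K(u\cdot\nabla f)\,g\,dx-\sum_{e\in\mathcal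 E_h^0}\int_e u\cdot[\![f]\!]\,\{g\}\,ds\qquad\forall f,g\in V_h^r,$$ where the integrals over the faces $e$ are understood as duality pairings with the normal traces of $u$ (defined on a single face because $p>2$), and $A_u$ is a consistent approximation of $\nabla_u^{\rm dist}$ in $V_h^r$. Moreover, suppose that $r\ge1$ and $p=\infty$, and let $A\in L(V_h^r,V_h^r)$ be any other consistent approximation of $\nabla_u^{\rm dist}$ in $V_h^r$. Let $f\in L^2(\Omega)$, $g\in C_0^\infty(\Omega)$ and $f_h,g_h\in V_h^r$ be such that $\|f_h-f\|_{L^2(\Omega)}\to0$ and $$h^{-1}\|g-g_h\|_{L^2(\Omega)}+\Big(\sum_{K\in\mathcal T_h}|g-g_h|_{H^1(K)}^2\Big)^{1/2}\to0,$$ and suppose that $\|Af_h\|_{L^2(\Omega)}\le C h^{-1}$ with a constant $C$ independent of $h$. Then $\langle(A-A_u)f_h,g_h\rangle\to0$. -/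

import Mathlib

open MeasureTheory Filter Topology
open scoped ContDiff ENNReal

noncomputable section

namespace FEDirDeriv

/-- Euclidean space `ℝⁿ`. -/
abbrev Euc (n : ℕ) : Type := EuclideanSpace ℝ (Fin n)

variable {n : ℕ}

/-! ### Test functions, weak divergence, `H(div, Ω)` and `H₀(div, Ω)` -/

/-- `g ∈ C₀^∞(Ω)`: a smooth function with compact support contained in `Ω`. -/
structure IsTest (Ω : Set (Euc n)) (g : Euc n → ℝ) : Prop where
  smooth : ContDiff ℝ ∞ g
  compact : HasCompactSupport g
  supp : tsupport g ⊆ Ω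

/-- `d` is the weak divergence of `u` on `Ω`: `∫_Ω u · ∇g = - ∫_Ω d g` for all `g ∈ C₀^∞(Ω)`.
Throughout, `fderiv ℝ g x (u x)` is the directional derivative `(u · ∇g)(x)`. -/
def HasWeakDiv (Ω : Set (Euc n)) (u : Euc n → Euc n) (d : Euc n → ℝ) : Prop :=
  ∀ g : Euc n → ℝ, IsTest Ω g →
    ∫ x in Ω, fderiv ℝ g x (u x) = - ∫ x in Ω, d x * g x

/-- `u ∈ H(div, Ω)` with `div u = d`. -/
structure IsHDiv (Ω : Set (Euc n)) (u : Euc n → Euc n) (d : Euc n → ℝ) : Prop where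
  memLp : MemLp u 2 (volume.restrict Ω)
  memLp_div : MemLp d 2 (volume.restrict Ω)
  weakDiv : HasWeakDiv Ω u d

/-- The pairing `⟨u · n, w⟩_{∂S} = ∫_S ((div u) w + u · ∇w) dx` of the normal trace of `u` (with
`div u = d`) on `∂S`, `n` the outward normal, with the trace of `w`, as given by Green's formula. -/
def normalPairing (S : Set (Euc n)) (u : Euc n → Euc n) (d : Euc n → ℝ) (w : Euc n → ℝ) : ℝ :=
  ∫ x in S, (d x * w x + fderiv ℝ w x (u x))

/-- `u ∈ H₀(div, Ω)` with `div u = d`: the normal trace of `u ∈ H(div, Ω)` on `∂Ω` vanishes, i.e.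
its pairing with every smooth function up to the boundary is zero. -/
structure IsH0Div (Ω : Set (Euc n)) (u : Euc n → Euc n) (d : Euc n → ℝ) : Prop
    extends IsHDiv Ω u d where
  normal_trace : ∀ w : Euc n → ℝ, ContDiff ℝ ∞ w → HasCompactSupport w →
    normalPairing Ω u d w = 0

/-! ### The distributional directional derivative -/

/-- For a test function `g` and `u` with `div u = d`, this is the function
`div (g u) = u · ∇g + g div u`; see `hasWeakDiv_smul`. -/
def divMul (u : Euc n → Euc n) (d : Euc n → ℝ) (g : Euc n → ℝ) (x : Euc n) : ℝ :=
  fderiv ℝ g x (u x) + g x * d x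

/-- `⟨∇_u^dist f, g⟩ = - ∫_Ω f div (g u) dx`. -/
def distDeriv (Ω : Set (Euc n)) (u : Euc n → Euc n) (d : Euc n → ℝ) (f g : Euc n → ℝ) : ℝ :=
  - ∫ x in Ω, f x * divMul u d g x

/-! ### Triangulations -/

/-- A triangulation of `Ω ⊆ ℝⁿ`: a finite geometric simplicial complex whose underlying space is
the closure of `Ω` and has interior `Ω`. Simplices are recorded by their vertex sets; the
closed simplex with vertex set `K` is `convexHull ℝ K`. -/
structure Triangulation (Ω : Set (Euc n)) where
  complex : Geometry.SimplicialComplex ℝ (Euc n)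
  finite : complex.faces.Finite
  space_eq : complex.space = closure Ω
  interior_eq : interior complex.space = Ω

namespace Triangulation

variable {Ω : Set (Euc n)}

/-- The elements `K ∈ 𝒯_h`, i.e. the `n`-simplices. -/
def cells (T : Triangulation Ω) : Finset (Finset (Euc n)) :=
  T.finite.toFinset.filter fun K => K.card = n + 1

/-- The elements that have `e` as a face. -/
def cellsAt (T : Triangulation Ω) (e : Finset (Euc n)) : Finset (Finset (Euc n)) :=
  T.cells.filter fun K => e ⊆ K

/-- The set `ℰ_h⁰` of interior `(n-1)`-simplices, i.e. those `e = K₁ ∩ K₂` that are shared by two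
elements. -/
def interiorFaces (T : Triangulation Ω) : Finset (Finset (Euc n)) :=
  T.finite.toFinset.filter fun e => e.card = n ∧ (T.cellsAt e).card = 2

end Triangulation

/-- The diameter `h_K`. -/
def simplexDiam (K : Finset (Euc n)) : ℝ :=
  Metric.diam (convexHull ℝ (K : Set (Euc n)))

/-- The inradius `ρ_K`: the largest radius of a closed ball contained in the simplex. -/
def simplexInradius (K : Finset (Euc n)) : ℝ :=
  sSup {ρ : ℝ | 0 ≤ ρ ∧ ∃ x, Metric.closedBall x ρ ⊆ convexHull ℝ (K : Set (Euc n))}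

/-- The maximum element diameter `h`. -/
def Triangulation.meshSize {Ω : Set (Euc n)} (T : Triangulation Ω) : ℝ :=
  sSup (simplexDiam '' (T.cells : Set (Finset (Euc n))))

/-- The family `T` is shape-regular and quasi-uniform: `h_K / ρ_K ≤ C₁` and `h / h_K ≤ C₂` with
constants independent of the triangulation and of the element. -/
def ShapeRegularQuasiUniform {Ω : Set (Euc n)} {ι : Type*} (T : ι → Triangulation Ω) : Prop :=
  ∃ C₁ C₂ : ℝ, 0 < C₁ ∧ 0 < C₂ ∧ ∀ i, ∀ K ∈ (T i).cells,
    simplexDiam K ≤ C₁ * simplexInradius K ∧ (T i).meshSize ≤ C₂ * simplexDiam K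

/-! ### The finite element space `V_h^r` -/

/-- The function on `ℝⁿ` given by a polynomial. -/
def polyFun (P : MvPolynomial (Fin n) ℝ) (x : Euc n) : ℝ :=
  MvPolynomial.eval (fun i => x i) P

/-- `f` coincides (almost everywhere) with the polynomial `P` on the simplex `K`. -/
def EqPolyOn (Ω : Set (Euc n)) (f : Euc n → ℝ) (K : Finset (Euc n))
    (P : MvPolynomial (Fin n) ℝ) : Prop :=
  ∀ᵐ x ∂(volume.restrict Ω), x ∈ convexHull ℝ (K : Set (Euc n)) → f x = polyFun P x

/-- `V_h^r = {f ∈ L²(Ω) | f|_K ∈ P_r(K) for all K ∈ 𝒯_h}`. -/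
def Vh {Ω : Set (Euc n)} (T : Triangulation Ω) (r : ℕ) :
    Submodule ℝ (Lp ℝ 2 (volume.restrict Ω)) where
  carrier := {f | ∀ K ∈ T.cells, ∃ P : MvPolynomial (Fin n) ℝ,
    P.totalDegree ≤ r ∧ EqPolyOn Ω f K P}
  zero_mem' := by
    intro K _
    refine ⟨0, by simp, ?_⟩
    filter_upwards [Lp.coeFn_zero ℝ 2 (volume.restrict Ω)] with x hx _
    exact hx.trans (by simp [polyFun])
  add_mem' := by
    intro f g hf hg K hK
    obtain ⟨P, hP, hfP⟩ := hf K hK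
    obtain ⟨Q, hQ, hgQ⟩ := hg K hK
    refine ⟨P + Q, (MvPolynomial.totalDegree_add P Q).trans (max_le hP hQ), ?_⟩
    filter_upwards [Lp.coeFn_add f g, hfP, hgQ] with x hx h1 h2 hxK
    refine hx.trans ?_
    rw [Pi.add_apply, h1 hxK, h2 hxK]
    simp [polyFun]
  smul_mem' := by
    intro c f hf K hK
    obtain ⟨P, hP, hfP⟩ := hf K hK
    refine ⟨c • P, (MvPolynomial.totalDegree_smul_le c P).trans hP, ?_⟩
    filter_upwards [Lp.coeFn_smul c f, hfP] with x hx h1 hxK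
    refine hx.trans ?_
    rw [Pi.smul_apply, h1 hxK]
    simp [polyFun]

open Classical in
/-- The polynomial that `f` coincides with on the simplex `K` (unique when `K` is an element of a
triangulation of `Ω`; `0` if there is none). -/
def localPoly (Ω : Set (Euc n)) (f : Euc n → ℝ) (K : Finset (Euc n)) :
    MvPolynomial (Fin n) ℝ :=
  if h : ∃ P, EqPolyOn Ω f K P then h.choose else 0

/-- `f|_K`, as a polynomial function (so that it also has values on `∂K`). -/
def localFun (Ω : Set (Euc n)) (f : Euc n → ℝ) (K : Finset (Euc n)) : Euc n → ℝ :=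
  polyFun (localPoly Ω f K)

/-! ### Integrals of normal components over faces -/

open Classical in
/-- The barycentric coordinate `λ_v(x)` of `x` with respect to the vertex `v` of the
nondegenerate `n`-simplex `K` (and `0` if `K` is not such a simplex or `v ∉ K`). -/
def bary (K : Finset (Euc n)) (v x : Euc n) : ℝ :=
  if h : (AffineIndependent ℝ ((↑) : K → Euc n) ∧
      affineSpan ℝ (Set.range ((↑) : K → Euc n)) = ⊤) ∧ v ∈ K then
    (AffineBasis.mk ((↑) : K → Euc n) h.1.1 h.1.2).coord ⟨v, h.2⟩ x
  else 0

open Classical in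
/-- For a facet `e` of the simplex `K`, the function `P / (P + λ)` on `K`, with `P` the product of
the barycentric coordinates of the vertices of `e` and `λ` that of the vertex opposite to `e`.
It takes values in `[0, 1]`, is smooth in the interior of `K`, equals `1` on the
relative interior of `e` and `0` on the other facets away from `e`, and lies in `W^{1,q}(K)` for all
`q < 2`. So it extends the indicator function of `e` from `∂K` to `K`. -/
def faceCutoff (K e : Finset (Euc n)) (x : Euc n) : ℝ :=
  (∏ v ∈ e, bary K v x) / ((∏ v ∈ e, bary K v x) + ∑ v ∈ K \ e, bary K v x)

/-- `∫_e (u · n_K) φ ds` for a facet `e` of the simplex `K` with outward normal `n_K`, a vector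
field `u ∈ H(div, K) ∩ L^p(K)^n`, `p > 2`, `div u = d`, and `φ` smooth: the pairing of the normal
trace of `u` on `∂K` with the function on `∂K` which is `φ` on `e` and `0` on the rest of `∂K`. The
pairing is evaluated on the extension `φ · faceCutoff K e` of that function to `K`; it is bounded
with gradient in `L^q(K)` for all `q < 2`, so the integral converges absolutely, and by Green's
formula the value is the same for every such extension. -/
def faceFlux (u : Euc n → Euc n) (d : Euc n → ℝ) (K e : Finset (Euc n)) (φ : Euc n → ℝ) : ℝ :=
  normalPairing (convexHull ℝ (K : Set (Euc n))) u d fun x => φ x * faceCutoff K e x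

/-! ### The operator `A_u` -/

/-- The average `{g} = (g₁ + g₂)/2` on the interior face `e = K₁ ∩ K₂`. -/
def average {Ω : Set (Euc n)} (T : Triangulation Ω) (g : Euc n → ℝ) (e : Finset (Euc n))
    (x : Euc n) : ℝ :=
  (1 / 2) * ∑ K ∈ T.cellsAt e, localFun Ω g K x

/-- `∫_e u · ⟦f⟧ {g} ds`, with the jump `⟦f⟧ = f₁ n₁ + f₂ n₂`, on the interior face
`e = K₁ ∩ K₂`; here `nᵢ` is the normal to `e` pointing out of `Kᵢ`, and `fᵢ = f|_{Kᵢ}`. -/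
def jumpTerm {Ω : Set (Euc n)} (T : Triangulation Ω) (u : Euc n → Euc n) (d : Euc n → ℝ)
    (f g : Euc n → ℝ) (e : Finset (Euc n)) : ℝ :=
  ∑ K ∈ T.cellsAt e, faceFlux u d K e fun x => localFun Ω f K x * average T g e x

/-- `∑_K ∫_K (∇_u f) g dx - ∑_{e ∈ ℰ_h⁰} ∫_e u · ⟦f⟧ {g} ds`. -/
def dirForm {Ω : Set (Euc n)} (T : Triangulation Ω) (u : Euc n → Euc n) (d : Euc n → ℝ)
    (f g : Euc n → ℝ) : ℝ :=
  (∑ K ∈ T.cells, ∫ x in convexHull ℝ (K : Set (Euc n)),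
      fderiv ℝ (localFun Ω f K) x (u x) * localFun Ω g K x)
    - ∑ e ∈ T.interiorFaces, jumpTerm T u d f g e

/-- `A = A_u`, i.e. `⟨A f, g⟩ = ∑_K ∫_K (∇_u f) g dx - ∑_{e ∈ ℰ_h⁰} ∫_e u · ⟦f⟧ {g} ds` for all
`f, g ∈ V_h^r`, with `⟨·,·⟩` the inner product of `L²(Ω)`. -/
def IsDirOperator {Ω : Set (Euc n)} (T : Triangulation Ω) (r : ℕ) (u : Euc n → Euc n)
    (d : Euc n → ℝ) (A : Vh T r →ₗ[ℝ] Vh T r) : Prop :=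
  ∀ f g : Vh T r, inner ℝ (A f) g
    = dirForm T u d (f : Lp ℝ 2 (volume.restrict Ω)) (g : Lp ℝ 2 (volume.restrict Ω))

/-! ### Consistent approximations -/

/-- The family of operators `A i ∈ L(V_h^r, V_h^r)` (with `V_h^r` that of the triangulation `T i`)
is a consistent approximation of `∇_u^dist` in `V_h^r` along the filter `l` (in other words, it
approximates `-u`): whenever `f ∈ L²(Ω)`, `f_h ∈ V_h^r` and `‖f - f_h‖_{L²(Ω)} → 0`, we have
`⟨A f_h - ∇_u^dist f, g⟩ → 0` for all `g ∈ C₀^∞(Ω)`. -/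
def IsConsistent {Ω : Set (Euc n)} {ι : Type*} (l : Filter ι) (T : ι → Triangulation Ω) (r : ℕ)
    (u : Euc n → Euc n) (d : Euc n → ℝ) (A : ∀ i, Vh (T i) r →ₗ[ℝ] Vh (T i) r) : Prop :=
  ∀ (f : Lp ℝ 2 (volume.restrict Ω)) (fh : ∀ i, Vh (T i) r),
    Tendsto (fun i => ‖f - (fh i : Lp ℝ 2 (volume.restrict Ω))‖) l (𝓝 0) →
    ∀ g : Euc n → ℝ, IsTest Ω g →
      Tendsto (fun i =>
        (∫ x in Ω, (A i (fh i) : Lp ℝ 2 (volume.restrict Ω)) x * g x) - distDeriv Ω u d f g)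
        l (𝓝 0)

/-- `‖g - g_h‖_{L²(Ω)}`. -/
def l2Dist (Ω : Set (Euc n)) (g gh : Euc n → ℝ) : ℝ :=
  (eLpNorm (fun x => g x - gh x) 2 (volume.restrict Ω)).toReal

/-- The broken seminorm `(∑_K |g - g_h|²_{H¹(K)})^{1/2}`. -/
def brokenH1Dist {Ω : Set (Euc n)} (T : Triangulation Ω) (g gh : Euc n → ℝ) : ℝ :=
  Real.sqrt (∑ K ∈ T.cells, ∫ x in convexHull ℝ (K : Set (Euc n)),
    ‖fderiv ℝ (fun y => g y - localFun Ω gh K y) x‖ ^ 2)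

/-! ### Facts that support the definitions -/

theorem integrable_clm_apply {Ω : Set (Euc n)} {u : Euc n → Euc n}
    (hu : MemLp u 2 (volume.restrict Ω)) {B : Euc n → (Euc n →L[ℝ] ℝ)} (hB : Continuous B)
    (hc : HasCompactSupport B) : Integrable (fun x => B x (u x)) (volume.restrict Ω) := by
  have hB2 : MemLp B 2 (volume.restrict Ω) :=
    (hB.memLp_of_hasCompactSupport (μ := volume) hc).restrict Ω
  have h1 : Integrable (fun x => ‖B x‖ * ‖u x‖) (volume.restrict Ω) :=
    hB2.norm.integrable_mul hu.norm
  refine h1.mono' ?_ (Eventually.of_forall fun x => (B x).le_opNorm (u x))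
  exact (ContinuousLinearMap.id ℝ (Euc n →L[ℝ] ℝ)).aestronglyMeasurable_comp₂
    hB2.aestronglyMeasurable hu.aestronglyMeasurable

/-- If `u ∈ H(div, Ω)`, then `g u` has weak divergence `u · ∇g + g div u` for all test functions
`g`. -/
theorem hasWeakDiv_smul {Ω : Set (Euc n)} {u : Euc n → Euc n} {d : Euc n → ℝ}
    (hu : IsHDiv Ω u d) {g : Euc n → ℝ} (hg : IsTest Ω g) :
    HasWeakDiv Ω (fun x => g x • u x) (divMul u d g) := by
  intro φ hφ
  have hgφ : IsTest Ω (fun x => g x * φ x) :=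
    ⟨hg.smooth.mul hφ.smooth, hg.compact.mul_right,
      (tsupport_mul_subset_left (f := g) (g := φ)).trans hg.supp⟩
  have hder : ∀ x, fderiv ℝ (fun x => g x * φ x) x (u x)
      = (g x • fderiv ℝ φ x) (u x) + (φ x • fderiv ℝ g x) (u x) := by
    intro x
    have h := fderiv_fun_mul (hg.smooth.differentiable (by simp) x)
      (hφ.smooth.differentiable (by simp) x)
    rw [h]; rfl
  have i1 : Integrable (fun x => (g x • fderiv ℝ φ x) (u x)) (volume.restrict Ω) :=
    integrable_clm_apply hu.memLp
      (hg.smooth.continuous.smul (hφ.smooth.continuous_fderiv (by simp))) hg.compact.smul_right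
  have i2 : Integrable (fun x => (φ x • fderiv ℝ g x) (u x)) (volume.restrict Ω) :=
    integrable_clm_apply hu.memLp
      (hφ.smooth.continuous.smul (hg.smooth.continuous_fderiv (by simp))) hφ.compact.smul_right
  have i3 : Integrable (fun x => d x * (g x * φ x)) (volume.restrict Ω) :=
    MemLp.integrable_mul (p := 2) (q := 2) hu.memLp_div
      ((hgφ.smooth.continuous.memLp_of_hasCompactSupport (μ := volume) hgφ.compact).restrict Ω)
  have key := hu.weakDiv _ hgφ
  simp_rw [hder] at key
  rw [integral_add i1 i2] at key
  have e1 : ∫ x in Ω, fderiv ℝ φ x (g x • u x) = ∫ x in Ω, (g x • fderiv ℝ φ x) (u x) := by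
    simp
  have e2 : ∫ x in Ω, divMul u d g x * φ x
      = (∫ x in Ω, (φ x • fderiv ℝ g x) (u x)) + ∫ x in Ω, d x * (g x * φ x) := by
    rw [← integral_add i2 i3]
    refine integral_congr_ae (Eventually.of_forall fun x => ?_)
    simp only [divMul, FunLike.coe_smul, Pi.smul_apply, smul_eq_mul]
    ring
  rw [e1, e2]
  linarith

/-- `faceCutoff K e` equals `1` at the points of the facet `e` that are not on a lower-dimensional
face. -/
theorem faceCutoff_eq_one {K e : Finset (Euc n)} {x : Euc n}
    (h1 : ∀ v ∈ e, bary K v x ≠ 0) (h0 : ∀ v ∈ K, v ∉ e → bary K v x = 0) :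
    faceCutoff K e x = 1 := by
  classical
  have hs : ∑ v ∈ K \ e, bary K v x = 0 :=
    Finset.sum_eq_zero fun v hv => h0 v (Finset.mem_sdiff.1 hv).1 (Finset.mem_sdiff.1 hv).2
  have hp : ∏ v ∈ e, bary K v x ≠ 0 := Finset.prod_ne_zero_iff.2 h1
  unfold faceCutoff
  convert div_self hp using 2
  convert add_zero _

/-- `faceCutoff K e` vanishes on the facets opposite to the vertices of `e`. -/
theorem faceCutoff_eq_zero {K e : Finset (Euc n)} {x : Euc n}
    (h : ∃ v ∈ e, bary K v x = 0) : faceCutoff K e x = 0 := by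
  obtain ⟨v, hv, h0⟩ := h
  unfold faceCutoff
  rw [Finset.prod_eq_zero hv h0, zero_div]

end FEDirDeriv

end

open MeasureTheory Filter Topology
open scoped ContDiff ENNReal

noncomputable section

namespace FEDirDeriv

variable {n : ℕ}

/-! ### Nondegenerate simplices and barycentric coordinates -/

/-! `A_u` is the Riesz representative of a bilinear form on a finite-dimensional space, so its
existence and uniqueness only need the face terms to converge and to be linear. The point is that
the normal trace can be restricted to a single facet. Up to a constant, the cutoff `P / (P + λ)` has
gradient at most `1 / (P + λ)`, and `(P + λ)² ≥ P λ` bounds this by the weight `wt`, the inverse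
square root of the product of all barycentric coordinates. This weight lies in `L^s` for every `s <
2`, so it can be paired with `u ∈ L^p`, `p > 2`.

Built from hat functions and with a positive constant added to the denominator, the cutoffs become
Lipschitz on all of `closure Ω`. For such functions Green's formula with `u ∈ H₀(div)` follows by
mollification, and dominated convergence carries it over to the cutoffs themselves
(`sum_normalPairing_eq_zero`). Hence the fluxes on the two sides of an interior facet cancel and
those on the boundary vanish (`sum_faceFlux_eq_zero`), the trace on `∂K` is the sum of its
restrictions to the facets (`normalPairing_eq_sum_faceFlux`), and a bounded `u` has bounded fluxes
(`abs_faceFlux_le_of_bounded`).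

For consistency, elementwise integration by parts (`FluxData.green`) shows that the form with a
smooth `g` in both slots equals `-∫ f_h div (g u)` exactly. Since `A_u f_h ∈ V_h^r`, one may test
with the `L²` projection of `g`, and the error involves only its difference from `g`, which is
`O(h)` with bounded gradient. The inverse estimate costs `h⁻¹` on `f_h`, so the error is at most `C
‖f_h‖` uniformly in `h`. If `f_h` is the projection of a smooth `φ`, the error is `O(h)`, because
`φ` does not jump and drops out of the face terms. Density of smooth functions in `L²` then gives
the limit (`isConsistent_of_isDirOperator`).

For the comparison with another operator `A`, consistency of both makes `⟨(A - A_u) f_h, g⟩` tend to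
zero. The remainder is tested against `g_h - g = o(h)`, while `A f_h` and `A_u f_h` are both
`O(h⁻¹)`, the latter by inverse estimates and bounded fluxes (`exists_dirOperator_bound`). -/

/-- `K` is the vertex set of a nondegenerate `n`-simplex in `ℝⁿ`. -/
structure IsSimplex (K : Finset (Euc n)) : Prop where
  indep : AffineIndependent ℝ ((↑) : K → Euc n)
  span : affineSpan ℝ (Set.range ((↑) : K → Euc n)) = ⊤

/-- The affine basis formed by the vertices of a simplex. -/
def IsSimplex.basis {K : Finset (Euc n)} (hK : IsSimplex K) : AffineBasis K ℝ (Euc n) :=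
  ⟨((↑) : K → Euc n), hK.indep, hK.span⟩

theorem IsSimplex.range_basis {K : Finset (Euc n)} (hK : IsSimplex K) :
    Set.range hK.basis = (K : Set (Euc n)) := by
  change Set.range ((↑) : K → Euc n) = _
  simp

theorem bary_of_notMem {K : Finset (Euc n)} {v : Euc n} (hv : v ∉ K) (x : Euc n) :
    bary K v x = 0 := by
  unfold bary
  rw [dif_neg (fun h => hv h.2)]

theorem IsSimplex.bary_of_mem {K : Finset (Euc n)} (hK : IsSimplex K) {v : Euc n} (hv : v ∈ K)
    (x : Euc n) : bary K v x = hK.basis.coord ⟨v, hv⟩ x := by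
  unfold bary
  rw [dif_pos ⟨⟨hK.indep, hK.span⟩, hv⟩]
  rfl

theorem IsSimplex.sum_bary {K : Finset (Euc n)} (hK : IsSimplex K) (x : Euc n) :
    ∑ v ∈ K, bary K v x = 1 := by
  rw [← Finset.sum_attach, ← hK.basis.sum_coord_apply_eq_one x]
  exact Finset.sum_congr rfl fun v _ => hK.bary_of_mem v.2 x

theorem IsSimplex.sum_bary_smul {K : Finset (Euc n)} (hK : IsSimplex K) (x : Euc n) :
    ∑ v ∈ K, bary K v x • v = x := by
  rw [← Finset.sum_attach]
  conv_rhs => rw [← hK.basis.linear_combination_coord_eq_self x]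
  exact Finset.sum_congr rfl fun v _ => by rw [hK.bary_of_mem v.2 x]; rfl

theorem IsSimplex.mem_convexHull_iff {K : Finset (Euc n)} (hK : IsSimplex K) {x : Euc n} :
    x ∈ convexHull ℝ (K : Set (Euc n)) ↔ ∀ v ∈ K, 0 ≤ bary K v x := by
  rw [← hK.range_basis, hK.basis.convexHull_eq_nonneg_coord]
  constructor
  · intro h v hv
    rw [hK.bary_of_mem hv]
    exact h ⟨v, hv⟩
  · intro h v
    rw [← hK.bary_of_mem v.2]
    exact h v v.2

theorem IsSimplex.mem_interior_iff {K : Finset (Euc n)} (hK : IsSimplex K) {x : Euc n} :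
    x ∈ interior (convexHull ℝ (K : Set (Euc n))) ↔ ∀ v ∈ K, 0 < bary K v x := by
  rw [← hK.range_basis, hK.basis.interior_convexHull]
  constructor
  · intro h v hv
    rw [hK.bary_of_mem hv]
    exact h ⟨v, hv⟩
  · intro h v
    rw [← hK.bary_of_mem v.2]
    exact h v v.2

theorem IsSimplex.bary_nonneg {K : Finset (Euc n)} (hK : IsSimplex K) {x : Euc n}
    (hx : x ∈ convexHull ℝ (K : Set (Euc n))) (v : Euc n) : 0 ≤ bary K v x := by
  by_cases hv : v ∈ K
  · exact hK.mem_convexHull_iff.1 hx v hv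
  · rw [bary_of_notMem hv]

theorem IsSimplex.bary_le_one {K : Finset (Euc n)} (hK : IsSimplex K) {x : Euc n}
    (hx : x ∈ convexHull ℝ (K : Set (Euc n))) (v : Euc n) : bary K v x ≤ 1 := by
  by_cases hv : v ∈ K
  · rw [← hK.sum_bary x]
    exact Finset.single_le_sum (f := fun v => bary K v x) (fun w _ => hK.bary_nonneg hx w) hv
  · rw [bary_of_notMem hv]; exact zero_le_one

/-- The fallback value `0` in the definition is affine too, so the calculus of `bary` needs no
hypothesis on `K`. -/
theorem bary_eq_affineMap (K : Finset (Euc n)) (v : Euc n) :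
    ∃ A : Euc n →ᵃ[ℝ] ℝ, ∀ x, bary K v x = A x := by
  unfold bary
  split_ifs with h
  · exact ⟨_, fun x => rfl⟩
  · exact ⟨AffineMap.const ℝ (Euc n) 0, fun x => rfl⟩

/-- The gradient of a barycentric coordinate. -/
def baryGrad (K : Finset (Euc n)) (v : Euc n) : Euc n →L[ℝ] ℝ := fderiv ℝ (bary K v) 0

theorem bary_eq_add (K : Finset (Euc n)) (v x y : Euc n) :
    bary K v x = bary K v y + baryGrad K v (x - y) := by
  obtain ⟨A, hA⟩ := bary_eq_affineMap K v
  have h1 : bary K v = fun x => (LinearMap.toContinuousLinearMap A.linear) x + A 0 := by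
    funext x
    rw [hA x]
    have := congrFun (AffineMap.decomp A) x
    simpa using this
  have h2 : baryGrad K v = LinearMap.toContinuousLinearMap A.linear := by
    unfold baryGrad
    rw [h1]
    exact ((ContinuousLinearMap.hasFDerivAt _).add_const _).fderiv
  rw [h2, h1]
  simp only [LinearMap.coe_toContinuousLinearMap', map_sub]
  ring

theorem bary_hasStrictFDerivAt (K : Finset (Euc n)) (v x : Euc n) :
    HasStrictFDerivAt (bary K v) (baryGrad K v) x := by
  have h : bary K v = fun x => bary K v 0 + baryGrad K v x := by
    funext y
    rw [bary_eq_add K v y 0, sub_zero]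
  rw [h]
  exact (baryGrad K v).hasStrictFDerivAt.const_add _

theorem continuous_bary (K : Finset (Euc n)) (v : Euc n) : Continuous (bary K v) :=
  continuous_iff_continuousAt.2 fun x => (bary_hasStrictFDerivAt K v x).continuousAt

theorem IsSimplex.bary_sum_smul {K : Finset (Euc n)} (hK : IsSimplex K) {w : Euc n → ℝ}
    (hw : ∑ v ∈ K, w v = 1) {v : Euc n} (hv : v ∈ K) : bary K v (∑ u ∈ K, w u • u) = w v := by
  rw [hK.bary_of_mem hv]
  have h1 : ∑ u ∈ K, w u • u = Finset.univ.affineCombination ℝ hK.basis (fun u : K => w u) := by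
    rw [Finset.affineCombination_eq_linear_combination]
    · rw [← Finset.sum_attach]; rfl
    · rw [← hw, ← Finset.sum_attach K]; rfl
  rw [h1, hK.basis.coord_apply_combination_of_mem (Finset.mem_univ _)]
  rw [← hw, ← Finset.sum_attach K]; rfl

/-- If a point is a convex combination of some of the vertices, its barycentric coordinates are the
weights. -/
theorem IsSimplex.bary_of_mem_face {K L : Finset (Euc n)} (hK : IsSimplex K) (hL : L ⊆ K)
    {w : Euc n → ℝ} (hw : ∑ v ∈ L, w v = 1) (v : Euc n) :
    bary K v (∑ u ∈ L, w u • u) = if v ∈ L then w v else 0 := by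
  by_cases hv : v ∈ K
  · have h1 : ∑ u ∈ K, (if u ∈ L then w u else 0) = 1 := by
      rw [← Finset.sum_filter, Finset.filter_mem_eq_inter, Finset.inter_eq_right.2 hL, hw]
    have h2 : ∑ u ∈ K, (if u ∈ L then w u else 0) • u = ∑ u ∈ L, w u • u := by
      simp_rw [ite_smul, zero_smul]
      rw [← Finset.sum_filter, Finset.filter_mem_eq_inter, Finset.inter_eq_right.2 hL]
    rw [← h2]
    exact hK.bary_sum_smul h1 hv
  · rw [bary_of_notMem hv, if_neg (fun h => hv (hL h))]

theorem IsSimplex.bary_vertex {K : Finset (Euc n)} (hK : IsSimplex K) {u : Euc n} (hu : u ∈ K)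
    (v : Euc n) : bary K v u = if v = u then 1 else 0 := by
  have := hK.bary_of_mem_face (Finset.singleton_subset_iff.2 hu) (w := fun _ => 1) (by simp) v
  simpa using this

theorem isCompact_simplex (K : Finset (Euc n)) : IsCompact (convexHull ℝ (K : Set (Euc n))) :=
  K.finite_toSet.isCompact_convexHull ℝ

theorem volume_frontier_simplex (K : Finset (Euc n)) :
    volume (frontier (convexHull ℝ (K : Set (Euc n)))) = 0 :=
  (convex_convexHull ℝ _).addHaar_frontier _

theorem interior_ae_eq_simplex (K : Finset (Euc n)) :
    (interior (convexHull ℝ (K : Set (Euc n))) : Set (Euc n)) =ᵐ[volume]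
      convexHull ℝ (K : Set (Euc n)) :=
  interior_ae_eq_of_null_frontier (volume_frontier_simplex K)

theorem ae_mem_interior_simplex (K : Finset (Euc n)) :
    ∀ᵐ x ∂(volume.restrict (convexHull ℝ (K : Set (Euc n)))),
      x ∈ interior (convexHull ℝ (K : Set (Euc n))) := by
  rw [← Measure.restrict_congr_set (interior_ae_eq_simplex K)]
  exact ae_restrict_mem isOpen_interior.measurableSet

theorem IsSimplex.interior_nonempty {K : Finset (Euc n)} (hK : IsSimplex K) :
    (interior (convexHull ℝ (K : Set (Euc n)))).Nonempty := by
  rw [interior_convexHull_nonempty_iff_affineSpan_eq_top]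
  have := hK.span
  simpa using this

theorem IsSimplex.card_eq {K : Finset (Euc n)} (hK : IsSimplex K) : K.card = n + 1 := by
  have := (hK.indep.affineSpan_eq_top_iff_card_eq_finrank_add_one).1 hK.span
  simpa using this

/-! ### Elements of a triangulation -/

namespace Triangulation

variable {Ω : Set (Euc n)} (T : Triangulation Ω)

theorem mem_cells {K : Finset (Euc n)} : K ∈ T.cells ↔ K ∈ T.complex.faces ∧ K.card = n + 1 := by
  simp [cells]

theorem mem_cellsAt {e K : Finset (Euc n)} : K ∈ T.cellsAt e ↔ K ∈ T.cells ∧ e ⊆ K := by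
  simp [cellsAt]

variable {T}

theorem isSimplex {K : Finset (Euc n)} (hK : K ∈ T.cells) : IsSimplex K := by
  rw [mem_cells] at hK
  have h := T.complex.indep hK.1
  refine ⟨h, ?_⟩
  rw [h.affineSpan_eq_top_iff_card_eq_finrank_add_one]
  simpa using hK.2

theorem simplex_subset_closure {K : Finset (Euc n)} (hK : K ∈ T.cells) :
    convexHull ℝ (K : Set (Euc n)) ⊆ closure Ω := by
  rw [← T.space_eq]
  exact T.complex.convexHull_subset_space ((T.mem_cells).1 hK).1

theorem interior_simplex_subset {K : Finset (Euc n)} (hK : K ∈ T.cells) :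
    interior (convexHull ℝ (K : Set (Euc n))) ⊆ Ω := by
  conv_rhs => rw [← T.interior_eq]
  exact interior_mono (T.complex.convexHull_subset_space ((T.mem_cells).1 hK).1)

theorem isOpen (T : Triangulation Ω) : IsOpen Ω := T.interior_eq ▸ isOpen_interior

theorem volume_face_eq_zero {s : Finset (Euc n)} (hs : s ∈ T.complex.faces)
    (hc : s.card ≠ n + 1) : volume (convexHull ℝ (s : Set (Euc n))) = 0 := by
  have h := T.complex.indep hs
  have h2 : affineSpan ℝ (s : Set (Euc n)) ≠ ⊤ := by
    intro h3
    have := (h.affineSpan_eq_top_iff_card_eq_finrank_add_one).1 (by simpa using h3)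
    exact hc (by simpa using this)
  exact measure_mono_null (convexHull_subset_affineSpan _) (Measure.addHaar_affineSubspace _ _ h2)

/-- The part of `Ω` outside the closed union of the cells is open and is covered by finitely many
lower-dimensional faces, which are null; so it is empty. Purity of the complex is thus a consequence
of `interior_eq`. -/
theorem closure_eq_iUnion_cells (T : Triangulation Ω) :
    closure Ω = ⋃ K ∈ T.cells, convexHull ℝ (K : Set (Euc n)) := by
  apply Set.Subset.antisymm
  · have hcl : IsClosed (⋃ K ∈ T.cells, convexHull ℝ (K : Set (Euc n))) :=
      T.cells.finite_toSet.isClosed_biUnion fun K _ => (isCompact_simplex K).isClosed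
    apply closure_minimal _ hcl
    by_contra hne
    rw [Set.not_subset] at hne
    obtain ⟨x, hx, hxn⟩ := hne
    have hop : IsOpen (Ω \ ⋃ K ∈ T.cells, convexHull ℝ (K : Set (Euc n))) := T.isOpen.sdiff hcl
    have hpos := hop.measure_pos volume ⟨x, hx, hxn⟩
    refine hpos.ne' (measure_mono_null (t := ⋃ s ∈ T.finite.toFinset.filter (·.card ≠ n + 1),
      convexHull ℝ (s : Set (Euc n))) ?_ ?_)
    · rintro y ⟨hy, hyn⟩
      have hy2 : y ∈ T.complex.space := by rw [T.space_eq]; exact subset_closure hy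
      obtain ⟨s, hs, hys⟩ := Geometry.SimplicialComplex.mem_space_iff.1 hy2
      simp only [Set.mem_iUnion, not_exists] at hyn
      simp only [Set.mem_iUnion, Finset.mem_filter, Set.Finite.mem_toFinset]
      exact ⟨s, ⟨hs, fun hc => hyn s (T.mem_cells.2 ⟨hs, hc⟩) hys⟩, hys⟩
    · refine (measure_biUnion_null_iff (Finset.countable_toSet _)).2 ?_
      intro s hs
      simp only [Finset.coe_filter, Set.Finite.mem_toFinset, Set.mem_ofPred_eq] at hs
      exact T.volume_face_eq_zero hs.1 hs.2
  · exact Set.iUnion₂_subset fun K hK => T.simplex_subset_closure hK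

theorem exists_cell_of_mem_closure (T : Triangulation Ω) {x : Euc n} (hx : x ∈ closure Ω) :
    ∃ K ∈ T.cells, x ∈ convexHull ℝ (K : Set (Euc n)) := by
  rw [T.closure_eq_iUnion_cells] at hx
  simpa using hx

theorem cells_nonempty (T : Triangulation Ω) (h : Ω.Nonempty) : T.cells.Nonempty := by
  obtain ⟨x, hx⟩ := h
  obtain ⟨K, hK, _⟩ := T.exists_cell_of_mem_closure (subset_closure hx)
  exact ⟨K, hK⟩

/-- In a simplicial complex a common point of two cells is a convex combination of their common
vertices, and the weights are its barycentric coordinates in either cell. Hat functions are well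
defined for this reason. -/
theorem bary_eq_bary {K L : Finset (Euc n)} (hK : K ∈ T.cells) (hL : L ∈ T.cells) {x : Euc n}
    (hxK : x ∈ convexHull ℝ (K : Set (Euc n))) (hxL : x ∈ convexHull ℝ (L : Set (Euc n)))
    (v : Euc n) : bary K v x = bary L v x := by
  have h := T.complex.inter_subset_convexHull ((T.mem_cells).1 hK).1 ((T.mem_cells).1 hL).1
    ⟨hxK, hxL⟩
  rw [← Finset.coe_inter, Finset.mem_convexHull'] at h
  obtain ⟨w, _, hw1, rfl⟩ := h
  rw [(isSimplex hK).bary_of_mem_face Finset.inter_subset_left hw1,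
    (isSimplex hL).bary_of_mem_face Finset.inter_subset_right hw1]

/-- At a common interior point every vertex of `K` has a positive coordinate, whereas the coordinate
in `L` vanishes at a vertex outside `L`. -/
theorem disjoint_interior {K L : Finset (Euc n)} (hK : K ∈ T.cells) (hL : L ∈ T.cells)
    (hne : K ≠ L) : Disjoint (interior (convexHull ℝ (K : Set (Euc n))))
      (interior (convexHull ℝ (L : Set (Euc n)))) := by
  rw [Set.disjoint_left]
  intro x hxK hxL
  apply hne
  apply Finset.eq_of_subset_of_card_le
  · intro v hv
    by_contra hvL
    have h1 := (isSimplex hK).mem_interior_iff.1 hxK v hv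
    rw [T.bary_eq_bary hK hL (interior_subset hxK) (interior_subset hxL),
      bary_of_notMem hvL] at h1
    exact lt_irrefl _ h1
  · rw [((T.mem_cells).1 hK).2, ((T.mem_cells).1 hL).2]

theorem volume_closure_diff (T : Triangulation Ω) : volume (closure Ω \ Ω) = 0 := by
  refine measure_mono_null (t := ⋃ K ∈ T.cells, frontier (convexHull ℝ (K : Set (Euc n)))) ?_ ?_
  · rintro x ⟨hx, hxn⟩
    obtain ⟨K, hK, hxK⟩ := T.exists_cell_of_mem_closure hx
    simp only [Set.mem_iUnion]
    exact ⟨K, hK, subset_closure hxK, fun h => hxn (interior_simplex_subset hK h)⟩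
  · exact (measure_biUnion_null_iff (Finset.countable_toSet _)).2
      fun K _ => volume_frontier_simplex K

theorem ae_eq_closure (T : Triangulation Ω) : (Ω : Set (Euc n)) =ᵐ[volume] closure Ω := by
  refine EventuallyLE.antisymm (LE.le.eventuallyLE subset_closure) ?_
  exact ae_le_set.2 T.volume_closure_diff

theorem ae_eq_iUnion_interior (T : Triangulation Ω) :
    (Ω : Set (Euc n)) =ᵐ[volume] ⋃ K ∈ T.cells, interior (convexHull ℝ (K : Set (Euc n))) := by
  refine T.ae_eq_closure.trans ?_
  rw [T.closure_eq_iUnion_cells]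
  exact (Finset.eventuallyEq_iUnion T.cells fun K _ => interior_ae_eq_simplex K).symm

theorem ae_mem_interior (T : Triangulation Ω) : ∀ᵐ x ∂(volume.restrict Ω),
    ∃ K ∈ T.cells, x ∈ interior (convexHull ℝ (K : Set (Euc n))) := by
  rw [Measure.restrict_congr_set T.ae_eq_iUnion_interior]
  have hm : MeasurableSet (⋃ K ∈ T.cells, interior (convexHull ℝ (K : Set (Euc n)))) :=
    (isOpen_biUnion fun K _ => isOpen_interior).measurableSet
  filter_upwards [ae_restrict_mem hm] with x hx
  simpa using hx

theorem integral_eq_sum (T : Triangulation Ω) {F : Euc n → ℝ} (hF : IntegrableOn F Ω) :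
    ∫ x in Ω, F x = ∑ K ∈ T.cells, ∫ x in convexHull ℝ (K : Set (Euc n)), F x := by
  rw [setIntegral_congr_set T.ae_eq_iUnion_interior]
  rw [integral_biUnion_finset T.cells (fun K _ => isOpen_interior.measurableSet)]
  · exact Finset.sum_congr rfl fun K _ => setIntegral_congr_set (interior_ae_eq_simplex K)
  · intro K hK L hL hne
    exact disjoint_interior hK hL hne
  · intro K hK
    exact hF.mono_set (interior_simplex_subset hK)

theorem integrableOn_of_cells (T : Triangulation Ω) {F : Euc n → ℝ}
    (hF : ∀ K ∈ T.cells, IntegrableOn F (convexHull ℝ (K : Set (Euc n)))) :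
    IntegrableOn F Ω := by
  have : IntegrableOn F (closure Ω) := by
    rw [T.closure_eq_iUnion_cells]
    exact (integrableOn_finset_iUnion).2 hF
  exact this.mono_set subset_closure

/-- A cell may touch `∂Ω`, but its interior lies in `Ω` and its frontier is null. -/
theorem restrict_simplex_le {K : Finset (Euc n)} (hK : K ∈ T.cells) :
    volume.restrict (convexHull ℝ (K : Set (Euc n))) ≤ volume.restrict Ω := by
  rw [← Measure.restrict_congr_set (interior_ae_eq_simplex K)]
  exact Measure.restrict_mono (interior_simplex_subset hK) le_rfl

theorem ae_simplex_of_ae {K : Finset (Euc n)} (hK : K ∈ T.cells) {p : Euc n → Prop}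
    (h : ∀ᵐ x ∂(volume.restrict Ω), p x) :
    ∀ᵐ x ∂(volume.restrict (convexHull ℝ (K : Set (Euc n)))), p x :=
  ae_mono (restrict_simplex_le hK) h

end Triangulation

theorem bary_sum_smul_of_sum_eq_one (K : Finset (Euc n)) (v : Euc n) {L : Finset (Euc n)}
    {w : Euc n → ℝ} (hw : ∑ u ∈ L, w u = 1) :
    bary K v (∑ u ∈ L, w u • u) = ∑ u ∈ L, w u * bary K v u := by
  obtain ⟨c, h⟩ : ∃ c, ∀ x, bary K v x = c + baryGrad K v x :=
    ⟨bary K v 0, fun x => by rw [bary_eq_add K v x 0, sub_zero]⟩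
  rw [h, map_sum]
  simp_rw [h, mul_add, Finset.sum_add_distrib, ← Finset.sum_mul, hw, map_smul, smul_eq_mul]
  simp

namespace Triangulation

variable {Ω : Set (Euc n)} {T : Triangulation Ω}

/-! ### A face of codimension one belongs to at most two elements -/

/-- The vertices opposite to a common facet lie on different sides of it. Otherwise a short step
from the barycentre of `e` towards `b` stays in both cells, and the coordinate of `b` there would be
positive in one cell and zero in the other. -/
theorem bary_neg_of_common_facet (hn : 1 ≤ n) {e : Finset (Euc n)} (he : e.card = n)
    {a b : Euc n} (ha : a ∉ e) (hK : insert a e ∈ T.cells) (hL : insert b e ∈ T.cells)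
    (hab : a ≠ b) (hb : b ∉ e) : bary (insert a e) a b < 0 := by
  by_contra! hpos
  set K := insert a e with hKdef
  have hbK : b ∉ K := by simp [hKdef, hb, Ne.symm hab]
  have hn0 : (0 : ℝ) < n := by exact_mod_cast hn
  have hev : ∀ᶠ t : ℝ in 𝓝[>] 0, ∀ v ∈ e, 0 ≤ (1 - t) * (1 / n) + t * bary K v b := by
    refine (Finset.eventually_all e).2 fun v _ => ?_
    have hc : Continuous fun t : ℝ => (1 - t) * (1 / (n : ℝ)) + t * bary K v b := by fun_prop
    have h0 : ∀ᶠ t : ℝ in 𝓝 0, 0 < (1 - t) * (1 / (n : ℝ)) + t * bary K v b := by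
      have h2 := hc.tendsto 0
      simp only [sub_zero, one_mul, zero_mul, add_zero] at h2
      exact h2.eventually_const_lt (by positivity)
    exact (h0.filter_mono nhdsWithin_le_nhds).mono fun t ht => ht.le
  have hlt : ∀ᶠ t : ℝ in 𝓝[>] 0, t < 1 := (eventually_lt_nhds one_pos).filter_mono nhdsWithin_le_nhds
  have hself : ∀ᶠ t : ℝ in 𝓝[>] 0, t ∈ Set.Ioi (0 : ℝ) := self_mem_nhdsWithin
  obtain ⟨t, ht0, ht, ht1⟩ := (hself.and (hev.and hlt)).exists
  have ht0 : 0 < t := ht0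
  -- The weights of the point at parameter `t` on the segment from the barycentre of `e` to `b`.
  let w : Euc n → ℝ := fun u => if u = b then t else (1 - t) * (1 / n)
  have hwe : ∀ u ∈ e, w u = (1 - t) * (1 / n) := fun u hu => by
    have : u ≠ b := fun h => hb (h ▸ hu)
    simp [w, this]
  have hw1 : ∑ u ∈ insert b e, w u = 1 := by
    rw [Finset.sum_insert hb, Finset.sum_congr rfl hwe, Finset.sum_const, he]
    simp only [w, if_true, nsmul_eq_mul]
    field_simp
    ring
  have hyL : ∀ v ∈ insert b e, bary (insert b e) v (∑ u ∈ insert b e, w u • u) = w v :=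
    fun v hv => (isSimplex hL).bary_sum_smul hw1 hv
  have hyK : ∀ v, bary K v (∑ u ∈ insert b e, w u • u)
      = t * bary K v b + ∑ u ∈ e, (1 - t) * (1 / n) * bary K v u := by
    intro v
    rw [bary_sum_smul_of_sum_eq_one K v hw1, Finset.sum_insert hb]
    congr 1
    · simp [w]
    · exact Finset.sum_congr rfl fun u hu => by rw [hwe u hu]
  have heK : ∀ u ∈ e, u ∈ K := fun u hu => Finset.mem_insert_of_mem hu
  set y := ∑ u ∈ insert b e, w u • u
  have hwnn : 0 ≤ (1 - t) * (1 / (n : ℝ)) := mul_nonneg (by linarith) (by positivity)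
  have m1 : y ∈ convexHull ℝ ((insert b e : Finset (Euc n)) : Set (Euc n)) := by
    rw [(isSimplex hL).mem_convexHull_iff]
    intro v hv
    rw [hyL v hv]
    simp only [w]
    split_ifs
    · exact ht0.le
    · exact hwnn
  have m2 : y ∈ convexHull ℝ (K : Set (Euc n)) := by
    rw [(isSimplex hK).mem_convexHull_iff]
    intro v hv
    rw [hyK v]
    rcases Finset.mem_insert.1 hv with rfl | hve
    · refine add_nonneg (mul_nonneg ht0.le hpos) (Finset.sum_nonneg fun u hu => ?_)
      rw [(isSimplex hK).bary_vertex (heK u hu)]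
      split_ifs
      · rw [mul_one]; exact hwnn
      · rw [mul_zero]
    · have : ∑ u ∈ e, (1 - t) * (1 / (n : ℝ)) * bary K v u = (1 - t) * (1 / n) := by
        rw [Finset.sum_eq_single v]
        · rw [(isSimplex hK).bary_vertex (heK v hve)]; simp
        · intro u hu huv
          rw [(isSimplex hK).bary_vertex (heK u hu)]; simp [Ne.symm huv]
        · exact fun h => absurd hve h
      rw [this, add_comm]
      exact ht v hve
  have h3 := bary_eq_bary hK hL m2 m1 b
  rw [bary_of_notMem hbK, hyL b (Finset.mem_insert_self b e)] at h3
  simp only [w, if_true] at h3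
  exact ht0.ne h3

theorem exists_eq_insert {e K : Finset (Euc n)} (he : e.card = n) (hK : K ∈ T.cellsAt e) :
    ∃ a, a ∉ e ∧ K = insert a e := by
  rw [mem_cellsAt, mem_cells] at hK
  have h1 : (K \ e).card = 1 := by
    rw [Finset.card_sdiff_of_subset hK.2, hK.1.2, he]; omega
  obtain ⟨a, ha⟩ := Finset.card_eq_one.1 h1
  have ha' : a ∈ K \ e := ha ▸ Finset.mem_singleton_self a
  refine ⟨a, (Finset.mem_sdiff.1 ha').2, ?_⟩
  rw [← Finset.sdiff_union_of_subset hK.2, ha]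
  rfl

/-- With three cells `a`, `b`, `c` on the facet `e`, the coordinate of `c` along `a` is the product
of that of `c` along `b` and that of `b` along `a`. All three numbers would be negative. -/
theorem card_cellsAt_le_two (hn : 1 ≤ n) {e : Finset (Euc n)} (he : e.card = n) :
    (T.cellsAt e).card ≤ 2 := by
  by_contra! hc
  obtain ⟨K, L, M, hK, hL, hM, hKL, hKM, hLM⟩ := Finset.two_lt_card_iff.1 hc
  obtain ⟨a, ha, rfl⟩ := exists_eq_insert he hK
  obtain ⟨b, hb, rfl⟩ := exists_eq_insert he hL
  obtain ⟨c, hcn, rfl⟩ := exists_eq_insert he hM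
  have hK' := (T.mem_cellsAt.1 hK).1
  have hL' := (T.mem_cellsAt.1 hL).1
  have hM' := (T.mem_cellsAt.1 hM).1
  have h1 := bary_neg_of_common_facet hn he ha hK' hL' (fun h => hKL (by rw [h])) hb
  have h2 := bary_neg_of_common_facet hn he ha hK' hM' (fun h => hKM (by rw [h])) hcn
  have h3 := bary_neg_of_common_facet hn he hb hL' hM' (fun h => hLM (by rw [h])) hcn
  have h4 : bary (insert a e) a c = bary (insert b e) b c * bary (insert a e) a b := by
    conv_lhs => rw [← (isSimplex hL').sum_bary_smul c]
    rw [bary_sum_smul_of_sum_eq_one _ _ ((isSimplex hL').sum_bary c), Finset.sum_insert hb]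
    rw [Finset.sum_eq_zero, add_zero]
    intro u hu
    rw [(isSimplex hK').bary_vertex (Finset.mem_insert_of_mem hu), if_neg, mul_zero]
    rintro rfl
    exact ha hu
  have := mul_pos_of_neg_of_neg h3 h1
  linarith

/-! ### Hat functions -/

open Classical in
/-- The piecewise affine function on `closure Ω` which is `1` at `v` and `0` at the other
vertices. -/
def hat (T : Triangulation Ω) (v x : Euc n) : ℝ :=
  if h : ∃ K ∈ T.cells, x ∈ convexHull ℝ (K : Set (Euc n)) then bary h.choose v x else 0

theorem hat_eq {K : Finset (Euc n)} (hK : K ∈ T.cells) {x : Euc n}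
    (hx : x ∈ convexHull ℝ (K : Set (Euc n))) (v : Euc n) : T.hat v x = bary K v x := by
  have h : ∃ K ∈ T.cells, x ∈ convexHull ℝ (K : Set (Euc n)) := ⟨K, hK, hx⟩
  unfold hat
  rw [dif_pos h]
  exact bary_eq_bary h.choose_spec.1 hK h.choose_spec.2 hx v

theorem hat_nonneg {x : Euc n} (hx : x ∈ closure Ω) (v : Euc n) : 0 ≤ T.hat v x := by
  obtain ⟨K, hK, hxK⟩ := T.exists_cell_of_mem_closure hx
  rw [hat_eq hK hxK]
  exact (isSimplex hK).bary_nonneg hxK v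

theorem hat_le_one {x : Euc n} (hx : x ∈ closure Ω) (v : Euc n) : T.hat v x ≤ 1 := by
  obtain ⟨K, hK, hxK⟩ := T.exists_cell_of_mem_closure hx
  rw [hat_eq hK hxK]
  exact (isSimplex hK).bary_le_one hxK v

theorem sum_hat_le_one (s : Finset (Euc n)) {x : Euc n} (hx : x ∈ closure Ω) :
    ∑ v ∈ s, T.hat v x ≤ 1 := by
  obtain ⟨K, hK, hxK⟩ := T.exists_cell_of_mem_closure hx
  simp_rw [hat_eq hK hxK]
  rw [← (isSimplex hK).sum_bary x]
  calc ∑ v ∈ s, bary K v x = ∑ v ∈ s ∩ K, bary K v x := by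
        refine (Finset.sum_subset Finset.inter_subset_left fun v hv hvn => ?_).symm
        exact bary_of_notMem (fun h => hvn (Finset.mem_inter.2 ⟨hv, h⟩)) x
    _ ≤ _ := Finset.sum_le_sum_of_subset_of_nonneg Finset.inter_subset_right
        fun v _ _ => (isSimplex hK).bary_nonneg hxK v

/-- Faces without common vertices are disjoint compact sets, and there are finitely many pairs. -/
theorem exists_dist_faces (T : Triangulation Ω) : ∃ c : ℝ, 0 < c ∧ ∀ s ∈ T.complex.faces,
    ∀ t ∈ T.complex.faces, Disjoint s t → ∀ x ∈ convexHull ℝ (s : Set (Euc n)),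
    ∀ y ∈ convexHull ℝ (t : Set (Euc n)), c ≤ ‖x - y‖ := by
  have key : ∀ p ∈ T.finite.toFinset ×ˢ T.finite.toFinset, ∀ᶠ c : ℝ in 𝓝[>] 0, Disjoint p.1 p.2 →
      ∀ x ∈ convexHull ℝ (p.1 : Set (Euc n)), ∀ y ∈ convexHull ℝ (p.2 : Set (Euc n)),
        c ≤ ‖x - y‖ := by
    rintro ⟨s, t⟩ hp
    simp only [Finset.mem_product, Set.Finite.mem_toFinset] at hp
    by_cases hst : Disjoint s t
    · have hd : Disjoint (convexHull ℝ (s : Set (Euc n))) (convexHull ℝ (t : Set (Euc n))) := by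
        rw [Set.disjoint_iff]
        intro x hx
        have := T.complex.inter_subset_convexHull hp.1 hp.2 hx
        rw [← Finset.coe_inter, Finset.disjoint_iff_inter_eq_empty.1 hst] at this
        simp at this
      obtain ⟨r, hr0, hr⟩ := Metric.exists_pos_forall_lt_edist (isCompact_simplex s)
        (isCompact_simplex t).isClosed hd
      have hr0' : (0 : ℝ) < r := hr0
      filter_upwards [(eventually_lt_nhds hr0').filter_mono nhdsWithin_le_nhds] with c hc _ x hx y hy
      have h1 := hr x hx y hy
      rw [edist_nndist, ENNReal.coe_lt_coe, ← NNReal.coe_lt_coe, coe_nndist, dist_eq_norm] at h1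
      linarith
    · exact Eventually.of_forall fun c h => absurd h hst
  have hall := (Finset.eventually_all _).2 key
  have hself : ∀ᶠ t : ℝ in 𝓝[>] 0, t ∈ Set.Ioi (0 : ℝ) := self_mem_nhdsWithin
  obtain ⟨c, hc0, hc⟩ := (hself.and hall).exists
  refine ⟨c, hc0, fun s hs t ht hst x hx y hy => hc (s, t) ?_ hst x hx y hy⟩
  simp [hs, ht]

/-- The constant is global although `closure Ω` need not be convex. Let `a`, `b` be the coordinates
of `x`, `y` and subtract their minimum `c`. The residuals have disjoint supports and equal mass `m`;
divided by `m` they are points of disjoint faces, at distance at least `c₀`. Since `x - y` is `m`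
times their difference, `c₀ |a v - b v| ≤ c₀ m ≤ ‖x - y‖`. -/
theorem exists_hat_lipschitz (T : Triangulation Ω) : ∃ C : ℝ, 0 ≤ C ∧ ∀ x ∈ closure Ω,
    ∀ y ∈ closure Ω, ∀ v, |T.hat v x - T.hat v y| ≤ C * ‖x - y‖ := by
  obtain ⟨c₀, hc₀, hdist⟩ := T.exists_dist_faces
  have key : ∀ x ∈ closure Ω, ∀ y ∈ closure Ω, ∀ v, c₀ * (T.hat v x - T.hat v y) ≤ ‖x - y‖ := by
    intro x hx y hy v
    obtain ⟨K, hK, hxK⟩ := T.exists_cell_of_mem_closure hx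
    obtain ⟨L, hL, hyL⟩ := T.exists_cell_of_mem_closure hy
    simp_rw [hat_eq hK hxK, hat_eq hL hyL]
    have hsK := isSimplex hK
    have hsL := isSimplex hL
    set a : Euc n → ℝ := fun v => bary K v x with ha
    set b : Euc n → ℝ := fun v => bary L v y with hb
    have ha0 : ∀ v, 0 ≤ a v := hsK.bary_nonneg hxK
    have hb0 : ∀ v, 0 ≤ b v := hsL.bary_nonneg hyL
    have haK : ∀ v, v ∉ K → a v = 0 := fun v hv => bary_of_notMem hv x
    have hbL : ∀ v, v ∉ L → b v = 0 := fun v hv => bary_of_notMem hv y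
    set U := K ∪ L
    have hsa : ∑ v ∈ U, a v = 1 := by
      rw [← hsK.sum_bary x]
      exact (Finset.sum_subset Finset.subset_union_left fun v _ hv => haK v hv).symm
    have hsb : ∑ v ∈ U, b v = 1 := by
      rw [← hsL.sum_bary y]
      exact (Finset.sum_subset Finset.subset_union_right fun v _ hv => hbL v hv).symm
    have hxa : ∑ v ∈ U, a v • v = x := by
      conv_rhs => rw [← hsK.sum_bary_smul x]
      exact (Finset.sum_subset Finset.subset_union_left fun v _ hv => by
        rw [haK v hv, zero_smul]).symm
    have hyb : ∑ v ∈ U, b v • v = y := by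
      conv_rhs => rw [← hsL.sum_bary_smul y]
      exact (Finset.sum_subset Finset.subset_union_right fun v _ hv => by
        rw [hbL v hv, zero_smul]).symm
    set c : Euc n → ℝ := fun v => min (a v) (b v) with hc
    have hca : ∀ v, c v ≤ a v := fun v => min_le_left _ _
    have hcb : ∀ v, c v ≤ b v := fun v => min_le_right _ _
    have hc0 : ∀ v, 0 ≤ c v := fun v => le_min (ha0 v) (hb0 v)
    set m := 1 - ∑ v ∈ U, c v with hm
    have hma : ∑ v ∈ U, (a v - c v) = m := by rw [Finset.sum_sub_distrib, hsa]
    have hmb : ∑ v ∈ U, (b v - c v) = m := by rw [Finset.sum_sub_distrib, hsb]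
    have hm0 : 0 ≤ m := hma ▸ Finset.sum_nonneg fun v _ => sub_nonneg.2 (hca v)
    have habm : a v - b v ≤ m := by
      by_cases hv : v ∈ U
      · calc a v - b v ≤ a v - c v := by linarith [hcb v]
          _ ≤ ∑ v ∈ U, (a v - c v) :=
            Finset.single_le_sum (f := fun v => a v - c v) (fun w _ => sub_nonneg.2 (hca w)) hv
          _ = m := hma
      · rw [haK v (fun h => hv (Finset.mem_union_left _ h)),
          hbL v (fun h => hv (Finset.mem_union_right _ h))]
        simpa using hm0
    rcases hm0.eq_or_lt with hm0' | hmpos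
    · have : c₀ * (a v - b v) ≤ 0 := mul_nonpos_of_nonneg_of_nonpos hc₀.le (by linarith)
      exact this.trans (norm_nonneg _)
    -- Applied to both `K, a` and `L, b`: the normalised residual lies in the face spanned by the
    -- vertices where it is positive, and `m > 0` makes this face nonempty.
    have hconv : ∀ (N : Finset (Euc n)) (g : Euc n → ℝ), N ⊆ U → (∀ v, c v ≤ g v) →
        (∀ v, v ∉ N → g v = 0) → ∑ v ∈ U, (g v - c v) = m →
        N ∈ T.complex.faces → N.filter (fun v => c v < g v) ∈ T.complex.faces ∧
        m⁻¹ • ∑ v ∈ U, (g v - c v) • v ∈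
          convexHull ℝ ((N.filter (fun v => c v < g v) : Finset (Euc n)) : Set (Euc n)) := by
      intro N g hNU hcg hgN hsum hN
      have hz : ∀ v ∈ U, v ∉ N.filter (fun v => c v < g v) → g v - c v = 0 := by
        intro v _ hv
        by_cases hvN : v ∈ N
        · have : ¬ c v < g v := fun h => hv (Finset.mem_filter.2 ⟨hvN, h⟩)
          linarith [hcg v]
        · have h1 := hcg v
          rw [hgN v hvN] at h1 ⊢
          linarith [hc0 v]
      have hsub : N.filter (fun v => c v < g v) ⊆ U := (Finset.filter_subset _ _).trans hNU
      have hsum' : ∑ v ∈ N.filter (fun v => c v < g v), (g v - c v) = m := by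
        rw [← hsum]
        exact Finset.sum_subset hsub hz
      refine ⟨T.complex.down_closed hN (Finset.filter_subset _ _) ?_, ?_⟩
      · by_contra hne
        rw [Finset.not_nonempty_iff_eq_empty] at hne
        rw [hne, Finset.sum_empty] at hsum'
        exact hmpos.ne hsum'
      · rw [Finset.mem_convexHull']
        refine ⟨fun v => m⁻¹ * (g v - c v), fun v _ => ?_, ?_, ?_⟩
        · exact mul_nonneg (inv_nonneg.2 hm0) (sub_nonneg.2 (hcg v))
        · rw [← Finset.mul_sum, hsum', inv_mul_cancel₀ hmpos.ne']
        · simp_rw [mul_smul]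
          rw [← Finset.smul_sum]
          congr 1
          exact Finset.sum_subset hsub fun v hv hvn => by rw [hz v hv hvn, zero_smul]
    obtain ⟨f1, p1⟩ := hconv K a Finset.subset_union_left hca haK hma (T.mem_cells.1 hK).1
    obtain ⟨f2, p2⟩ := hconv L b Finset.subset_union_right hcb hbL hmb (T.mem_cells.1 hL).1
    have hdisj : Disjoint (K.filter fun v => c v < a v) (L.filter fun v => c v < b v) := by
      rw [Finset.disjoint_left]
      intro w hw1 hw2
      have h1 := (Finset.mem_filter.1 hw1).2
      have h2 := (Finset.mem_filter.1 hw2).2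
      exact absurd (lt_min h1 h2) (lt_irrefl _)
    have hd := hdist _ f1 _ f2 hdisj _ p1 _ p2
    have heq : m⁻¹ • ∑ v ∈ U, (a v - c v) • v - m⁻¹ • ∑ v ∈ U, (b v - c v) • v
        = m⁻¹ • (x - y) := by
      rw [← smul_sub, ← Finset.sum_sub_distrib]
      congr 1
      rw [← hxa, ← hyb, ← Finset.sum_sub_distrib]
      refine Finset.sum_congr rfl fun v _ => ?_
      rw [← sub_smul, ← sub_smul]
      congr 1
      ring
    rw [heq, norm_smul, Real.norm_of_nonneg (inv_nonneg.2 hm0), inv_mul_eq_div,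
      le_div_iff₀ hmpos] at hd
    calc c₀ * (a v - b v) ≤ c₀ * m := mul_le_mul_of_nonneg_left habm hc₀.le
      _ ≤ ‖x - y‖ := hd
  refine ⟨c₀⁻¹, inv_nonneg.2 hc₀.le, fun x hx y hy v => ?_⟩
  rw [inv_mul_eq_div, le_div_iff₀ hc₀]
  have h1 := key x hx y hy v
  have h2 := key y hy x hx v
  rw [norm_sub_rev] at h2
  rcases abs_cases (T.hat v x - T.hat v y) with ⟨h, _⟩ | ⟨h, _⟩ <;> rw [h] <;> linarith

end Triangulation

/-! ### Bounded Lipschitz functions on a set -/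

/-- `f` is bounded and Lipschitz on `s`. -/
def BddLip (s : Set (Euc n)) (f : Euc n → ℝ) : Prop :=
  ∃ C : ℝ, 0 ≤ C ∧ (∀ x ∈ s, |f x| ≤ C) ∧ ∀ x ∈ s, ∀ y ∈ s, |f x - f y| ≤ C * ‖x - y‖

namespace BddLip

variable {s : Set (Euc n)} {f g : Euc n → ℝ}

theorem mk' {C D : ℝ} (h1 : ∀ x ∈ s, |f x| ≤ C)
    (h2 : ∀ x ∈ s, ∀ y ∈ s, |f x - f y| ≤ D * ‖x - y‖) : BddLip s f := by
  refine ⟨max (max C D) 0, le_max_right _ _, fun x hx => (h1 x hx).trans ?_,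
    fun x hx y hy => (h2 x hx y hy).trans (mul_le_mul_of_nonneg_right ?_ (norm_nonneg _))⟩
  · exact (le_max_left _ _).trans (le_max_left _ _)
  · exact (le_max_right _ _).trans (le_max_left _ _)

theorem const (c : ℝ) : BddLip s fun _ => c :=
  mk' (C := |c|) (D := 0) (fun _ _ => le_rfl) (fun _ _ _ _ => by simp)

theorem add (hf : BddLip s f) (hg : BddLip s g) : BddLip s fun x => f x + g x := by
  obtain ⟨C, -, hf1, hf2⟩ := hf
  obtain ⟨D, -, hg1, hg2⟩ := hg
  refine mk' (C := C + D) (D := C + D) (fun x hx => (abs_add_le _ _).trans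
    (add_le_add (hf1 x hx) (hg1 x hx))) fun x hx y hy => ?_
  have : f x + g x - (f y + g y) = (f x - f y) + (g x - g y) := by ring
  rw [this, add_mul]
  exact (abs_add_le _ _).trans (add_le_add (hf2 x hx y hy) (hg2 x hx y hy))

theorem mul (hf : BddLip s f) (hg : BddLip s g) : BddLip s fun x => f x * g x := by
  obtain ⟨C, hC, hf1, hf2⟩ := hf
  obtain ⟨D, hD, hg1, hg2⟩ := hg
  refine mk' (C := C * D) (D := C * D + C * D) (fun x hx => ?_) fun x hx y hy => ?_
  · rw [abs_mul]
    exact mul_le_mul (hf1 x hx) (hg1 x hx) (abs_nonneg _) hC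
  · have : f x * g x - f y * g y = f x * (g x - g y) + (f x - f y) * g y := by ring
    rw [this]
    refine (abs_add_le _ _).trans ?_
    rw [abs_mul, abs_mul]
    calc |f x| * |g x - g y| + |f x - f y| * |g y|
        ≤ C * (D * ‖x - y‖) + C * ‖x - y‖ * D := by
          gcongr
          · exact hf1 x hx
          · exact hg2 x hx y hy
          · exact hf2 x hx y hy
          · exact hg1 y hy
      _ = _ := by ring

theorem neg (hf : BddLip s f) : BddLip s fun x => -f x := by
  simpa using (const (-1)).mul hf

theorem sub (hf : BddLip s f) (hg : BddLip s g) : BddLip s fun x => f x - g x := by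
  simpa [sub_eq_add_neg] using hf.add hg.neg

theorem sum {ι : Type*} {t : Finset ι} {f : ι → Euc n → ℝ} (hf : ∀ i ∈ t, BddLip s (f i)) :
    BddLip s fun x => ∑ i ∈ t, f i x := by
  classical
  induction t using Finset.induction_on with
  | empty => simpa using const 0
  | insert a t ha ih =>
    simp_rw [Finset.sum_insert ha]
    exact (hf a (Finset.mem_insert_self a t)).add
      (ih fun i hi => hf i (Finset.mem_insert_of_mem hi))

theorem prod {ι : Type*} {t : Finset ι} {f : ι → Euc n → ℝ} (hf : ∀ i ∈ t, BddLip s (f i)) :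
    BddLip s fun x => ∏ i ∈ t, f i x := by
  classical
  induction t using Finset.induction_on with
  | empty => simpa using const 1
  | insert a t ha ih =>
    simp_rw [Finset.prod_insert ha]
    exact (hf a (Finset.mem_insert_self a t)).mul
      (ih fun i hi => hf i (Finset.mem_insert_of_mem hi))

theorem pow (hf : BddLip s f) (m : ℕ) : BddLip s fun x => f x ^ m := by
  simpa using prod (t := Finset.range m) (f := fun _ => f) fun _ _ => hf

theorem inv (hf : BddLip s f) {δ : ℝ} (hδ : 0 < δ) (h : ∀ x ∈ s, δ ≤ f x) :
    BddLip s fun x => (f x)⁻¹ := by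
  obtain ⟨C, -, -, hf2⟩ := hf
  refine mk' (C := δ⁻¹) (D := δ⁻¹ * δ⁻¹ * C) (fun x hx => ?_) fun x hx y hy => ?_
  · have h1 := hδ.trans_le (h x hx)
    rw [abs_of_pos (inv_pos.2 h1)]
    exact inv_anti₀ hδ (h x hx)
  · have h1 := hδ.trans_le (h x hx)
    have h2 := hδ.trans_le (h y hy)
    have : (f x)⁻¹ - (f y)⁻¹ = (f x)⁻¹ * (f y)⁻¹ * (f y - f x) := by
      field_simp
    rw [this, abs_mul, abs_mul, abs_of_pos (inv_pos.2 h1), abs_of_pos (inv_pos.2 h2), abs_sub_comm,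
      mul_assoc (δ⁻¹ * δ⁻¹)]
    gcongr
    · exact h x hx
    · exact h y hy
    · exact hf2 x hx y hy

theorem div (hf : BddLip s f) (hg : BddLip s g) {δ : ℝ} (hδ : 0 < δ) (h : ∀ x ∈ s, δ ≤ g x) :
    BddLip s fun x => f x / g x := by
  simpa [div_eq_mul_inv] using hf.mul (hg.inv hδ h)

theorem of_contDiff (hs : Bornology.IsBounded s) (hf : ContDiff ℝ 1 f) : BddLip s f := by
  obtain ⟨R, hR⟩ := hs.subset_closedBall 0
  have hc := isCompact_closedBall (0 : Euc n) R
  obtain ⟨C, hC⟩ := hc.exists_bound_of_continuousOn hf.continuous.continuousOn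
  obtain ⟨D, hD⟩ := hc.exists_bound_of_continuousOn (hf.continuous_fderiv one_ne_zero).continuousOn
  refine mk' (C := C) (D := D) (fun x hx => hC x (hR hx)) fun x hx y hy => ?_
  exact (convex_closedBall (0 : Euc n) R).norm_image_sub_le_of_norm_fderiv_le
    (fun z _ => hf.differentiable (by simp) z) hD (hR hy) (hR hx)

theorem hat {Ω : Set (Euc n)} (T : Triangulation Ω) (v : Euc n) : BddLip (closure Ω) (T.hat v) := by
  obtain ⟨C, -, h⟩ := T.exists_hat_lipschitz
  refine mk' (C := 1) (D := C) (fun x hx => ?_) fun x hx y hy => h x hx y hy v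
  rw [abs_of_nonneg (Triangulation.hat_nonneg hx v)]
  exact Triangulation.hat_le_one hx v

end BddLip

/-! ### Green's formula for Lipschitz functions -/

section Mollify

variable {W : Euc n → ℝ} {C : NNReal} (φ : ContDiffBump (0 : Euc n))

/-- The mollification of `W` by a bump function. -/
def mollify (φ : ContDiffBump (0 : Euc n)) (W : Euc n → ℝ) : Euc n → ℝ :=
  MeasureTheory.convolution (φ.normed volume) W (ContinuousLinearMap.lsmul ℝ ℝ) volume

theorem mollify_apply (x : Euc n) :
    mollify φ W x = ∫ t, φ.normed volume t * W (x - t) := rfl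

theorem integrable_mollify (hW : Continuous W) (x : Euc n) :
    Integrable fun t => φ.normed volume t * W (x - t) := by
  refine Continuous.integrable_of_hasCompactSupport ?_ ?_
  · exact (φ.contDiff_normed (n := 0)).continuous.mul (hW.comp (continuous_const.sub continuous_id))
  · exact φ.hasCompactSupport_normed.mul_right

/-- The left side is an average of the quantities in `h`. With `c = 0` this preserves Lipschitz
constants; with `c = L (y - x)` it compares derivatives. -/
theorem mollify_sub_le (hW : Continuous W) {x y : Euc n} {c M : ℝ}
    (h : ∀ t ∈ Metric.ball (0 : Euc n) φ.rOut, |W (y - t) - W (x - t) - c| ≤ M) :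
    |mollify φ W y - mollify φ W x - c| ≤ M := by
  have hint := φ.integral_normed (μ := (volume : Measure (Euc n)))
  have hφi : Integrable (φ.normed (volume : Measure (Euc n))) :=
    (φ.contDiff_normed (n := 0)).continuous.integrable_of_hasCompactSupport
      φ.hasCompactSupport_normed
  have e : mollify φ W y - mollify φ W x - c
      = ∫ t, φ.normed volume t * (W (y - t) - W (x - t) - c) := by
    have : c = ∫ t, φ.normed (volume : Measure (Euc n)) t * c := by
      rw [integral_mul_const, hint, one_mul]
    conv_lhs => rw [this]
    rw [mollify_apply, mollify_apply, ← integral_sub (integrable_mollify φ hW y)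
      (integrable_mollify φ hW x)]
    refine (integral_sub ((integrable_mollify φ hW y).sub
      (integrable_mollify φ hW x)) (hφi.mul_const c)).symm.trans ?_
    refine integral_congr_ae (Eventually.of_forall fun t => ?_)
    simp only [Pi.sub_apply]
    ring
  rw [e, ← Real.norm_eq_abs]
  have : M = ∫ t, φ.normed (volume : Measure (Euc n)) t * M := by
    rw [integral_mul_const, hint, one_mul]
  rw [this]
  refine norm_integral_le_of_norm_le (hφi.mul_const M) (Eventually.of_forall fun t => ?_)
  rw [norm_mul, Real.norm_of_nonneg (φ.nonneg_normed t)]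
  by_cases ht : t ∈ Metric.ball (0 : Euc n) φ.rOut
  · exact mul_le_mul_of_nonneg_left (h t ht) (φ.nonneg_normed t)
  · rw [← φ.support_normed_eq (μ := volume), Function.notMem_support] at ht
    rw [ht]; simp

theorem contDiff_mollify (hW : Continuous W) : ContDiff ℝ ∞ (mollify φ W) :=
  HasCompactSupport.contDiff_convolution_left _ φ.hasCompactSupport_normed φ.contDiff_normed
    hW.locallyIntegrable

theorem lipschitzWith_mollify (hW : LipschitzWith C W) : LipschitzWith C (mollify φ W) := by
  refine LipschitzWith.of_dist_le_mul fun x y => ?_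
  rw [Real.dist_eq]
  have := mollify_sub_le φ hW.continuous (x := y) (y := x) (c := 0) (M := C * dist x y)
    fun t _ => by
      rw [sub_zero, ← Real.dist_eq]
      simpa using hW.dist_le_mul (x - t) (y - t)
  simpa using this

theorem abs_mollify_sub_le (hW : LipschitzWith C W) (x : Euc n) :
    |mollify φ W x - W x| ≤ C * φ.rOut := by
  rw [← Real.dist_eq]
  refine ContDiffBump.dist_normed_convolution_le hW.continuous.aestronglyMeasurable fun y hy => ?_
  exact (hW.dist_le_mul y x).trans
    (mul_le_mul_of_nonneg_left (Metric.mem_ball.1 hy).le C.coe_nonneg)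

/-- Mollification averages increments between translated points, so strict differentiability, which
controls increments between any two points near `x`, is the right assumption. -/
theorem tendsto_fderiv_mollify (φ : ℕ → ContDiffBump (0 : Euc n))
    (hφ : Tendsto (fun k => (φ k).rOut) atTop (𝓝 0)) (hW : Continuous W) {x : Euc n}
    {L : Euc n →L[ℝ] ℝ} (hL : HasStrictFDerivAt W L x) :
    Tendsto (fun k => fderiv ℝ (mollify (φ k) W) x) atTop (𝓝 L) := by
  rw [tendsto_iff_norm_sub_tendsto_zero]
  rw [Metric.tendsto_nhds]
  intro ε hε
  have h1 := hL.isLittleO.def (half_pos hε)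
  obtain ⟨η, hη, hball⟩ := Metric.eventually_nhds_iff_ball.1 h1
  have h2 : ∀ a ∈ Metric.ball x η, ∀ b ∈ Metric.ball x η,
      ‖W a - W b - L (a - b)‖ ≤ ε / 2 * ‖a - b‖ := fun a ha b hb =>
    hball (a, b) (by rw [← ball_prod_same]; exact ⟨ha, hb⟩)
  filter_upwards [hφ.eventually_lt_const (half_pos hη)] with k hk
  have hdiff : HasFDerivAt (mollify (φ k) W) (fderiv ℝ (mollify (φ k) W) x) x :=
    ((contDiff_mollify (φ k) hW).differentiable (by simp) x).hasFDerivAt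
  have h3 : ‖fderiv ℝ (mollify (φ k) W) x - L‖ ≤ ε / 2 := by
    refine (hdiff.sub L.hasFDerivAt).le_of_lip' (half_pos hε).le ?_
    filter_upwards [Metric.ball_mem_nhds x (half_pos hη)] with y hy
    have := mollify_sub_le (φ k) hW (x := x) (y := y) (c := L (y - x)) (M := ε / 2 * ‖y - x‖)
      fun t ht' => by
        have ht2 : ‖t‖ < η / 2 := (mem_ball_zero_iff.1 ht').trans hk
        have m1 : y - t ∈ Metric.ball x η := by
          rw [mem_ball_iff_norm]
          calc ‖y - t - x‖ = ‖(y - x) - t‖ := by congr 1; abel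
            _ ≤ ‖y - x‖ + ‖t‖ := norm_sub_le _ _
            _ < η := by have := mem_ball_iff_norm.1 hy; linarith
        have m2 : x - t ∈ Metric.ball x η := by
          rw [mem_ball_iff_norm]
          calc ‖x - t - x‖ = ‖t‖ := by rw [sub_right_comm, sub_self, zero_sub, norm_neg]
            _ < η := by linarith
        have := h2 _ m1 _ m2
        simpa using this
    rw [Real.norm_eq_abs]
    convert this using 2
    simp only [Pi.sub_apply, map_sub]
    ring
  rw [Real.dist_eq, sub_zero, abs_of_nonneg (norm_nonneg _)]
  linarith

end Mollify

theorem integrable_fderiv_apply {μ : Measure (Euc n)} {u : Euc n → Euc n}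
    (hu : AEStronglyMeasurable u μ) (W : Euc n → ℝ) :
    AEStronglyMeasurable (fun x => fderiv ℝ W x (u x)) μ :=
  (ContinuousLinearMap.id ℝ (Euc n →L[ℝ] ℝ)).aestronglyMeasurable_comp₂
    (measurable_fderiv ℝ W).aestronglyMeasurable hu

/-- The condition defining `H₀(div)` holds for mollifications of `W` and passes to the limit. Strict
differentiability almost everywhere gives convergence of the gradients, and the Lipschitz constant
dominates them. -/
theorem normalPairing_eq_zero_of_lipschitzWith {Ω : Set (Euc n)} (hΩ : IsOpen Ω)
    (hΩb : Bornology.IsBounded Ω) {u : Euc n → Euc n} {d : Euc n → ℝ} (hu : IsH0Div Ω u d)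
    {W : Euc n → ℝ} {C : NNReal} (hW : LipschitzWith C W)
    (hd : ∀ᵐ x ∂(volume.restrict Ω), ∃ L : Euc n →L[ℝ] ℝ, HasStrictFDerivAt W L x) :
    normalPairing Ω u d W = 0 := by
  have : IsFiniteMeasure (volume.restrict Ω) :=
    ⟨by rw [Measure.restrict_apply_univ]; exact hΩb.measure_lt_top⟩
  obtain ⟨R, hR⟩ := hΩb.subset_ball 0
  set R' := max R 1 with hR'
  have hRpos : 0 < R' := lt_max_of_lt_right one_pos
  have hΩR : Ω ⊆ Metric.ball 0 R' := hR.trans (Metric.ball_subset_ball (le_max_left _ _))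
  -- `χ` is `1` on a ball containing `Ω`: it gives the mollifications compact support without
  -- changing them on `Ω`.
  let χ : ContDiffBump (0 : Euc n) := ⟨R', R' + 1, hRpos, by linarith⟩
  let φ : ℕ → ContDiffBump (0 : Euc n) := fun k =>
    ⟨1 / ((k : ℝ) + 1) / 2, 1 / ((k : ℝ) + 1), by positivity, half_lt_self (by positivity)⟩
  have hφ : Tendsto (fun k => (φ k).rOut) atTop (𝓝 0) := tendsto_one_div_add_atTop_nhds_zero_nat
  have hφ1 : ∀ k, (φ k).rOut ≤ 1 := fun k => by
    simp only [φ]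
    rw [div_le_one (by positivity)]
    linarith [(Nat.cast_nonneg k : (0 : ℝ) ≤ k)]
  have h0 : ∀ k, normalPairing Ω u d (mollify (φ k) W) = 0 := by
    intro k
    have hs := contDiff_mollify (φ k) hW.continuous
    rw [← hu.normal_trace (fun x => χ x * mollify (φ k) W x) (χ.contDiff.mul hs)
      (χ.hasCompactSupport.mul_right)]
    unfold normalPairing
    refine setIntegral_congr_fun hΩ.measurableSet fun x hx => ?_
    have hev : (fun x => χ x * mollify (φ k) W x) =ᶠ[𝓝 x] mollify (φ k) W := by
      filter_upwards [χ.eventuallyEq_one_of_mem_ball (hΩR hx)] with y hy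
      rw [hy]; simp
    have hx1 : χ x * mollify (φ k) W x = mollify (φ k) W x := hev.self_of_nhds
    simp only
    rw [hev.fderiv_eq, hx1]
  obtain ⟨M, hM⟩ : ∃ M, ∀ x ∈ Ω, |W x| ≤ M := by
    obtain ⟨M, hM⟩ := (isCompact_closedBall (0 : Euc n) R').exists_bound_of_continuousOn
      hW.continuous.continuousOn
    exact ⟨M, fun x hx => hM x (Metric.ball_subset_closedBall (hΩR hx))⟩
  have hui : Integrable u (volume.restrict Ω) := hu.memLp.integrable (by norm_num)
  have hdi : Integrable d (volume.restrict Ω) := hu.memLp_div.integrable (by norm_num)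
  have hlim : Tendsto (fun k => normalPairing Ω u d (mollify (φ k) W)) atTop
      (𝓝 (normalPairing Ω u d W)) := by
    -- The mollification radii are at most `1`, so each mollification differs from `W` by at most
    -- `C`; this gives the bound `M + C`.
    refine tendsto_integral_of_dominated_convergence
      (fun x => |d x| * (M + C) + C * ‖u x‖) (fun k => ?_) ?_ (fun k => ?_) ?_
    · exact (hdi.aestronglyMeasurable.mul
        (contDiff_mollify (φ k) hW.continuous).continuous.aestronglyMeasurable).add
        (integrable_fderiv_apply hui.aestronglyMeasurable _)
    · exact (hdi.abs.mul_const _).add (hui.norm.const_mul _)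
    · filter_upwards [ae_restrict_mem hΩ.measurableSet] with x hx
      refine (norm_add_le _ _).trans (add_le_add ?_ ?_)
      · rw [norm_mul, Real.norm_eq_abs, Real.norm_eq_abs]
        refine mul_le_mul_of_nonneg_left ?_ (abs_nonneg _)
        have h1 := abs_mollify_sub_le (φ k) hW x
        have h2 : (C : ℝ) * (φ k).rOut ≤ C := mul_le_of_le_one_right C.coe_nonneg (hφ1 k)
        have h3 := abs_sub_abs_le_abs_sub (mollify (φ k) W x) (W x)
        linarith [hM x hx]
      · refine (ContinuousLinearMap.le_opNorm _ _).trans ?_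
        exact mul_le_mul_of_nonneg_right
          (norm_fderiv_le_of_lipschitz ℝ (lipschitzWith_mollify (φ k) hW)) (norm_nonneg _)
    · filter_upwards [hd] with x ⟨L, hL⟩
      refine Tendsto.add (Tendsto.const_mul _ ?_) ?_
      · rw [tendsto_iff_dist_tendsto_zero]
        have hz : Tendsto (fun k => (C : ℝ) * (φ k).rOut) atTop (𝓝 0) := by
          simpa using hφ.const_mul (C : ℝ)
        refine squeeze_zero (fun _ => dist_nonneg) (fun k => ?_) hz
        rw [Real.dist_eq]
        exact abs_mollify_sub_le (φ k) hW x
      · have h1 := tendsto_fderiv_mollify φ hφ hW.continuous hL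
        rw [hL.hasFDerivAt.fderiv]
        exact ((ContinuousLinearMap.apply ℝ ℝ (u x)).continuous.tendsto L).comp h1
  simp_rw [h0] at hlim
  exact (tendsto_nhds_unique hlim tendsto_const_nhds)

/-- Green's formula on `Ω` for `u ∈ H₀(div, Ω)` and a Lipschitz function on `closure Ω`. -/
theorem normalPairing_eq_zero_of_bddLip {Ω : Set (Euc n)} (hΩ : IsOpen Ω)
    (hΩb : Bornology.IsBounded Ω) {u : Euc n → Euc n} {d : Euc n → ℝ} (hu : IsH0Div Ω u d)
    {W : Euc n → ℝ} (hW : BddLip (closure Ω) W)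
    (hd : ∀ᵐ x ∂(volume.restrict Ω), ∃ L : Euc n →L[ℝ] ℝ, HasStrictFDerivAt W L x) :
    normalPairing Ω u d W = 0 := by
  obtain ⟨C, hC, -, h2⟩ := hW
  have hlip : LipschitzOnWith ⟨C, hC⟩ W Ω := by
    refine LipschitzOnWith.of_dist_le_mul fun x hx y hy => ?_
    rw [Real.dist_eq, dist_eq_norm]
    exact h2 x (subset_closure hx) y (subset_closure hy)
  -- The extension agrees with `W` near every point of the open set `Ω`, so it has the same values
  -- and derivatives there.
  obtain ⟨V, hV, hVW⟩ := hlip.extend_real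
  have hev : ∀ x ∈ Ω, W =ᶠ[𝓝 x] V := fun x hx => by
    filter_upwards [hΩ.mem_nhds hx] with y hy using hVW hy
  have h := normalPairing_eq_zero_of_lipschitzWith hΩ hΩb hu hV (by
    filter_upwards [hd, ae_restrict_mem hΩ.measurableSet] with x ⟨L, hL⟩ hx
    exact ⟨L, hL.congr_of_eventuallyEq (hev x hx)⟩)
  rw [← h]
  refine setIntegral_congr_fun hΩ.measurableSet fun x hx => ?_
  rw [(hev x hx).fderiv_eq, (hev x hx).self_of_nhds]

/-! ### Integrals of products of functions of barycentric coordinates -/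

/-- The standard simplex in coordinates: nonnegative coordinates with sum at most `1`. -/
def cornerSimplex (n : ℕ) : Set (Fin n → ℝ) := {t | (∀ i, 0 ≤ t i) ∧ ∑ i, t i ≤ 1}

theorem isClosed_cornerSimplex (n : ℕ) : IsClosed (cornerSimplex n) := by
  have h1 : IsClosed {t : Fin n → ℝ | ∀ i, 0 ≤ t i} := by
    rw [Set.ofPred_forall]
    exact isClosed_iInter fun i => isClosed_le continuous_const (continuous_apply i)
  have h2 : IsClosed {t : Fin n → ℝ | ∑ i, t i ≤ 1} :=
    isClosed_le (continuous_finsetSum _ fun i _ => continuous_apply i) continuous_const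
  exact h1.inter h2

theorem cornerSimplex_subset_Icc (n : ℕ) : cornerSimplex n ⊆ Set.univ.pi fun _ => Set.Icc 0 1 := by
  intro t ht i _
  refine ⟨ht.1 i, le_trans ?_ ht.2⟩
  exact Finset.single_le_sum (f := t) (fun j _ => ht.1 j) (Finset.mem_univ i)

theorem volume_cornerSimplex_ne_zero (n : ℕ) : volume (cornerSimplex n) ≠ 0 := by
  have hop : IsOpen {t : Fin n → ℝ | (∀ i, 0 < t i) ∧ ∑ i, t i < 1} := by
    have h1 : IsOpen {t : Fin n → ℝ | ∀ i, 0 < t i} := by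
      rw [Set.ofPred_forall]
      exact isOpen_iInter_of_finite fun i => isOpen_lt continuous_const (continuous_apply i)
    exact h1.inter (isOpen_lt (continuous_finsetSum _ fun i _ => continuous_apply i)
      continuous_const)
  have hne : {t : Fin n → ℝ | (∀ i, 0 < t i) ∧ ∑ i, t i < 1}.Nonempty := by
    refine ⟨fun _ => 1 / ((n : ℝ) + 1), fun i => by positivity, ?_⟩
    simp only [Finset.sum_const, Finset.card_univ, Fintype.card_fin, nsmul_eq_mul]
    rw [mul_one_div, div_lt_one (by positivity)]
    linarith
  exact ((hop.measure_pos volume hne).trans_le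
    (measure_mono fun t (ht : (∀ i, 0 < t i) ∧ ∑ i, t i < 1) =>
      show (∀ i, 0 ≤ t i) ∧ ∑ i, t i ≤ 1 from ⟨fun i => (ht.1 i).le, ht.2.le⟩)).ne'

theorem volume_cornerSimplex_ne_top (n : ℕ) : volume (cornerSimplex n) ≠ ⊤ := by
  refine ne_top_of_le_ne_top ?_ (measure_mono (cornerSimplex_subset_Icc n))
  exact (isCompact_univ_pi fun _ => isCompact_Icc).measure_lt_top.ne

theorem IsSimplex.sum_baryGrad {K : Finset (Euc n)} (hK : IsSimplex K) (y : Euc n) :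
    ∑ v ∈ K, baryGrad K v y = 0 := by
  have h1 := hK.sum_bary y
  have h2 := hK.sum_bary 0
  simp_rw [fun v => bary_eq_add K v y 0, sub_zero, Finset.sum_add_distrib] at h1
  linarith

/-- Barycentric coordinates turn integrals over a simplex into integrals over the standard
simplex. -/
theorem IsSimplex.exists_lintegral_eq {K : Finset (Euc n)} (hK : IsSimplex K) {j : Euc n}
    (hj : j ∈ K) : ∃ ε : Fin n ≃ (K.erase j : Finset (Euc n)), ∀ G : (Fin n → ℝ) → ℝ≥0∞,
      Measurable G → ∫⁻ x in convexHull ℝ (K : Set (Euc n)), G (fun i => bary K (ε i) x)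
        = volume (convexHull ℝ (K : Set (Euc n))) *
          ((volume (cornerSimplex n))⁻¹ * ∫⁻ t in cornerSimplex n, G t) := by
  have hcard : (K.erase j).card = n := by
    rw [Finset.card_erase_of_mem hj, hK.card_eq]; rfl
  let ε : Fin n ≃ (K.erase j : Finset (Euc n)) := (Finset.equivFinOfCardEq hcard).symm
  have hsum : ∀ g : Euc n → ℝ, ∑ i, g (ε i) = ∑ v ∈ K.erase j, g v := fun g => by
    rw [← Finset.sum_attach (K.erase j)]
    exact Fintype.sum_equiv ε _ _ fun i => rfl
  let ℓ : Euc n →L[ℝ] (Fin n → ℝ) := ContinuousLinearMap.pi fun i => baryGrad K (ε i)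
  -- The gradients sum to zero, so if `n` of them vanish on `y`, all do. Then `y` and `0` have the
  -- same barycentric coordinates and are equal.
  have hinj : Function.Injective ℓ := by
    rw [injective_iff_map_eq_zero]
    intro y hy
    have h1 : ∀ v ∈ K.erase j, baryGrad K v y = 0 := by
      intro v hv
      have := congrFun hy (ε.symm ⟨v, hv⟩)
      simpa [ℓ] using this
    have h2 : baryGrad K j y = 0 := by
      have := hK.sum_baryGrad y
      rwa [← Finset.add_sum_erase _ _ hj, Finset.sum_eq_zero h1, add_zero] at this
    have h3 : ∀ v ∈ K, bary K v y = bary K v 0 := by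
      intro v hv
      rw [bary_eq_add K v y 0, sub_zero]
      by_cases hvj : v = j
      · rw [hvj, h2, add_zero]
      · rw [h1 v (Finset.mem_erase.2 ⟨hvj, hv⟩), add_zero]
    rw [← hK.sum_bary_smul y, Finset.sum_congr rfl fun v hv => by rw [h3 v hv], hK.sum_bary_smul 0]
  let L : Euc n ≃L[ℝ] (Fin n → ℝ) := (LinearEquiv.ofInjectiveOfFinrankEq ℓ.toLinearMap hinj
    (by simp)).toContinuousLinearEquiv
  have hL : ∀ x, L x = ℓ x := fun x => rfl
  let Λ : Euc n → (Fin n → ℝ) := fun x i => bary K (ε i) x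
  have hΛ : Λ = (fun t => t + Λ 0) ∘ L := by
    funext x i
    simp only [Λ, Function.comp, hL, Pi.add_apply, ℓ, ContinuousLinearMap.coe_pi']
    rw [bary_eq_add K (ε i) x 0, sub_zero, add_comm]
  have hΛc : Continuous Λ := continuous_pi fun i => continuous_bary K (ε i)
  -- `Λ` is an affine isomorphism, so it maps Lebesgue measure to a multiple of Lebesgue measure.
  -- The factor need not be computed: `G = 1` identifies it below as a ratio of volumes.
  have hmap : ∃ c : ℝ≥0∞, Measure.map Λ volume = c • (volume : Measure (Fin n → ℝ)) := by
    have h1 : (Measure.map L (volume : Measure (Euc n))).IsAddHaarMeasure :=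
      L.isAddHaarMeasure_map _
    obtain ⟨c, hc⟩ : ∃ c : NNReal, Measure.map L (volume : Measure (Euc n)) = c • volume :=
      ⟨_, Measure.isAddLeftInvariant_eq_smul (Measure.map L (volume : Measure (Euc n))) volume⟩
    refine ⟨c, ?_⟩
    rw [hΛ, ← Measure.map_map (measurable_add_const _) L.continuous.measurable, hc]
    rw [Measure.map_smul, (measurePreserving_add_right volume (Λ 0)).map_eq]
    rfl
  obtain ⟨c, hc⟩ := hmap
  have hpre : convexHull ℝ (K : Set (Euc n)) = Λ ⁻¹' cornerSimplex n := by
    ext x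
    rw [hK.mem_convexHull_iff]
    simp only [Set.mem_preimage, cornerSimplex, Set.mem_ofPred_eq, Λ]
    rw [hsum fun v => bary K v x]
    have h1 := hK.sum_bary x
    rw [← Finset.add_sum_erase _ _ hj] at h1
    constructor
    · intro h
      exact ⟨fun i => h _ (Finset.mem_of_mem_erase (ε i).2), by linarith [h j hj]⟩
    · rintro ⟨h, h'⟩ v hv
      by_cases hvj : v = j
      · rw [hvj]; linarith
      · have := h (ε.symm ⟨v, Finset.mem_erase.2 ⟨hvj, hv⟩⟩)
        simpa using this
  have hmeas := (isClosed_cornerSimplex n).measurableSet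
  have key : ∀ G : (Fin n → ℝ) → ℝ≥0∞, Measurable G →
      ∫⁻ x in convexHull ℝ (K : Set (Euc n)), G (Λ x) = c * ∫⁻ t in cornerSimplex n, G t := by
    intro G hG
    rw [hpre, ← setLIntegral_map hmeas hG hΛc.measurable, hc, Measure.restrict_smul,
      lintegral_smul_measure, smul_eq_mul]
  refine ⟨ε, fun G hG => ?_⟩
  have hvol : volume (convexHull ℝ (K : Set (Euc n))) = c * volume (cornerSimplex n) := by
    have := key (fun _ => 1) measurable_const
    simpa using this
  change ∫⁻ x in convexHull ℝ (K : Set (Euc n)), G (Λ x) = _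
  rw [key G hG, hvol, mul_assoc, ← mul_assoc (volume (cornerSimplex n)),
    ENNReal.mul_inv_cancel (volume_cornerSimplex_ne_zero n) (volume_cornerSimplex_ne_top n),
    one_mul]

/-- The constant in `IsSimplex.integral_prod_bary_le`. -/
def cornerConst (n : ℕ) : ℝ := ((volume (cornerSimplex n))⁻¹).toReal

theorem cornerConst_nonneg (n : ℕ) : 0 ≤ cornerConst n := ENNReal.toReal_nonneg

/-- Enlarge the standard simplex to the unit cube and apply Fubini. -/
theorem lintegral_cornerSimplex_prod_le {f : Fin n → ℝ → ℝ}
    (h0 : ∀ i, ∀ t ∈ Set.Icc (0 : ℝ) 1, 0 ≤ f i t)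
    (hf : ∀ i, IntegrableOn (f i) (Set.Icc 0 1)) :
    ∫⁻ t in cornerSimplex n, ENNReal.ofReal (∏ i, f i (t i))
      ≤ ENNReal.ofReal (∏ i, ∫ t in Set.Icc (0 : ℝ) 1, f i t) := by
  let g : Fin n → ℝ → ℝ := fun i => (Set.Icc (0 : ℝ) 1).indicator (f i)
  have hI : ∀ i, Integrable (g i) := fun i =>
    (integrable_indicator_iff measurableSet_Icc).2 (hf i)
  have hP : Integrable (fun t : Fin n → ℝ => ∏ i, g i (t i)) := by
    rw [volume_pi]
    exact Integrable.fintype_prod hI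
  have hnn : ∀ i t, 0 ≤ g i t := fun i t => Set.indicator_nonneg (h0 i) t
  have e1 : ∫⁻ t in cornerSimplex n, ENNReal.ofReal (∏ i, f i (t i))
      = ∫⁻ t in cornerSimplex n, ENNReal.ofReal (∏ i, g i (t i)) := by
    refine setLIntegral_congr_fun (isClosed_cornerSimplex n).measurableSet fun t ht => ?_
    have : ∏ i, f i (t i) = ∏ i, g i (t i) :=
      Finset.prod_congr rfl fun i _ =>
        (Set.indicator_of_mem (cornerSimplex_subset_Icc n ht i (Set.mem_univ i)) (f i)).symm
    simp only [this]
  have e2 : ∏ i, ∫ t in Set.Icc (0 : ℝ) 1, f i t = ∏ i, ∫ t, g i t :=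
    Finset.prod_congr rfl fun i _ => (integral_indicator measurableSet_Icc).symm
  rw [e1, e2, ← integral_fintype_prod_volume_eq_prod g, ofReal_integral_eq_lintegral_ofReal hP
    (Eventually.of_forall fun t => Finset.prod_nonneg fun i _ => hnn i (t i))]
  exact setLIntegral_le_lintegral _ _

theorem IsSimplex.integral_prod_bary_le {K : Finset (Euc n)} (hK : IsSimplex K) {j : Euc n}
    (hj : j ∈ K) {f : Euc n → ℝ → ℝ} (hm : ∀ v, Measurable (f v))
    (h0 : ∀ v, ∀ t ∈ Set.Icc (0 : ℝ) 1, 0 ≤ f v t)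
    (hf : ∀ v, IntegrableOn (f v) (Set.Icc 0 1)) :
    IntegrableOn (fun x => ∏ v ∈ K.erase j, f v (bary K v x)) (convexHull ℝ (K : Set (Euc n))) ∧
    ∫ x in convexHull ℝ (K : Set (Euc n)), ∏ v ∈ K.erase j, f v (bary K v x)
      ≤ cornerConst n * (∏ v ∈ K.erase j, ∫ t in Set.Icc (0 : ℝ) 1, f v t) *
        (volume (convexHull ℝ (K : Set (Euc n)))).toReal := by
  obtain ⟨ε, hε⟩ := hK.exists_lintegral_eq hj
  have hprod : ∀ g : Euc n → ℝ, ∏ i, g (ε i) = ∏ v ∈ K.erase j, g v := fun g => by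
    rw [← Finset.prod_attach (K.erase j)]
    exact Fintype.prod_equiv ε _ _ fun i => rfl
  have hmeas : Measurable fun x => ∏ v ∈ K.erase j, f v (bary K v x) :=
    Finset.measurable_fun_prod _ fun v _ => (hm v).comp (continuous_bary K v).measurable
  have h1 := hε (fun t => ENNReal.ofReal (∏ i, f (ε i) (t i)))
    (ENNReal.measurable_ofReal.comp (Finset.measurable_fun_prod _ fun i _ =>
      (hm _).comp (measurable_pi_apply i)))
  simp only [fun x => hprod fun v => f v (bary K v x)] at h1
  have h2 := lintegral_cornerSimplex_prod_le (f := fun i => f (ε i)) (fun i => h0 _) (fun i => hf _)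
  rw [hprod fun v => ∫ t in Set.Icc (0 : ℝ) 1, f v t] at h2
  have hle : ∫⁻ x in convexHull ℝ (K : Set (Euc n)),
      ENNReal.ofReal (∏ v ∈ K.erase j, f v (bary K v x))
      ≤ volume (convexHull ℝ (K : Set (Euc n))) * ((volume (cornerSimplex n))⁻¹ *
        ENNReal.ofReal (∏ v ∈ K.erase j, ∫ t in Set.Icc (0 : ℝ) 1, f v t)) := by
    rw [h1]
    gcongr
  have hfin : volume (convexHull ℝ (K : Set (Euc n))) * ((volume (cornerSimplex n))⁻¹ *
        ENNReal.ofReal (∏ v ∈ K.erase j, ∫ t in Set.Icc (0 : ℝ) 1, f v t)) ≠ ⊤ := by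
    refine ENNReal.mul_ne_top (isCompact_simplex K).measure_lt_top.ne
      (ENNReal.mul_ne_top (ENNReal.inv_ne_top.2 (volume_cornerSimplex_ne_zero n))
        ENNReal.ofReal_ne_top)
  have hnn : ∀ᵐ x ∂(volume.restrict (convexHull ℝ (K : Set (Euc n)))),
      0 ≤ ∏ v ∈ K.erase j, f v (bary K v x) := by
    filter_upwards [ae_restrict_mem (isCompact_simplex K).measurableSet] with x hx
    exact Finset.prod_nonneg fun v _ => h0 v _ ⟨hK.bary_nonneg hx v, hK.bary_le_one hx v⟩
  have hp : 0 ≤ ∏ v ∈ K.erase j, ∫ t in Set.Icc (0 : ℝ) 1, f v t :=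
    Finset.prod_nonneg fun v _ => setIntegral_nonneg measurableSet_Icc (h0 v)
  refine ⟨⟨hmeas.aestronglyMeasurable, ?_⟩, ?_⟩
  · rw [hasFiniteIntegral_iff_ofReal hnn]
    exact hle.trans_lt hfin.lt_top
  · rw [integral_eq_lintegral_of_nonneg_ae hnn hmeas.aestronglyMeasurable]
    refine (ENNReal.toReal_mono hfin hle).trans ?_
    rw [ENNReal.toReal_mul, ENNReal.toReal_mul, ENNReal.toReal_ofReal hp, cornerConst]
    exact le_of_eq (by ring)

/-! ### The weight `∏ λ_v^{-1/2}` -/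

/-- The weight `∏_v λ_v^{-1/2}` on a simplex. -/
def wt (K : Finset (Euc n)) (x : Euc n) : ℝ := (Real.sqrt (∏ v ∈ K, bary K v x))⁻¹

theorem wt_nonneg (K : Finset (Euc n)) (x : Euc n) : 0 ≤ wt K x :=
  inv_nonneg.2 (Real.sqrt_nonneg _)

theorem measurable_wt (K : Finset (Euc n)) : Measurable (wt K) :=
  ((Real.continuous_sqrt.comp (continuous_finsetProd _ fun v _ => continuous_bary K v)).measurable).inv

theorem IsSimplex.prod_bary_pos {K : Finset (Euc n)} (hK : IsSimplex K) {x : Euc n}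
    (hx : x ∈ interior (convexHull ℝ (K : Set (Euc n)))) : 0 < ∏ v ∈ K, bary K v x :=
  Finset.prod_pos fun v hv => hK.mem_interior_iff.1 hx v hv

theorem IsSimplex.one_le_wt {K : Finset (Euc n)} (hK : IsSimplex K) {x : Euc n}
    (hx : x ∈ interior (convexHull ℝ (K : Set (Euc n)))) : 1 ≤ wt K x := by
  have h1 := hK.prod_bary_pos hx
  have h2 : ∏ v ∈ K, bary K v x ≤ 1 := Finset.prod_le_one
    (fun v _ => hK.bary_nonneg (interior_subset hx) v)
    (fun v _ => hK.bary_le_one (interior_subset hx) v)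
  exact (one_le_inv₀ (Real.sqrt_pos.2 h1)).2 (Real.sqrt_le_one.2 h2)

/-- Here `wt ^ s` is the product of all `λ_v ^ (-σ)` with `σ = s / 2 < 1`. At each point some
coordinate is at least the mean `1 / (n + 1)`, so its factor is at most `(n + 1) ^ σ`. The other `n`
coordinates are independent variables, in each of which `t ^ (-σ)` is integrable on `[0, 1]`. -/
theorem exists_integral_wt_rpow_le (n : ℕ) {s : ℝ} (hs0 : 0 < s) (hs : s < 2) : ∃ C : ℝ, 0 ≤ C ∧
    ∀ K : Finset (Euc n), IsSimplex K →
      IntegrableOn (fun x => wt K x ^ s) (convexHull ℝ (K : Set (Euc n))) ∧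
      ∫ x in convexHull ℝ (K : Set (Euc n)), wt K x ^ s
        ≤ C * (volume (convexHull ℝ (K : Set (Euc n)))).toReal := by
  set σ := s / 2 with hσ
  have hσ0 : 0 < σ := by positivity
  have hσ1 : σ < 1 := by rw [hσ]; linarith
  set B := ∫ t in Set.Icc (0 : ℝ) 1, t ^ (-σ)
  have hB0 : 0 ≤ B := setIntegral_nonneg measurableSet_Icc fun t ht => Real.rpow_nonneg ht.1 _
  have hint : IntegrableOn (fun t : ℝ => t ^ (-σ)) (Set.Icc 0 1) := by
    rw [integrableOn_Icc_iff_integrableOn_Ioc, ← intervalIntegrable_iff_integrableOn_Ioc_of_le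
      zero_le_one]
    exact intervalIntegral.intervalIntegrable_rpow' (by linarith)
  refine ⟨((n : ℝ) + 1) ^ σ * (((n : ℝ) + 1) * (cornerConst n * B ^ n)), by
    have := cornerConst_nonneg n
    positivity, fun K hK => ?_⟩
  have hj := fun j (hj : j ∈ K) => hK.integral_prod_bary_le hj (f := fun _ t => t ^ (-σ))
    (fun _ => by fun_prop) (fun _ t ht => Real.rpow_nonneg ht.1 _) (fun _ => hint)
  have hcard : ∀ j ∈ K, (K.erase j).card = n := fun j hj => by
    rw [Finset.card_erase_of_mem hj, hK.card_eq]; rfl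
  have hbd : ∀ x ∈ interior (convexHull ℝ (K : Set (Euc n))), wt K x ^ s
      ≤ ((n : ℝ) + 1) ^ σ * ∑ j ∈ K, ∏ v ∈ K.erase j, bary K v x ^ (-σ) := by
    intro x hx
    have hpos := hK.mem_interior_iff.1 hx
    have h1 : wt K x ^ s = ∏ v ∈ K, bary K v x ^ (-σ) := by
      rw [Real.finsetProd_rpow _ _ fun v hv => (hpos v hv).le]
      unfold wt
      rw [Real.sqrt_eq_rpow, ← Real.rpow_neg (hK.prod_bary_pos hx).le,
        ← Real.rpow_mul (hK.prod_bary_pos hx).le]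
      congr 1
      rw [hσ]; ring
    obtain ⟨j, hjK, hjl⟩ : ∃ j ∈ K, 1 / ((n : ℝ) + 1) ≤ bary K j x := by
      by_contra! hcon
      have hne : K.Nonempty := Finset.card_pos.1 (by rw [hK.card_eq]; omega)
      have := Finset.sum_lt_sum_of_nonempty hne hcon
      rw [hK.sum_bary, Finset.sum_const, hK.card_eq, nsmul_eq_mul] at this
      push_cast at this
      rw [mul_one_div, div_self (by positivity)] at this
      exact lt_irrefl _ this
    rw [h1, ← Finset.mul_prod_erase _ _ hjK]
    have h2 : bary K j x ^ (-σ) ≤ ((n : ℝ) + 1) ^ σ := by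
      have := Real.rpow_le_rpow_of_nonpos (by positivity) hjl (by linarith : -σ ≤ 0)
      rwa [one_div, Real.inv_rpow (by positivity), ← Real.rpow_neg (by positivity : (0 : ℝ) ≤ n + 1),
        neg_neg] at this
    have hnn : ∀ j ∈ K, 0 ≤ ∏ v ∈ K.erase j, bary K v x ^ (-σ) := fun j _ =>
      Finset.prod_nonneg fun v hv => Real.rpow_nonneg (hpos v (Finset.mem_of_mem_erase hv)).le _
    exact mul_le_mul h2 (Finset.single_le_sum
      (f := fun j => ∏ v ∈ K.erase j, bary K v x ^ (-σ)) hnn hjK) (hnn j hjK) (by positivity)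
  have hI : IntegrableOn (fun x => ((n : ℝ) + 1) ^ σ *
      ∑ j ∈ K, ∏ v ∈ K.erase j, bary K v x ^ (-σ)) (convexHull ℝ (K : Set (Euc n))) :=
    (integrable_finsetSum _ fun j hjK => (hj j hjK).1).const_mul _
  have hae : ∀ᵐ x ∂(volume.restrict (convexHull ℝ (K : Set (Euc n)))), wt K x ^ s
      ≤ ((n : ℝ) + 1) ^ σ * ∑ j ∈ K, ∏ v ∈ K.erase j, bary K v x ^ (-σ) := by
    filter_upwards [ae_mem_interior_simplex K] with x hx using hbd x hx
  have hI2 : IntegrableOn (fun x => wt K x ^ s) (convexHull ℝ (K : Set (Euc n))) := by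
    refine hI.mono' (((measurable_wt K).pow_const s).aestronglyMeasurable) ?_
    filter_upwards [hae] with x hx
    rwa [Real.norm_of_nonneg (Real.rpow_nonneg (wt_nonneg K x) _)]
  refine ⟨hI2, (integral_mono_ae hI2 hI hae).trans ?_⟩
  rw [integral_const_mul, integral_finsetSum _ fun j hjK => (hj j hjK).1, mul_assoc]
  refine mul_le_mul_of_nonneg_left ?_ (by positivity)
  refine (Finset.sum_le_sum fun j hjK => (hj j hjK).2).trans (le_of_eq ?_)
  rw [Finset.sum_congr rfl fun j hjK => by rw [Finset.prod_const, hcard j hjK], Finset.sum_const,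
    hK.card_eq, nsmul_eq_mul]
  push_cast
  ring

/-- The function `(m + 1) (1 - t) ^ m` has integral `1` on `[0, 1]` and concentrates at `t = 0`,
that is, on the facet opposite to `v`. The bound is uniform in `m`, which is used to estimate fluxes
of bounded fields. -/
theorem IsSimplex.integral_pow_bary_le {K : Finset (Euc n)} (hn : 1 ≤ n) (hK : IsSimplex K)
    {v : Euc n} (hv : v ∈ K) (m : ℕ) :
    ∫ x in convexHull ℝ (K : Set (Euc n)), ((m : ℝ) + 1) * (1 - bary K v x) ^ m
      ≤ cornerConst n * (volume (convexHull ℝ (K : Set (Euc n)))).toReal := by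
  classical
  -- `v` must be among the independent coordinates, so the coordinate that is dropped belongs to
  -- another vertex; one exists because `n ≥ 1`.
  obtain ⟨j, hj, hjv⟩ : ∃ j ∈ K, j ≠ v :=
    Finset.exists_mem_ne (by rw [hK.card_eq]; omega) v
  have h := (hK.integral_prod_bary_le hj
    (f := fun w t => if w = v then ((m : ℝ) + 1) * (1 - t) ^ m else 1) (fun w => ?_)
    (fun w t ht => ?_) (fun w => ?_)).2
  · have hvj : v ∈ K.erase j := Finset.mem_erase.2 ⟨hjv.symm, hv⟩
    have hI : ∫ t in Set.Icc (0 : ℝ) 1, ((m : ℝ) + 1) * (1 - t) ^ m = 1 := by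
      rw [integral_Icc_eq_integral_Ioc, ← intervalIntegral.integral_of_le zero_le_one,
        intervalIntegral.integral_const_mul,
        intervalIntegral.integral_comp_sub_left (fun t => t ^ m)]
      simp only [sub_self, sub_zero, integral_pow]
      field_simp
      simp
    have h1 : ∀ x, ∏ w ∈ K.erase j,
        (if w = v then ((m : ℝ) + 1) * (1 - bary K w x) ^ m else 1)
        = ((m : ℝ) + 1) * (1 - bary K v x) ^ m := fun x => by
      rw [Finset.prod_ite_eq' ]
      simp [hvj]
    have h2 : ∏ w ∈ K.erase j, ∫ t in Set.Icc (0 : ℝ) 1,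
        (if w = v then ((m : ℝ) + 1) * (1 - t) ^ m else 1) = 1 := by
      refine Finset.prod_eq_one fun w _ => ?_
      split_ifs
      · exact hI
      · simp
    simp_rw [h1] at h
    rwa [h2, mul_one] at h
  · split_ifs <;> fun_prop
  · split_ifs
    · exact mul_nonneg (by positivity) (pow_nonneg (by linarith [ht.2]) _)
    · exact zero_le_one
  · split_ifs
    · exact (by fun_prop : Continuous fun t : ℝ => ((m : ℝ) + 1) * (1 - t) ^ m).integrableOn_Icc
    · exact continuous_const.integrableOn_Icc

/-! ### Regularised cutoff functions -/

/-- On the interior of the simplex `K`, the functions `W k` converge to `c` together with their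
derivatives, the derivatives being dominated by a multiple of the weight `wt K`. -/
def CutoffLimit (K : Finset (Euc n)) (W : ℕ → Euc n → ℝ) (c : Euc n → ℝ) : Prop :=
  ∃ C : ℝ, 0 ≤ C ∧ ∀ x ∈ interior (convexHull ℝ (K : Set (Euc n))),
    ∃ (D : ℕ → Euc n →L[ℝ] ℝ) (D' : Euc n →L[ℝ] ℝ),
      (∀ k, HasStrictFDerivAt (W k) (D k) x) ∧ HasStrictFDerivAt c D' x ∧
      Tendsto D atTop (𝓝 D') ∧ Tendsto (fun k => W k x) atTop (𝓝 (c x)) ∧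
      (∀ k, ‖D k‖ ≤ C * wt K x) ∧ ∀ k, |W k x| ≤ C

namespace CutoffLimit

variable {K : Finset (Euc n)} {W V : ℕ → Euc n → ℝ} {c b : Euc n → ℝ}

theorem congr (h : CutoffLimit K W c)
    (hW : ∀ x ∈ interior (convexHull ℝ (K : Set (Euc n))), ∀ k, V k x = W k x)
    (hc : ∀ x ∈ interior (convexHull ℝ (K : Set (Euc n))), b x = c x) : CutoffLimit K V b := by
  obtain ⟨C, hC, h⟩ := h
  refine ⟨C, hC, fun x hx => ?_⟩
  obtain ⟨D, D', h1, h2, h3, h4, h5, h6⟩ := h x hx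
  have hnhds := isOpen_interior.mem_nhds hx
  refine ⟨D, D', fun k => (h1 k).congr_of_eventuallyEq ?_, h2.congr_of_eventuallyEq ?_, h3, ?_, h5,
    fun k => ?_⟩
  · filter_upwards [hnhds] with y hy using (hW y hy k).symm
  · filter_upwards [hnhds] with y hy using (hc y hy).symm
  · rw [hc x hx]
    simpa only [hW x hx] using h4
  · rw [hW x hx]; exact h6 k

theorem zero (K : Finset (Euc n)) : CutoffLimit K (fun _ _ => 0) (fun _ => 0) :=
  ⟨0, le_rfl, fun x _ => ⟨fun _ => 0, 0, fun _ => hasStrictFDerivAt_const _ _,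
    hasStrictFDerivAt_const _ _, tendsto_const_nhds, tendsto_const_nhds, by simp, by simp⟩⟩

theorem add (h : CutoffLimit K W c) (h' : CutoffLimit K V b) :
    CutoffLimit K (fun k x => W k x + V k x) (fun x => c x + b x) := by
  obtain ⟨C, hC, h⟩ := h
  obtain ⟨C', hC', h'⟩ := h'
  refine ⟨C + C', add_nonneg hC hC', fun x hx => ?_⟩
  obtain ⟨D, D', h1, h2, h3, h4, h5, h6⟩ := h x hx
  obtain ⟨E, E', g1, g2, g3, g4, g5, g6⟩ := h' x hx
  refine ⟨fun k => D k + E k, D' + E', fun k => (h1 k).add (g1 k), h2.add g2, h3.add g3,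
    h4.add g4, fun k => ?_, fun k => ?_⟩
  · rw [add_mul]; exact (norm_add_le _ _).trans (add_le_add (h5 k) (g5 k))
  · exact (abs_add_le _ _).trans (add_le_add (h6 k) (g6 k))

theorem sum {ι : Type*} {t : Finset ι} {W : ι → ℕ → Euc n → ℝ} {c : ι → Euc n → ℝ}
    (h : ∀ i ∈ t, CutoffLimit K (W i) (c i)) :
    CutoffLimit K (fun k x => ∑ i ∈ t, W i k x) (fun x => ∑ i ∈ t, c i x) := by
  classical
  induction t using Finset.induction_on with
  | empty => simpa using zero K
  | insert a t ha ih =>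
    simp_rw [Finset.sum_insert ha]
    exact (h a (Finset.mem_insert_self a t)).add
      (ih fun i hi => h i (Finset.mem_insert_of_mem hi))

/-- The term `W ∇η` of the product rule is bounded, and `wt ≥ 1` absorbs it into the weight. -/
theorem mul (hK : IsSimplex K) (h : CutoffLimit K W c) {η : Euc n → ℝ} (hη : ContDiff ℝ 1 η) :
    CutoffLimit K (fun k x => η x * W k x) (fun x => η x * c x) := by
  obtain ⟨C, hC, h⟩ := h
  obtain ⟨M, hM⟩ := (isCompact_simplex K).exists_bound_of_continuousOn hη.continuous.continuousOn
  obtain ⟨M', hM'⟩ := (isCompact_simplex K).exists_bound_of_continuousOn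
    (hη.continuous_fderiv one_ne_zero).continuousOn
  refine ⟨max (M * C) (M * C + C * M'), ?_, fun x hx => ?_⟩
  · obtain ⟨x, hx⟩ := hK.interior_nonempty
    have := (norm_nonneg _).trans (hM x (interior_subset hx))
    exact (mul_nonneg this hC).trans (le_max_left _ _)
  obtain ⟨D, D', h1, h2, h3, h4, h5, h6⟩ := h x hx
  have hη' : HasStrictFDerivAt η (fderiv ℝ η x) x :=
    hη.contDiffAt.hasStrictFDerivAt one_ne_zero
  have hMx := hM x (interior_subset hx)
  have hM'x := hM' x (interior_subset hx)
  have hwt := hK.one_le_wt hx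
  refine ⟨fun k => η x • D k + W k x • fderiv ℝ η x, η x • D' + c x • fderiv ℝ η x,
    fun k => hη'.mul (h1 k), hη'.mul h2, (h3.const_smul _).add (h4.smul_const _),
    h4.const_mul _, fun k => ?_, fun k => ?_⟩
  · refine (norm_add_le _ _).trans ?_
    rw [norm_smul, norm_smul]
    calc ‖η x‖ * ‖D k‖ + ‖W k x‖ * ‖fderiv ℝ η x‖ ≤ M * (C * wt K x) + C * M' := by
          gcongr
          · exact (norm_nonneg _).trans hMx
          · exact h5 k
          · exact h6 k
      _ ≤ M * (C * wt K x) + C * M' * wt K x := by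
          have : C * M' ≤ C * M' * wt K x :=
            le_mul_of_one_le_right (mul_nonneg hC ((norm_nonneg _).trans hM'x)) hwt
          linarith
      _ = (M * C + C * M') * wt K x := by ring
      _ ≤ _ := mul_le_mul_of_nonneg_right (le_max_right _ _) (wt_nonneg K x)
  · rw [abs_mul]
    exact (mul_le_mul hMx (h6 k) (abs_nonneg _) ((norm_nonneg _).trans hMx)).trans (le_max_left _ _)

theorem sub (hK : IsSimplex K) (h : CutoffLimit K W c) (h' : CutoffLimit K V b) :
    CutoffLimit K (fun k x => W k x - V k x) (fun x => c x - b x) := by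
  have := h.add (h'.mul hK (contDiff_const (c := (-1 : ℝ))))
  simpa [sub_eq_add_neg] using this

end CutoffLimit

/-- Passage to the limit in Green's formula. -/
theorem sum_normalPairing_eq_zero {Ω : Set (Euc n)} (T : Triangulation Ω)
    (hΩb : Bornology.IsBounded Ω) {u : Euc n → Euc n} {d : Euc n → ℝ} (hu : IsH0Div Ω u d)
    (hw : ∀ K ∈ T.cells, IntegrableOn (fun x => ‖u x‖ * wt K x) (convexHull ℝ (K : Set (Euc n))))
    {φ : Euc n → ℝ} (hφ : ContDiff ℝ 1 φ) {W : ℕ → Euc n → ℝ} {c : Finset (Euc n) → Euc n → ℝ}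
    (hW : ∀ k, BddLip (closure Ω) (W k)) (hc : ∀ K ∈ T.cells, CutoffLimit K W (c K)) :
    ∑ K ∈ T.cells, normalPairing (convexHull ℝ (K : Set (Euc n))) u d (fun x => φ x * c K x)
      = 0 := by
  have : IsFiniteMeasure (volume.restrict Ω) :=
    ⟨by rw [Measure.restrict_apply_univ]; exact hΩb.measure_lt_top⟩
  have hdi : Integrable d (volume.restrict Ω) := hu.memLp_div.integrable (by norm_num)
  have hφc : ∀ K ∈ T.cells, CutoffLimit K (fun k x => φ x * W k x) (fun x => φ x * c K x) :=
    fun K hK => (hc K hK).mul (Triangulation.isSimplex hK) hφ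
  set F : ℕ → Euc n → ℝ := fun k x => d x * (φ x * W k x) +
    fderiv ℝ (fun y => φ y * W k y) x (u x) with hF
  have hmeas : ∀ k, AEStronglyMeasurable (F k) (volume.restrict Ω) := fun k => by
    have h1 : AEStronglyMeasurable (fun x => φ x * W k x) (volume.restrict Ω) := by
      obtain ⟨C, hC, -, h2⟩ := (BddLip.of_contDiff hΩb.closure hφ).mul (hW k)
      have hlip : LipschitzOnWith ⟨C, hC⟩ (fun x => φ x * W k x) Ω := by
        refine LipschitzOnWith.of_dist_le_mul fun x hx y hy => ?_
        rw [Real.dist_eq, dist_eq_norm]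
        exact h2 x (subset_closure hx) y (subset_closure hy)
      exact hlip.continuousOn.aestronglyMeasurable T.isOpen.measurableSet
    exact (hdi.aestronglyMeasurable.mul h1).add
      (integrable_fderiv_apply hu.memLp.aestronglyMeasurable _)
  -- A dominating function independent of `k`. Its integrability is the assumption `hw` on `‖u‖ wt`.
  have hbd : ∀ K ∈ T.cells, ∃ G : Euc n → ℝ, IntegrableOn G (convexHull ℝ (K : Set (Euc n))) ∧
      ∀ k, ∀ᵐ x ∂(volume.restrict (convexHull ℝ (K : Set (Euc n)))), ‖F k x‖ ≤ G x := by
    intro K hK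
    obtain ⟨C, hC, h⟩ := hφc K hK
    refine ⟨fun x => |d x| * C + C * (‖u x‖ * wt K x), ?_, fun k => ?_⟩
    · exact ((hdi.mono_measure (Triangulation.restrict_simplex_le hK)).abs.mul_const _).add
        ((hw K hK).const_mul _)
    · filter_upwards [ae_mem_interior_simplex K] with x hx
      obtain ⟨D, D', h1, h2, h3, h4, h5, h6⟩ := h x hx
      simp only [hF]
      rw [(h1 k).hasFDerivAt.fderiv]
      refine (norm_add_le _ _).trans (add_le_add ?_ ?_)
      · rw [norm_mul]
        exact mul_le_mul_of_nonneg_left (h6 k) (norm_nonneg _)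
      · refine ((D k).le_opNorm _).trans ?_
        calc ‖D k‖ * ‖u x‖ ≤ C * wt K x * ‖u x‖ :=
              mul_le_mul_of_nonneg_right (h5 k) (norm_nonneg _)
          _ = _ := by ring
  have hFi : ∀ k, ∀ K ∈ T.cells, IntegrableOn (F k) (convexHull ℝ (K : Set (Euc n))) := by
    intro k K hK
    obtain ⟨G, hG, hle⟩ := hbd K hK
    exact hG.mono' ((hmeas k).mono_measure (Triangulation.restrict_simplex_le hK)) (hle k)
  -- For fixed `k` the function `φ · W k` is Lipschitz across all cells, so Green's formula on the
  -- whole of `Ω` applies.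
  have h0 : ∀ k, ∑ K ∈ T.cells, ∫ x in convexHull ℝ (K : Set (Euc n)), F k x = 0 := by
    intro k
    rw [← T.integral_eq_sum (T.integrableOn_of_cells (hFi k))]
    refine normalPairing_eq_zero_of_bddLip T.isOpen hΩb hu
      ((BddLip.of_contDiff hΩb.closure hφ).mul (hW k)) ?_
    filter_upwards [T.ae_mem_interior] with x ⟨K, hK, hx⟩
    obtain ⟨C, hC, h⟩ := hφc K hK
    obtain ⟨D, D', h1, -⟩ := h x hx
    exact ⟨D k, h1 k⟩
  have hlim : Tendsto (fun k => ∑ K ∈ T.cells, ∫ x in convexHull ℝ (K : Set (Euc n)), F k x) atTop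
      (𝓝 (∑ K ∈ T.cells, normalPairing (convexHull ℝ (K : Set (Euc n))) u d
        (fun x => φ x * c K x))) := by
    refine tendsto_finsetSum _ fun K hK => ?_
    obtain ⟨G, hG, hle⟩ := hbd K hK
    obtain ⟨C, hC, h⟩ := hφc K hK
    refine tendsto_integral_of_dominated_convergence G
      (fun k => (hmeas k).mono_measure (Triangulation.restrict_simplex_le hK)) hG hle ?_
    filter_upwards [ae_mem_interior_simplex K] with x hx
    obtain ⟨D, D', h1, h2, h3, h4, -⟩ := h x hx
    simp only [hF, fun k => (h1 k).hasFDerivAt.fderiv, h2.hasFDerivAt.fderiv]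
    exact (h4.const_mul _).add
      (((ContinuousLinearMap.apply ℝ ℝ (u x)).continuous.tendsto D').comp h3)
  simp_rw [h0] at hlim
  exact (tendsto_nhds_unique hlim tendsto_const_nhds)

/-! ### Derivatives of quotients -/

/-- The derivative of `N / (N + M)`. -/
def quotDeriv (N M : ℝ) (N' M' : Euc n →L[ℝ] ℝ) : Euc n →L[ℝ] ℝ :=
  ((N + M) ^ 2)⁻¹ • (M • N' - N • M')

theorem hasStrictFDerivAt_quot {N M : Euc n → ℝ} {N' M' : Euc n →L[ℝ] ℝ} {x : Euc n}
    (hN : HasStrictFDerivAt N N' x) (hM : HasStrictFDerivAt M M' x) (h : N x + M x ≠ 0) :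
    HasStrictFDerivAt (fun y => N y / (N y + M y)) (quotDeriv (N x) (M x) N' M') x := by
  have h2 : HasStrictFDerivAt (fun y => (N y + M y)⁻¹)
      ((-((N x + M x) ^ 2)⁻¹) • (N' + M')) x :=
    (hasStrictDerivAt_inv h).comp_hasStrictFDerivAt x (hN.add hM)
  have h1 := hN.mul h2
  simp only [div_eq_mul_inv]
  refine h1.congr_fderiv ?_
  unfold quotDeriv
  ext y
  simp only [FunLike.coe_smul, FunLike.coe_sub, FunLike.coe_add, Pi.smul_apply, Pi.sub_apply,
    Pi.add_apply, smul_eq_mul]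
  field_simp
  ring

/-- Both coefficients in the numerator are at most `N + M + δ`, so one factor of the squared
denominator cancels. The resulting bound does not depend on `δ`. -/
theorem norm_quotDeriv_le {N M δ a b w : ℝ} {N' M' : Euc n →L[ℝ] ℝ} (hN : 0 < N) (hM : 0 ≤ M)
    (hδ : 0 ≤ δ) (hw : (N + M)⁻¹ ≤ w) (hN' : ‖N'‖ ≤ a) (hM' : ‖M'‖ ≤ b) :
    ‖quotDeriv N (M + δ) N' M'‖ ≤ (a + b) * w := by
  have hpos : 0 < N + (M + δ) := by linarith
  have ha : 0 ≤ a := (norm_nonneg _).trans hN'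
  have hb : 0 ≤ b := (norm_nonneg _).trans hM'
  unfold quotDeriv
  rw [norm_smul, Real.norm_of_nonneg (by positivity)]
  have h1 : ‖(M + δ) • N' - N • M'‖ ≤ (N + (M + δ)) * (a + b) := by
    refine (norm_sub_le _ _).trans ?_
    rw [norm_smul, norm_smul, Real.norm_of_nonneg hN.le, Real.norm_of_nonneg (by linarith)]
    calc (M + δ) * ‖N'‖ + N * ‖M'‖ ≤ (M + δ) * a + N * b := by gcongr
      _ ≤ _ := by nlinarith [mul_nonneg hN.le ha, mul_nonneg (add_nonneg hM hδ) hb]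
  have h2 : (N + (M + δ))⁻¹ ≤ w := (inv_anti₀ (by linarith) (by linarith)).trans hw
  calc ((N + (M + δ)) ^ 2)⁻¹ * ‖(M + δ) • N' - N • M'‖
      ≤ ((N + (M + δ)) ^ 2)⁻¹ * ((N + (M + δ)) * (a + b)) := by gcongr
    _ = (a + b) * (N + (M + δ))⁻¹ := by field_simp
    _ ≤ _ := mul_le_mul_of_nonneg_left h2 (by linarith)

theorem tendsto_quotDeriv {N M : ℝ} {N' M' : Euc n →L[ℝ] ℝ} (h : N + M ≠ 0) {δ : ℕ → ℝ}
    (hδ : Tendsto δ atTop (𝓝 0)) :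
    Tendsto (fun k => quotDeriv N (M + δ k) N' M') atTop (𝓝 (quotDeriv N M N' M')) := by
  have h1 : Tendsto (fun k => M + δ k) atTop (𝓝 M) := by simpa using hδ.const_add M
  unfold quotDeriv
  refine Tendsto.smul (((h1.const_add N).pow 2).inv₀ (pow_ne_zero 2 h)) ?_
  exact (h1.smul_const N').sub_const _

/-! ### The cutoff functions of a simplex -/

/-- The product of the barycentric coordinates other than that of `j`. -/
def faceProd (K : Finset (Euc n)) (j x : Euc n) : ℝ := ∏ v ∈ K.erase j, bary K v x

/-- The derivative of `faceProd K j`. -/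
def faceProdDeriv (K : Finset (Euc n)) (j x : Euc n) : Euc n →L[ℝ] ℝ :=
  ∑ v ∈ K.erase j, (∏ w ∈ (K.erase j).erase v, bary K w x) • baryGrad K v

theorem hasStrictFDerivAt_faceProd (K : Finset (Euc n)) (j x : Euc n) :
    HasStrictFDerivAt (faceProd K j) (faceProdDeriv K j x) x :=
  HasStrictFDerivAt.finsetProd fun v _ => bary_hasStrictFDerivAt K v x

theorem faceProd_nonneg {K : Finset (Euc n)} (hK : IsSimplex K) {x : Euc n}
    (hx : x ∈ convexHull ℝ (K : Set (Euc n))) (j : Euc n) : 0 ≤ faceProd K j x :=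
  Finset.prod_nonneg fun v _ => hK.bary_nonneg hx v

theorem faceProd_pos {K : Finset (Euc n)} (hK : IsSimplex K) {x : Euc n}
    (hx : x ∈ interior (convexHull ℝ (K : Set (Euc n)))) (j : Euc n) : 0 < faceProd K j x :=
  Finset.prod_pos fun v hv => hK.mem_interior_iff.1 hx v (Finset.mem_of_mem_erase hv)

theorem faceCutoff_erase (K : Finset (Euc n)) {j : Euc n} (hj : j ∈ K) (x : Euc n) :
    faceCutoff K (K.erase j) x = faceProd K j x / (faceProd K j x + bary K j x) := by
  unfold faceCutoff faceProd
  rw [Finset.sdiff_erase_self hj, Finset.sum_singleton]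

theorem IsSimplex.norm_faceProdDeriv_le {K : Finset (Euc n)} (hK : IsSimplex K) {x : Euc n}
    (hx : x ∈ convexHull ℝ (K : Set (Euc n))) {j : Euc n} (hj : j ∈ K) {B : ℝ}
    (hB : ∀ v, ‖baryGrad K v‖ ≤ B) : ‖faceProdDeriv K j x‖ ≤ n * B := by
  have hcard : (K.erase j).card = n := by
    rw [Finset.card_erase_of_mem hj, hK.card_eq]; rfl
  unfold faceProdDeriv
  refine (norm_sum_le_of_le (K.erase j) (f := fun v =>
    (∏ w ∈ (K.erase j).erase v, bary K w x) • baryGrad K v) (n := fun _ => B) ?_).trans ?_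
  · intro v _
    rw [norm_smul, Real.norm_of_nonneg (Finset.prod_nonneg fun w _ => hK.bary_nonneg hx w)]
    refine (mul_le_of_le_one_left (norm_nonneg _) ?_).trans (hB v)
    exact Finset.prod_le_one (fun w _ => hK.bary_nonneg hx w) fun w _ => hK.bary_le_one hx w
  · rw [Finset.sum_const, hcard, nsmul_eq_mul]

/-- For `P` the product of the other coordinates, `(P + λ_j)² ≥ P λ_j`, the product of all
coordinates. This symmetric weight serves all facets of `K` at once. -/
theorem IsSimplex.inv_add_le_wt {K : Finset (Euc n)} (hK : IsSimplex K) {x : Euc n}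
    (hx : x ∈ interior (convexHull ℝ (K : Set (Euc n)))) {j : Euc n} (hj : j ∈ K) :
    (faceProd K j x + bary K j x)⁻¹ ≤ wt K x := by
  have h1 := faceProd_pos hK hx j
  have h2 := hK.mem_interior_iff.1 hx j hj
  refine inv_anti₀ (Real.sqrt_pos.2 (hK.prod_bary_pos hx)) ?_
  refine Real.sqrt_le_iff.2 ⟨by linarith, ?_⟩
  rw [← Finset.mul_prod_erase _ _ hj]
  change bary K j x * faceProd K j x ≤ _
  nlinarith [sq_nonneg (faceProd K j x), sq_nonneg (bary K j x), mul_pos h1 h2]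

/-- The derivative of `faceCutoff K (K.erase j)`. -/
def cutoffDeriv (K : Finset (Euc n)) (j x : Euc n) : Euc n →L[ℝ] ℝ :=
  quotDeriv (faceProd K j x) (bary K j x) (faceProdDeriv K j x) (baryGrad K j)

theorem IsSimplex.hasStrictFDerivAt_faceCutoff {K : Finset (Euc n)} (hK : IsSimplex K) {x : Euc n}
    (hx : x ∈ interior (convexHull ℝ (K : Set (Euc n)))) {j : Euc n} (hj : j ∈ K) :
    HasStrictFDerivAt (faceCutoff K (K.erase j)) (cutoffDeriv K j x) x := by
  have h1 := faceProd_pos hK hx j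
  have h2 := hK.mem_interior_iff.1 hx j hj
  have h3 : faceCutoff K (K.erase j) =
      fun y => faceProd K j y / (faceProd K j y + bary K j y) :=
    funext fun y => faceCutoff_erase K hj y
  rw [h3]
  exact hasStrictFDerivAt_quot (hasStrictFDerivAt_faceProd K j x)
    (bary_hasStrictFDerivAt K j x) (by linarith)

theorem IsSimplex.norm_cutoffDeriv_le {K : Finset (Euc n)} (hK : IsSimplex K) {x : Euc n}
    (hx : x ∈ interior (convexHull ℝ (K : Set (Euc n)))) {j : Euc n} (hj : j ∈ K) {B : ℝ}
    (hB : ∀ v, ‖baryGrad K v‖ ≤ B) : ‖cutoffDeriv K j x‖ ≤ (n * B + B) * wt K x := by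
  have := norm_quotDeriv_le (faceProd_pos hK hx j) (hK.bary_nonneg (interior_subset hx) j) le_rfl
    (hK.inv_add_le_wt hx hj) (hK.norm_faceProdDeriv_le (interior_subset hx) hj hB) (hB j)
  rwa [add_zero] at this

theorem IsSimplex.faceCutoff_mem_Icc {K : Finset (Euc n)} (hK : IsSimplex K) {x : Euc n}
    (hx : x ∈ convexHull ℝ (K : Set (Euc n))) {j : Euc n} (hj : j ∈ K) :
    faceCutoff K (K.erase j) x ∈ Set.Icc (0 : ℝ) 1 := by
  have h1 := faceProd_nonneg hK hx j
  have h2 := hK.bary_nonneg hx j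
  rw [faceCutoff_erase K hj]
  exact ⟨div_nonneg h1 (add_nonneg h1 h2), div_le_one_of_le₀ (by linarith) (add_nonneg h1 h2)⟩

theorem exists_baryGrad_bound (K : Finset (Euc n)) : ∃ B, 0 ≤ B ∧ ∀ v, ‖baryGrad K v‖ ≤ B := by
  refine ⟨∑ v ∈ K, ‖baryGrad K v‖, Finset.sum_nonneg fun v _ => norm_nonneg _, fun v => ?_⟩
  by_cases hv : v ∈ K
  · exact Finset.single_le_sum (f := fun v => ‖baryGrad K v‖) (fun v _ => norm_nonneg _) hv
  · have h : baryGrad K v = 0 := by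
      have h1 : bary K v = fun _ => 0 := funext fun x => bary_of_notMem hv x
      unfold baryGrad
      rw [h1]
      exact fderiv_const_apply _
    rw [h, norm_zero]
    exact Finset.sum_nonneg fun v _ => norm_nonneg _

/-- The regularisation parameters `1 / (k + 1)`. -/
def regSeq (k : ℕ) : ℝ := 1 / ((k : ℝ) + 1)

theorem regSeq_pos (k : ℕ) : 0 < regSeq k := by unfold regSeq; positivity

theorem tendsto_regSeq : Tendsto regSeq atTop (𝓝 0) := tendsto_one_div_add_atTop_nhds_zero_nat

/-- The added constant bounds the denominator from below, which later gives a Lipschitz function on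
`closure Ω`; the bound of the derivative by `wt` is uniform in the constant. -/
theorem IsSimplex.cutoffLimit_faceCutoff {K : Finset (Euc n)} (hK : IsSimplex K) {j : Euc n}
    (hj : j ∈ K) : CutoffLimit K
      (fun k x => faceProd K j x / (faceProd K j x + (bary K j x + regSeq k)))
      (faceCutoff K (K.erase j)) := by
  obtain ⟨B, hB0, hB⟩ := exists_baryGrad_bound K
  refine ⟨max (n * B + B) 1, le_max_of_le_right zero_le_one, fun x hx => ?_⟩
  have h1 := faceProd_pos hK hx j
  have h2 := hK.mem_interior_iff.1 hx j hj
  refine ⟨fun k => quotDeriv (faceProd K j x) (bary K j x + regSeq k) (faceProdDeriv K j x)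
    (baryGrad K j), cutoffDeriv K j x, fun k => ?_, hK.hasStrictFDerivAt_faceCutoff hx hj,
    tendsto_quotDeriv (by linarith) tendsto_regSeq, ?_, fun k => ?_, fun k => ?_⟩
  · exact hasStrictFDerivAt_quot (hasStrictFDerivAt_faceProd K j x)
      ((bary_hasStrictFDerivAt K j x).add_const _) (by linarith [regSeq_pos k])
  · rw [faceCutoff_erase K hj]
    refine Tendsto.div tendsto_const_nhds ?_ (by linarith)
    simpa using (tendsto_regSeq.const_add (bary K j x)).const_add (faceProd K j x)
  · exact (norm_quotDeriv_le h1 h2.le (regSeq_pos k).le (hK.inv_add_le_wt hx hj)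
      (hK.norm_faceProdDeriv_le (interior_subset hx) hj hB) (hB j)).trans
      (mul_le_mul_of_nonneg_right (le_max_left _ _) (wt_nonneg K x))
  · have h3 := regSeq_pos k
    rw [abs_of_nonneg (by positivity)]
    exact (div_le_one_of_le₀ (by linarith) (by positivity)).trans (le_max_right _ _)

/-- The sum over the facets of the products of barycentric coordinates; it vanishes exactly on the
faces of codimension at least two. -/
def coreSum (K : Finset (Euc n)) (x : Euc n) : ℝ := ∑ j ∈ K, faceProd K j x

/-- Each term of the derivative carries the product `Q` of all coordinates except `λ_j` and `λ_v`.
Since `λ_v Q` and `λ_j Q` are two summands of `coreSum`, `(λ_v + λ_j) Q ≤ coreSum`; and `1 ≤ (λ_v +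
λ_j) wt` because the product of all coordinates is at most `λ_j λ_v`. The factor `coreSum` is what
makes `cutoffLimit_core` uniform. -/
theorem IsSimplex.norm_coreSumDeriv_le {K : Finset (Euc n)} (hK : IsSimplex K) {x : Euc n}
    (hx : x ∈ interior (convexHull ℝ (K : Set (Euc n)))) {B : ℝ} (hB : ∀ v, ‖baryGrad K v‖ ≤ B) :
    ‖∑ j ∈ K, faceProdDeriv K j x‖ ≤ ∑ j ∈ K, ∑ _v ∈ K.erase j, coreSum K x * wt K x * B := by
  have hpos := hK.mem_interior_iff.1 hx
  have hB0 : 0 ≤ B := (norm_nonneg _).trans (hB 0)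
  refine norm_sum_le_of_le _ fun j hj => norm_sum_le_of_le _ fun v hv => ?_
  have hvK := Finset.mem_of_mem_erase hv
  have hvj := Finset.ne_of_mem_erase hv
  set Q := ∏ w ∈ (K.erase j).erase v, bary K w x with hQ
  have hQ0 : 0 ≤ Q := Finset.prod_nonneg fun w _ => hK.bary_nonneg (interior_subset hx) w
  have hQ1 : Q ≤ 1 := Finset.prod_le_one (fun w _ => hK.bary_nonneg (interior_subset hx) w)
    fun w _ => hK.bary_le_one (interior_subset hx) w
  have e1 : faceProd K j x = bary K v x * Q := (Finset.mul_prod_erase _ _ hv).symm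
  have e2 : faceProd K v x = bary K j x * Q := by
    rw [hQ, Finset.erase_right_comm]
    exact (Finset.mul_prod_erase _ _ (Finset.mem_erase.2 ⟨hvj.symm, hj⟩)).symm
  have h1 : (bary K v x + bary K j x) * Q ≤ coreSum K x := by
    have h2 : ∑ i ∈ {j, v}, faceProd K i x ≤ coreSum K x := by
      refine Finset.sum_le_sum_of_subset_of_nonneg ?_
        fun i _ _ => faceProd_nonneg hK (interior_subset hx) i
      intro i hi
      rcases Finset.mem_insert.1 hi with rfl | hi
      · exact hj
      · rw [Finset.mem_singleton.1 hi]; exact hvK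
    rw [Finset.sum_pair hvj.symm, e1, e2] at h2
    linarith
  have h3 : 1 ≤ (bary K v x + bary K j x) * wt K x := by
    have hs := Real.sqrt_pos.2 (hK.prod_bary_pos hx)
    unfold wt
    rw [← div_eq_mul_inv, one_le_div hs, Real.sqrt_le_iff]
    refine ⟨by linarith [hpos v hvK, hpos j hj], ?_⟩
    rw [← Finset.mul_prod_erase _ _ hj]
    change bary K j x * faceProd K j x ≤ _
    rw [e1]
    have h4 : bary K j x * (bary K v x * Q) ≤ bary K j x * (bary K v x * 1) := by
      have := hpos v hvK
      have := hpos j hj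
      gcongr
    nlinarith [hpos v hvK, hpos j hj, mul_pos (hpos v hvK) (hpos j hj)]
  rw [norm_smul, Real.norm_of_nonneg hQ0]
  have hw := wt_nonneg K x
  calc Q * ‖baryGrad K v‖ ≤ Q * B := mul_le_mul_of_nonneg_left (hB v) hQ0
    _ ≤ (coreSum K x * wt K x) * B := by
        refine mul_le_mul_of_nonneg_right ?_ hB0
        calc Q ≤ ((bary K v x + bary K j x) * wt K x) * Q := le_mul_of_one_le_left hQ0 h3
          _ = (bary K v x + bary K j x) * Q * wt K x := by ring
          _ ≤ _ := mul_le_mul_of_nonneg_right h1 hw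

theorem IsSimplex.coreSum_pos {K : Finset (Euc n)} (hK : IsSimplex K) {x : Euc n}
    (hx : x ∈ interior (convexHull ℝ (K : Set (Euc n)))) : 0 < coreSum K x :=
  Finset.sum_pos (fun j _ => faceProd_pos hK hx j)
    (Finset.card_pos.1 (by rw [hK.card_eq]; omega))

/-- The derivative of `S / (S + δ)` is at most `δ S / (S + δ)²` times a multiple of `wt`, and that
quotient is at most `1`. So faces of codimension two, where `S` vanishes, can be cut out at no cost
in the limit. -/
theorem IsSimplex.cutoffLimit_core {K : Finset (Euc n)} (hK : IsSimplex K) :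
    CutoffLimit K (fun k x => coreSum K x / (coreSum K x + regSeq k)) (fun _ => 1) := by
  obtain ⟨B, hB0, hB⟩ := exists_baryGrad_bound K
  set C := ∑ j ∈ K, ∑ _v ∈ K.erase j, B with hC
  have hC0 : 0 ≤ C := Finset.sum_nonneg fun j _ => Finset.sum_nonneg fun v _ => hB0
  refine ⟨max C 1, le_max_of_le_right zero_le_one, fun x hx => ?_⟩
  have hS := hK.coreSum_pos hx
  have hder : HasStrictFDerivAt (coreSum K) (∑ j ∈ K, faceProdDeriv K j x) x :=
    HasStrictFDerivAt.fun_sum fun j _ => hasStrictFDerivAt_faceProd K j x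
  have hbd : ‖∑ j ∈ K, faceProdDeriv K j x‖ ≤ coreSum K x * (C * wt K x) := by
    refine (hK.norm_coreSumDeriv_le hx hB).trans (le_of_eq ?_)
    simp_rw [← Finset.mul_sum]
    rw [← hC]; ring
  refine ⟨fun k => quotDeriv (coreSum K x) (regSeq k) (∑ j ∈ K, faceProdDeriv K j x) 0, 0,
    fun k => ?_, hasStrictFDerivAt_const _ _, ?_, ?_, fun k => ?_, fun k => ?_⟩
  · exact hasStrictFDerivAt_quot hder (hasStrictFDerivAt_const (regSeq k) x)
      (by linarith [regSeq_pos k])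
  · have := tendsto_quotDeriv (N := coreSum K x) (M := 0) (N' := ∑ j ∈ K, faceProdDeriv K j x)
      (M' := 0) (by linarith) tendsto_regSeq
    simpa [quotDeriv] using this
  · have : Tendsto (fun k => coreSum K x / (coreSum K x + regSeq k)) atTop
        (𝓝 (coreSum K x / coreSum K x)) := by
      refine Tendsto.div tendsto_const_nhds ?_ hS.ne'
      simpa using tendsto_regSeq.const_add (coreSum K x)
    rwa [div_self hS.ne'] at this
  · have h3 := regSeq_pos k
    have hw := wt_nonneg K x
    simp only [quotDeriv, smul_zero, sub_zero]
    rw [norm_smul, norm_smul, Real.norm_of_nonneg h3.le, Real.norm_of_nonneg (by positivity)]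
    calc ((coreSum K x + regSeq k) ^ 2)⁻¹ * (regSeq k * ‖∑ j ∈ K, faceProdDeriv K j x‖)
        ≤ ((coreSum K x + regSeq k) ^ 2)⁻¹ * (regSeq k * (coreSum K x * (C * wt K x))) := by
          gcongr
      _ = (regSeq k * coreSum K x / (coreSum K x + regSeq k) ^ 2) * (C * wt K x) := by
          field_simp
      _ ≤ 1 * (C * wt K x) := by
          refine mul_le_mul_of_nonneg_right ?_ (by positivity)
          refine div_le_one_of_le₀ ?_ (by positivity)
          nlinarith [mul_pos hS h3, sq_nonneg (coreSum K x), sq_nonneg (regSeq k)]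
      _ ≤ max C 1 * wt K x := by
          rw [one_mul]
          exact mul_le_mul_of_nonneg_right (le_max_left _ _) hw
  · have h3 := regSeq_pos k
    rw [abs_of_nonneg (by positivity)]
    exact (div_le_one_of_le₀ (by linarith) (by positivity)).trans (le_max_right _ _)

/-! ### Properties of the normal components on faces -/

section Faces

variable {Ω : Set (Euc n)} {T : Triangulation Ω}

/-- The product of the hat functions of the vertices in `e`. -/
def hatProd (T : Triangulation Ω) (e : Finset (Euc n)) (x : Euc n) : ℝ := ∏ v ∈ e, T.hat v x

theorem hatProd_nonneg {x : Euc n} (hx : x ∈ closure Ω) (e : Finset (Euc n)) :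
    0 ≤ hatProd T e x := Finset.prod_nonneg fun v _ => Triangulation.hat_nonneg hx v

theorem BddLip.hatProd (T : Triangulation Ω) (e : Finset (Euc n)) :
    BddLip (closure Ω) (hatProd T e) := BddLip.prod fun v _ => BddLip.hat T v

theorem hatProd_erase {K : Finset (Euc n)} (hK : K ∈ T.cells) {x : Euc n}
    (hx : x ∈ convexHull ℝ (K : Set (Euc n))) (j : Euc n) :
    hatProd T (K.erase j) x = faceProd K j x :=
  Finset.prod_congr rfl fun v _ => Triangulation.hat_eq hK hx v

theorem hatProd_eq_zero {K e : Finset (Euc n)} (hK : K ∈ T.cells) {x : Euc n}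
    (hx : x ∈ convexHull ℝ (K : Set (Euc n))) (he : ¬ e ⊆ K) : hatProd T e x = 0 := by
  obtain ⟨v, hv, hvK⟩ := Finset.not_subset.1 he
  refine Finset.prod_eq_zero hv ?_
  rw [Triangulation.hat_eq hK hx, bary_of_notMem hvK]

theorem normalPairing_mul_zero (S : Set (Euc n)) (u : Euc n → Euc n) (d φ : Euc n → ℝ) :
    normalPairing S u d (fun x => φ x * 0) = 0 := by
  simp [normalPairing]

/-- The normal components of `u` on the two sides of an interior facet cancel, and those on a
boundary facet vanish. -/
theorem sum_faceFlux_eq_zero (hΩb : Bornology.IsBounded Ω)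
    {u : Euc n → Euc n} {d : Euc n → ℝ} (hu : IsH0Div Ω u d)
    (hw : ∀ K ∈ T.cells, IntegrableOn (fun x => ‖u x‖ * wt K x) (convexHull ℝ (K : Set (Euc n))))
    {φ : Euc n → ℝ} (hφ : ContDiff ℝ 1 φ) {e : Finset (Euc n)} (he : e.card = n) :
    ∑ K ∈ T.cellsAt e, faceFlux u d K e φ = 0 := by
  classical
  -- A single function on `closure Ω`: on a cell with vertices `e` and `a`, `1 - ∑ v ∈ e, λ_v` is
  -- `λ_a`, so `W k` is the regularised cutoff of `e`; on a cell that does not contain `e` the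
  -- product vanishes.
  let W : ℕ → Euc n → ℝ := fun k x =>
    hatProd T e x / (hatProd T e x + ((1 - ∑ v ∈ e, T.hat v x) + regSeq k))
  have h := sum_normalPairing_eq_zero T hΩb hu hw hφ (W := W)
    (c := fun K => if e ⊆ K then faceCutoff K e else fun _ => 0) (fun k => ?_) (fun K hK => ?_)
  · rw [← h]
    unfold Triangulation.cellsAt
    rw [Finset.sum_filter]
    refine Finset.sum_congr rfl fun K _ => ?_
    by_cases heK : e ⊆ K
    · simp only [if_pos heK]; rfl
    · simp only [if_neg heK, normalPairing_mul_zero]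
  · refine (BddLip.hatProd T e).div ((BddLip.hatProd T e).add (((BddLip.const 1).sub
      (BddLip.sum fun v _ => BddLip.hat T v)).add (BddLip.const _))) (regSeq_pos k) fun x hx => ?_
    have h1 := hatProd_nonneg (T := T) hx e
    have h2 := Triangulation.sum_hat_le_one (T := T) e hx
    linarith
  · have hsK := Triangulation.isSimplex hK
    by_cases heK : e ⊆ K
    · simp only [if_pos heK]
      obtain ⟨a, ha, rfl⟩ := Triangulation.exists_eq_insert he (T.mem_cellsAt.2 ⟨hK, heK⟩)
      have hle := hsK.cutoffLimit_faceCutoff (Finset.mem_insert_self a e)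
      have hea : (insert a e).erase a = e := Finset.erase_insert ha
      rw [hea] at hle
      refine hle.congr (fun x hx k => ?_) fun x _ => rfl
      have hx' := interior_subset hx
      have e1 : hatProd T e x = faceProd (insert a e) a x := by
        rw [← hatProd_erase hK hx', hea]
      have e2 : 1 - ∑ v ∈ e, T.hat v x = bary (insert a e) a x := by
        rw [← hsK.sum_bary x, Finset.sum_insert ha]
        simp_rw [Triangulation.hat_eq hK hx']
        ring
      simp only [W, e1, e2]
    · simp only [if_neg heK]
      refine (CutoffLimit.zero K).congr (fun x hx k => ?_) fun x _ => rfl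
      simp only [W, hatProd_eq_zero hK (interior_subset hx) heK, zero_div]

theorem not_subset_of_ne {K L : Finset (Euc n)} (hK : K ∈ T.cells) (hL : L ∈ T.cells)
    (h : L ≠ K) : ∃ v ∈ K, v ∉ L := by
  by_contra! hcon
  refine h (Finset.eq_of_subset_of_card_le hcon ?_).symm
  rw [(Triangulation.isSimplex hK).card_eq, (Triangulation.isSimplex hL).card_eq]

/-- A function of the barycentric coordinates that vanishes with any of them has zero trace. -/
theorem normalPairing_eq_zero_of_cutoffLimit (hΩb : Bornology.IsBounded Ω)
    {u : Euc n → Euc n} {d : Euc n → ℝ} (hu : IsH0Div Ω u d)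
    (hw : ∀ K ∈ T.cells, IntegrableOn (fun x => ‖u x‖ * wt K x) (convexHull ℝ (K : Set (Euc n))))
    {φ : Euc n → ℝ} (hφ : ContDiff ℝ 1 φ) {K : Finset (Euc n)} (hK : K ∈ T.cells)
    {W : ℕ → Euc n → ℝ} {c : Euc n → ℝ} (hW : ∀ k, BddLip (closure Ω) (W k))
    (hc : CutoffLimit K W c)
    (h0 : ∀ k, ∀ x ∈ closure Ω, (∃ v ∈ K, T.hat v x = 0) → W k x = 0) :
    normalPairing (convexHull ℝ (K : Set (Euc n))) u d (fun x => φ x * c x) = 0 := by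
  classical
  have h := sum_normalPairing_eq_zero T hΩb hu hw hφ (W := W)
    (c := fun L => if L = K then c else fun _ => 0) hW (fun L hL => ?_)
  · rw [Finset.sum_eq_single_of_mem K hK] at h
    · simpa using h
    · intro L _ hLK
      simp only [if_neg hLK, normalPairing_mul_zero]
  · by_cases hLK : L = K
    · simp only [if_pos hLK]; rwa [hLK]
    · simp only [if_neg hLK]
      refine (CutoffLimit.zero L).congr (fun x hx k => ?_) fun x _ => rfl
      -- Another cell misses some vertex `v` of `K`; the hat function of `v` vanishes on that cell,
      -- and hence so does `W k`.
      obtain ⟨v, hvK, hvL⟩ := not_subset_of_ne hK hL hLK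
      refine h0 k x (Triangulation.simplex_subset_closure hL (interior_subset hx)) ⟨v, hvK, ?_⟩
      rw [Triangulation.hat_eq hL (interior_subset hx), bary_of_notMem hvL]

theorem hatProd_erase_eq_zero {K : Finset (Euc n)} {v j x : Euc n} (hv : v ∈ K) (hvj : v ≠ j)
    (h : T.hat v x = 0) : hatProd T (K.erase j) x = 0 :=
  Finset.prod_eq_zero (Finset.mem_erase.2 ⟨hvj, hv⟩) h

end Faces

/-! ### Functions that may be paired with the normal trace -/

/-- `c` is bounded on the interior of the simplex `K`, with derivative bounded by a multiple of the
weight `wt K`. -/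
def Admissible (K : Finset (Euc n)) (c : Euc n → ℝ) : Prop :=
  ∃ C : ℝ, 0 ≤ C ∧ ∀ x ∈ interior (convexHull ℝ (K : Set (Euc n))),
    ∃ D : Euc n →L[ℝ] ℝ, HasStrictFDerivAt c D x ∧ ‖D‖ ≤ C * wt K x ∧ |c x| ≤ C

theorem CutoffLimit.admissible {K : Finset (Euc n)} {W : ℕ → Euc n → ℝ} {c : Euc n → ℝ}
    (hc : CutoffLimit K W c) : Admissible K c := by
  obtain ⟨C, hC, h⟩ := hc
  refine ⟨C, hC, fun x hx => ?_⟩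
  obtain ⟨D, D', h1, h2, h3, h4, h5, h6⟩ := h x hx
  exact ⟨D', h2, le_of_tendsto h3.norm (Eventually.of_forall h5),
    le_of_tendsto h4.abs (Eventually.of_forall h6)⟩

namespace Admissible

variable {K : Finset (Euc n)} {b c : Euc n → ℝ}

/-- The constant sequence, through which the rules for `CutoffLimit` become available for
`Admissible`. -/
theorem cutoffLimit (hc : Admissible K c) : CutoffLimit K (fun _ => c) c := by
  obtain ⟨C, hC, h⟩ := hc
  refine ⟨C, hC, fun x hx => ?_⟩
  obtain ⟨D, h1, h2, h3⟩ := h x hx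
  exact ⟨fun _ => D, D, fun _ => h1, h1, tendsto_const_nhds, tendsto_const_nhds, fun _ => h2,
    fun _ => h3⟩

theorem mul (hK : IsSimplex K) (hc : Admissible K c) {η : Euc n → ℝ} (hη : ContDiff ℝ 1 η) :
    Admissible K fun x => η x * c x := (hc.cutoffLimit.mul hK hη).admissible

theorem sum {ι : Type*} {t : Finset ι} {c : ι → Euc n → ℝ}
    (h : ∀ i ∈ t, Admissible K (c i)) : Admissible K fun x => ∑ i ∈ t, c i x :=
  (CutoffLimit.sum fun i hi => (h i hi).cutoffLimit).admissible

theorem faceCutoff (hK : IsSimplex K) {j : Euc n} (hj : j ∈ K) :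
    Admissible K (faceCutoff K (K.erase j)) := (hK.cutoffLimit_faceCutoff hj).admissible

theorem hasFDerivAt (hc : Admissible K c) {x : Euc n}
    (hx : x ∈ interior (convexHull ℝ (K : Set (Euc n)))) : HasFDerivAt c (fderiv ℝ c x) x := by
  obtain ⟨C, hC, h⟩ := hc
  obtain ⟨D, h1, h2, h3⟩ := h x hx
  exact h1.hasFDerivAt.differentiableAt.hasFDerivAt

end Admissible

/-- The assumptions on `u` and `d` under which normal components on facets are defined. -/
structure FluxData {Ω : Set (Euc n)} (T : Triangulation Ω) (u : Euc n → Euc n) (d : Euc n → ℝ) :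
    Prop where
  bdd : Bornology.IsBounded Ω
  h0div : IsH0Div Ω u d
  integrable_wt : ∀ K ∈ T.cells,
    IntegrableOn (fun x => ‖u x‖ * wt K x) (convexHull ℝ (K : Set (Euc n)))

namespace FluxData

variable {Ω : Set (Euc n)} {T : Triangulation Ω} {u : Euc n → Euc n} {d : Euc n → ℝ}
  (hF : FluxData T u d) {K : Finset (Euc n)} (hK : K ∈ T.cells) {b c φ ψ : Euc n → ℝ}

theorem isFiniteMeasure (hF : FluxData T u d) : IsFiniteMeasure (volume.restrict Ω) :=
  ⟨by rw [Measure.restrict_apply_univ]; exact hF.bdd.measure_lt_top⟩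

theorem integrableOn_div (hF : FluxData T u d) (hK : K ∈ T.cells) :
    IntegrableOn d (convexHull ℝ (K : Set (Euc n))) := by
  have := hF.isFiniteMeasure
  exact (hF.h0div.memLp_div.integrable (by norm_num)).mono_measure
    (Triangulation.restrict_simplex_le hK)

theorem aestronglyMeasurable (hF : FluxData T u d) (hK : K ∈ T.cells) :
    AEStronglyMeasurable u (volume.restrict (convexHull ℝ (K : Set (Euc n)))) :=
  hF.h0div.memLp.aestronglyMeasurable.mono_measure (Triangulation.restrict_simplex_le hK)

theorem integrableOn_pairing (hF : FluxData T u d) (hK : K ∈ T.cells) (hc : Admissible K c) :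
    IntegrableOn (fun x => d x * c x + fderiv ℝ c x (u x)) (convexHull ℝ (K : Set (Euc n))) := by
  obtain ⟨C, hC, h⟩ := hc
  have hcm : AEStronglyMeasurable c (volume.restrict (convexHull ℝ (K : Set (Euc n)))) := by
    rw [← Measure.restrict_congr_set (interior_ae_eq_simplex K)]
    refine ContinuousOn.aestronglyMeasurable (fun x hx => ?_) isOpen_interior.measurableSet
    obtain ⟨D, h2, -⟩ := h x hx
    exact h2.continuousAt.continuousWithinAt
  refine Integrable.mono' (g := fun x => |d x| * C + C * (‖u x‖ * wt K x))
    (((hF.integrableOn_div hK).abs.mul_const C).add ((hF.integrable_wt K hK).const_mul C))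
    (((hF.integrableOn_div hK).aestronglyMeasurable.mul hcm).add
      (integrable_fderiv_apply (hF.aestronglyMeasurable hK) c)) ?_
  filter_upwards [ae_mem_interior_simplex K] with x hx
  obtain ⟨D, h2, h5, h6⟩ := h x hx
  rw [h2.hasFDerivAt.fderiv]
  refine (norm_add_le _ _).trans (add_le_add ?_ ?_)
  · rw [norm_mul]
    exact mul_le_mul_of_nonneg_left h6 (norm_nonneg _)
  · refine (D.le_opNorm _).trans ?_
    calc ‖D‖ * ‖u x‖ ≤ C * wt K x * ‖u x‖ := mul_le_mul_of_nonneg_right h5 (norm_nonneg _)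
      _ = _ := by ring

theorem normalPairing_add (hF : FluxData T u d) (hK : K ∈ T.cells) (hc : Admissible K c)
    (hb : Admissible K b) :
    normalPairing (convexHull ℝ (K : Set (Euc n))) u d (fun x => c x + b x)
      = normalPairing (convexHull ℝ (K : Set (Euc n))) u d c +
        normalPairing (convexHull ℝ (K : Set (Euc n))) u d b := by
  unfold normalPairing
  rw [← integral_add (hF.integrableOn_pairing hK hc) (hF.integrableOn_pairing hK hb)]
  refine integral_congr_ae ?_
  filter_upwards [ae_mem_interior_simplex K] with x hx
  rw [((hc.hasFDerivAt hx).fun_add (hb.hasFDerivAt hx)).fderiv]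
  simp only [FunLike.coe_add, Pi.add_apply]
  ring

theorem normalPairing_smul (hc : Admissible K c) (a : ℝ) :
    normalPairing (convexHull ℝ (K : Set (Euc n))) u d (fun x => a * c x)
      = a * normalPairing (convexHull ℝ (K : Set (Euc n))) u d c := by
  unfold normalPairing
  rw [← integral_const_mul]
  refine integral_congr_ae ?_
  filter_upwards [ae_mem_interior_simplex K] with x hx
  rw [((hc.hasFDerivAt hx).const_mul a).fderiv]
  simp only [FunLike.coe_smul, Pi.smul_apply, smul_eq_mul]
  ring

theorem normalPairing_sum (hF : FluxData T u d) (hK : K ∈ T.cells) {ι : Type*} {t : Finset ι}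
    {c : ι → Euc n → ℝ} (h : ∀ i ∈ t, Admissible K (c i)) :
    normalPairing (convexHull ℝ (K : Set (Euc n))) u d (fun x => ∑ i ∈ t, c i x)
      = ∑ i ∈ t, normalPairing (convexHull ℝ (K : Set (Euc n))) u d (c i) := by
  classical
  induction t using Finset.induction_on with
  | empty => simp [normalPairing]
  | insert a t ha ih =>
    simp_rw [Finset.sum_insert ha]
    have ht : ∀ i ∈ t, Admissible K (c i) := fun i hi => h i (Finset.mem_insert_of_mem hi)
    rw [hF.normalPairing_add hK (h a (Finset.mem_insert_self a t)) (Admissible.sum ht), ih ht]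

theorem admissible_mul_faceCutoff (hK : K ∈ T.cells) {j : Euc n} (hj : j ∈ K)
    (hφ : ContDiff ℝ 1 φ) : Admissible K fun x => φ x * faceCutoff K (K.erase j) x :=
  (Admissible.faceCutoff (Triangulation.isSimplex hK) hj).mul (Triangulation.isSimplex hK) hφ

theorem faceFlux_add (hF : FluxData T u d) (hK : K ∈ T.cells) {j : Euc n} (hj : j ∈ K)
    (hφ : ContDiff ℝ 1 φ) (hψ : ContDiff ℝ 1 ψ) :
    faceFlux u d K (K.erase j) (fun x => φ x + ψ x)
      = faceFlux u d K (K.erase j) φ + faceFlux u d K (K.erase j) ψ := by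
  unfold faceFlux
  rw [← hF.normalPairing_add hK (admissible_mul_faceCutoff hK hj hφ)
    (admissible_mul_faceCutoff hK hj hψ)]
  simp_rw [add_mul]

theorem faceFlux_smul (hK : K ∈ T.cells) {j : Euc n} (hj : j ∈ K)
    (hφ : ContDiff ℝ 1 φ) (a : ℝ) :
    faceFlux u d K (K.erase j) (fun x => a * φ x) = a * faceFlux u d K (K.erase j) φ := by
  unfold faceFlux
  rw [← normalPairing_smul (admissible_mul_faceCutoff hK hj hφ) a]
  simp_rw [mul_assoc]

/-- The normal component of `u` on the boundary of an element is the sum of those on its facets. -/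
theorem normalPairing_eq_sum_faceFlux (hF : FluxData T u d) (hK : K ∈ T.cells)
    (hφ : ContDiff ℝ 1 φ) : normalPairing (convexHull ℝ (K : Set (Euc n))) u d φ
      = ∑ j ∈ K, faceFlux u d K (K.erase j) φ := by
  have hsK := Triangulation.isSimplex hK
  let S : Euc n → ℝ := fun x => ∑ j ∈ K, hatProd T (K.erase j) x
  have hS0 : ∀ x ∈ closure Ω, 0 ≤ S x := fun x hx =>
    Finset.sum_nonneg fun j _ => hatProd_nonneg hx _
  have hSL : BddLip (closure Ω) S := BddLip.sum fun j _ => BddLip.hatProd T _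
  have hcl := hsK.cutoffLimit_core.sub hsK (CutoffLimit.sum fun j (hj : j ∈ K) =>
    hsK.cutoffLimit_faceCutoff hj)
  -- The trace of `1 - ∑ j, faceCutoff K (K.erase j)` should vanish on `∂K`. The constant `1` is
  -- regularised by the core cutoff, so that each approximation vanishes on all of `∂K`, including
  -- the lower-dimensional faces.
  have h := normalPairing_eq_zero_of_cutoffLimit hF.bdd hF.h0div hF.integrable_wt hφ hK
    (W := fun k x => S x / (S x + regSeq k) - ∑ j ∈ K, hatProd T (K.erase j) x /
      (hatProd T (K.erase j) x + (T.hat j x + regSeq k)))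
    (c := fun x => 1 - ∑ j ∈ K, faceCutoff K (K.erase j) x) (fun k => ?_) ?_ (fun k x hx hv => ?_)
  · have ha : ∀ j ∈ K, Admissible K fun x => φ x * faceCutoff K (K.erase j) x := fun j hj =>
      admissible_mul_faceCutoff hK hj hφ
    have h1 : normalPairing (convexHull ℝ (K : Set (Euc n))) u d φ =
        normalPairing (convexHull ℝ (K : Set (Euc n))) u d
          (fun x => φ x * (1 - ∑ j ∈ K, faceCutoff K (K.erase j) x)
            + ∑ j ∈ K, φ x * faceCutoff K (K.erase j) x) := by
      congr 1
      funext x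
      rw [← Finset.mul_sum]
      ring
    rw [h1, hF.normalPairing_add hK (hcl.admissible.mul hsK hφ) (Admissible.sum ha), h, zero_add,
      hF.normalPairing_sum hK ha]
    rfl
  · refine (hSL.div (hSL.add (BddLip.const _)) (regSeq_pos k)
      fun x hx => by linarith [hS0 x hx]).sub (BddLip.sum fun j _ => ?_)
    refine (BddLip.hatProd T _).div ((BddLip.hatProd T _).add ((BddLip.hat T j).add
      (BddLip.const _))) (regSeq_pos k) fun x hx => ?_
    have h1 := hatProd_nonneg (T := T) hx (K.erase j)
    have h2 := Triangulation.hat_nonneg (T := T) hx j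
    linarith
  · refine hcl.congr (fun x hx k => ?_) fun x _ => rfl
    have hx' := interior_subset hx
    simp only [S, hatProd_erase hK hx', Triangulation.hat_eq hK hx']
    rfl
  -- Where `λ_v = 0`, every product but the one omitting `v` vanishes, and both fractions reduce to
  -- the same quotient.
  · obtain ⟨v, hv, h0⟩ := hv
    have hz : ∀ j ∈ K, j ≠ v → hatProd T (K.erase j) x = 0 := fun j _ hjv =>
      hatProd_erase_eq_zero hv hjv.symm h0
    have e1 : S x = hatProd T (K.erase v) x :=
      Finset.sum_eq_single_of_mem v hv fun j hj hjv => hz j hj hjv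
    rw [Finset.sum_eq_single_of_mem v hv fun j hj hjv => by rw [hz j hj hjv, zero_div], e1, h0,
      zero_add, sub_self]

/-- Product rule for `φ` times the cutoff: the cutoff lies in `[0, 1]`, its gradient is at most `(n
B + B) wt`, and `wt ≥ 1` covers the term with `∇φ`. -/
theorem abs_faceFlux_le (hF : FluxData T u d) (hK : K ∈ T.cells) {j : Euc n} (hj : j ∈ K)
    (hφ : ContDiff ℝ 1 φ) {α α' B : ℝ} (hα : ∀ x ∈ convexHull ℝ (K : Set (Euc n)), |φ x| ≤ α)
    (hα' : ∀ x ∈ convexHull ℝ (K : Set (Euc n)), ‖fderiv ℝ φ x‖ ≤ α')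
    (hB : ∀ v, ‖baryGrad K v‖ ≤ B) :
    |faceFlux u d K (K.erase j) φ| ≤ ∫ x in convexHull ℝ (K : Set (Euc n)),
      (α * |d x| + (α' + α * (n * B + B)) * (‖u x‖ * wt K x)) := by
  have hsK := Triangulation.isSimplex hK
  rw [← Real.norm_eq_abs]
  refine norm_integral_le_of_norm_le (((hF.integrableOn_div hK).abs.const_mul _).add
    ((hF.integrable_wt K hK).const_mul _)) ?_
  filter_upwards [ae_mem_interior_simplex K] with x hx
  have hx' := interior_subset hx
  have hd : HasFDerivAt (fun x => φ x * faceCutoff K (K.erase j) x)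
      (φ x • cutoffDeriv K j x + faceCutoff K (K.erase j) x • fderiv ℝ φ x) x :=
    (hφ.differentiable one_ne_zero x).hasFDerivAt.mul
      (hsK.hasStrictFDerivAt_faceCutoff hx hj).hasFDerivAt
  rw [hd.fderiv]
  have hc := hsK.faceCutoff_mem_Icc hx' hj
  have hα0 := (abs_nonneg _).trans (hα x hx')
  have hα'0 := (norm_nonneg _).trans (hα' x hx')
  have hw := hsK.one_le_wt hx
  refine (norm_add_le _ _).trans (add_le_add ?_ ?_)
  · rw [norm_mul, mul_comm, norm_mul, Real.norm_of_nonneg hc.1]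
    refine mul_le_mul_of_nonneg_right ?_ (norm_nonneg _)
    exact (mul_le_of_le_one_right (norm_nonneg _) hc.2).trans (hα x hx')
  · refine (ContinuousLinearMap.le_opNorm _ _).trans ?_
    have : ‖φ x • cutoffDeriv K j x + faceCutoff K (K.erase j) x • fderiv ℝ φ x‖
        ≤ (α' + α * (n * B + B)) * wt K x := by
      refine (norm_add_le _ _).trans ?_
      rw [norm_smul, norm_smul, Real.norm_of_nonneg hc.1]
      calc ‖φ x‖ * ‖cutoffDeriv K j x‖ + faceCutoff K (K.erase j) x * ‖fderiv ℝ φ x‖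
          ≤ α * ((n * B + B) * wt K x) + 1 * α' := by
            gcongr
            · exact hα x hx'
            · exact hsK.norm_cutoffDeriv_le hx hj hB
            · exact hc.2
            · exact hα' x hx'
        _ ≤ α * ((n * B + B) * wt K x) + α' * wt K x := by
            rw [one_mul]
            gcongr
            exact le_mul_of_one_le_right hα'0 hw
        _ = _ := by ring
    calc _ ≤ (α' + α * (n * B + B)) * wt K x * ‖u x‖ :=
          mul_le_mul_of_nonneg_right this (norm_nonneg _)
      _ = _ := by ring

end FluxData

/-! ### Concentration near a facet, and normal components of bounded fields. -/

theorem contDiff_bary (K : Finset (Euc n)) (v : Euc n) : ContDiff ℝ 1 (bary K v) := by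
  have h : bary K v = fun x => bary K v 0 + baryGrad K v x := by
    funext y
    rw [bary_eq_add K v y 0, sub_zero]
  rw [h]
  exact contDiff_const.add (baryGrad K v).contDiff

namespace FluxData

variable {Ω : Set (Euc n)} {T : Triangulation Ω} {u : Euc n → Euc n} {d : Euc n → ℝ}
  {K : Finset (Euc n)} {φ : Euc n → ℝ}

/-- The factor `(1 - λ_j) ^ (m + 1)` equals `1` on the facet, and the cutoff vanishes on the other
facets, so the difference has zero trace on `∂K`. Large `m` pushes the integral towards the facet.
-/
theorem faceFlux_eq_faceFlux_mul_pow (hF : FluxData T u d) (hK : K ∈ T.cells) {j : Euc n}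
    (hj : j ∈ K) (hφ : ContDiff ℝ 1 φ) (m : ℕ) :
    faceFlux u d K (K.erase j) φ
      = faceFlux u d K (K.erase j) fun x => φ x * (1 - bary K j x) ^ (m + 1) := by
  have hsK := Triangulation.isSimplex hK
  have hη : ContDiff ℝ 1 fun x => (1 - bary K j x) ^ (m + 1) :=
    (contDiff_const.sub (contDiff_bary K j)).pow _
  have hcl := (hsK.cutoffLimit_faceCutoff hj).mul hsK
    (contDiff_const.sub hη : ContDiff ℝ 1 fun x => 1 - (1 - bary K j x) ^ (m + 1))
  have h := normalPairing_eq_zero_of_cutoffLimit hF.bdd hF.h0div hF.integrable_wt hφ hK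
    (W := fun k x => (1 - (1 - T.hat j x) ^ (m + 1)) * (hatProd T (K.erase j) x /
      (hatProd T (K.erase j) x + (T.hat j x + regSeq k))))
    (c := fun x => (1 - (1 - bary K j x) ^ (m + 1)) * faceCutoff K (K.erase j) x)
    (fun k => ?_) ?_ (fun k x hx hv => ?_)
  · have e : (fun x => φ x * faceCutoff K (K.erase j) x) = fun x =>
        φ x * ((1 - (1 - bary K j x) ^ (m + 1)) * faceCutoff K (K.erase j) x)
          + φ x * (1 - bary K j x) ^ (m + 1) * faceCutoff K (K.erase j) x := by
      funext x; ring
    unfold faceFlux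
    rw [e, hF.normalPairing_add hK (hcl.admissible.mul hsK hφ)
      (admissible_mul_faceCutoff hK hj (hφ.mul hη)), h, zero_add]
  · refine ((BddLip.const 1).sub (((BddLip.const 1).sub (BddLip.hat T j)).pow _)).mul ?_
    refine (BddLip.hatProd T _).div ((BddLip.hatProd T _).add ((BddLip.hat T j).add
      (BddLip.const _))) (regSeq_pos k) fun x hx => ?_
    have h1 := hatProd_nonneg (T := T) hx (K.erase j)
    have h2 := Triangulation.hat_nonneg (T := T) hx j
    linarith
  · refine hcl.congr (fun x hx k => ?_) fun x _ => rfl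
    have hx' := interior_subset hx
    simp only [hatProd_erase hK hx', Triangulation.hat_eq hK hx']
  · obtain ⟨v, hv, h0⟩ := hv
    by_cases hvj : v = j
    · rw [← hvj, h0]; simp
    · rw [hatProd_erase_eq_zero hv hvj h0]; simp

/-- If `u` is bounded, then so is its normal component on a facet. -/
theorem abs_faceFlux_le_of_bounded (hF : FluxData T u d) (hn : 1 ≤ n) (hK : K ∈ T.cells)
    {j : Euc n} (hj : j ∈ K) (hφ : ContDiff ℝ 1 φ) {α B M : ℝ}
    (hα : ∀ x ∈ convexHull ℝ (K : Set (Euc n)), |φ x| ≤ α)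
    (hB : ∀ v, ‖baryGrad K v‖ ≤ B) (hM : ∀ᵐ x ∂(volume.restrict Ω), ‖u x‖ ≤ M) :
    |faceFlux u d K (K.erase j) φ|
      ≤ α * B * M * (cornerConst n * (volume (convexHull ℝ (K : Set (Euc n)))).toReal) := by
  have hsK := Triangulation.isSimplex hK
  obtain ⟨α', hα'⟩ := (isCompact_simplex K).exists_bound_of_continuousOn
    (hφ.continuous_fderiv one_ne_zero).continuousOn
  have hMK := Triangulation.ae_simplex_of_ae hK hM
  have hB0 : 0 ≤ B := (norm_nonneg _).trans (hB 0)
  obtain ⟨x₀, hx₀⟩ := hsK.interior_nonempty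
  have hα0 : 0 ≤ α := (abs_nonneg _).trans (hα x₀ (interior_subset hx₀))
  have hα'0 : 0 ≤ α' := (norm_nonneg _).trans (hα' x₀ (interior_subset hx₀))
  set G : Euc n → ℝ := fun x => α * |d x| + (α' + α * (n * B + B)) * (‖u x‖ * wt K x) with hG
  have hGi : IntegrableOn G (convexHull ℝ (K : Set (Euc n))) :=
    ((hF.integrableOn_div hK).abs.const_mul _).add ((hF.integrable_wt K hK).const_mul _)
  have hpc : ∀ m : ℕ, Continuous fun x => (1 - bary K j x) ^ m := fun m =>
    (continuous_const.sub (continuous_bary K j)).pow m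
  have hpb : ∀ m : ℕ, ∀ x ∈ convexHull ℝ (K : Set (Euc n)), 0 ≤ (1 - bary K j x) ^ m ∧
      (1 - bary K j x) ^ m ≤ 1 := fun m x hx => by
    have h1 := hsK.bary_nonneg hx j
    have h2 := hsK.bary_le_one hx j
    exact ⟨pow_nonneg (by linarith) _, pow_le_one₀ (by linarith) (by linarith)⟩
  have hGm : ∀ m : ℕ, IntegrableOn (fun x => G x * (1 - bary K j x) ^ (m + 1))
      (convexHull ℝ (K : Set (Euc n))) := fun m => by
    refine hGi.norm.mono' (hGi.aestronglyMeasurable.mul (hpc _).aestronglyMeasurable) ?_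
    filter_upwards [ae_restrict_mem (isCompact_simplex K).measurableSet] with x hx
    rw [norm_mul, Real.norm_of_nonneg (hpb _ x hx).1]
    exact mul_le_of_le_one_right (norm_nonneg _) (hpb _ x hx).2
  have hPm : ∀ m : ℕ, IntegrableOn (fun x => ((m : ℝ) + 1) * (1 - bary K j x) ^ m)
      (convexHull ℝ (K : Set (Euc n))) := fun m =>
    (continuous_const.mul (hpc m)).continuousOn.integrableOn_compact (isCompact_simplex K)
  -- Only the derivative of the power produces the factor `(m + 1) (1 - λ_j) ^ m`, whose integral is
  -- bounded uniformly in `m`. All other terms, including those with `d` and `wt`, retain `(1 - λ_j)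
  -- ^ (m + 1)` and disappear as `m → ∞`.
  have key : ∀ m : ℕ, |faceFlux u d K (K.erase j) φ|
      ≤ (∫ x in convexHull ℝ (K : Set (Euc n)), G x * (1 - bary K j x) ^ (m + 1)) +
        α * B * M * (cornerConst n * (volume (convexHull ℝ (K : Set (Euc n)))).toReal) := by
    intro m
    have hM0 : 0 ≤ α * B * M := by
      -- The cell has positive measure, so `‖u x‖ ≤ M` holds at some point and `M ≥ 0`.
      have hne : volume.restrict (convexHull ℝ (K : Set (Euc n))) ≠ 0 := by
        rw [Ne, Measure.restrict_eq_zero]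
        exact fun h => (isOpen_interior.measure_pos volume ⟨x₀, hx₀⟩).ne'
          (measure_mono_null interior_subset h)
      have := ae_neBot.2 hne
      obtain ⟨x, hx⟩ := hMK.exists
      exact mul_nonneg (mul_nonneg hα0 hB0) ((norm_nonneg _).trans hx)
    have hle : |faceFlux u d K (K.erase j) φ| ≤ ∫ x in convexHull ℝ (K : Set (Euc n)),
        (G x * (1 - bary K j x) ^ (m + 1) +
          α * B * M * (((m : ℝ) + 1) * (1 - bary K j x) ^ m)) := by
      rw [hF.faceFlux_eq_faceFlux_mul_pow hK hj hφ m, ← Real.norm_eq_abs]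
      refine norm_integral_le_of_norm_le ((hGm m).add ((hPm m).const_mul _)) ?_
      filter_upwards [ae_mem_interior_simplex K, hMK] with x hx hux
      have hx' := interior_subset hx
      set η := 1 - bary K j x with hη
      have hp1 := hpb (m + 1) x hx'
      have hp0 := hpb m x hx'
      rw [← hη] at hp1 hp0
      have hdη : HasFDerivAt (fun x => (1 - bary K j x) ^ (m + 1))
          ((((m : ℝ) + 1) * η ^ m) • (-baryGrad K j)) x := by
        have := (((bary_hasStrictFDerivAt K j x).hasFDerivAt.const_sub 1).pow (m + 1))
        refine this.congr_fderiv ?_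
        rw [hη]
        simp
      have hd : HasFDerivAt (fun x => φ x * (1 - bary K j x) ^ (m + 1) *
          faceCutoff K (K.erase j) x)
          ((φ x * η ^ (m + 1)) • cutoffDeriv K j x + faceCutoff K (K.erase j) x •
            (φ x • ((((m : ℝ) + 1) * η ^ m) • (-baryGrad K j)) + η ^ (m + 1) • fderiv ℝ φ x)) x :=
        ((hφ.differentiable one_ne_zero x).hasFDerivAt.mul hdη).mul
          (hsK.hasStrictFDerivAt_faceCutoff hx hj).hasFDerivAt
      rw [hd.fderiv]
      have hc := hsK.faceCutoff_mem_Icc hx' hj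
      have hw := hsK.one_le_wt hx
      have hφx : ‖φ x‖ ≤ α := hα x hx'
      have hn1 : ‖(φ x * η ^ (m + 1)) • cutoffDeriv K j x‖
          ≤ α * η ^ (m + 1) * ((n * B + B) * wt K x) := by
        rw [norm_smul, norm_mul, Real.norm_of_nonneg hp1.1]
        have := hsK.norm_cutoffDeriv_le hx hj hB
        exact mul_le_mul (mul_le_mul_of_nonneg_right hφx hp1.1) this (norm_nonneg _)
          (mul_nonneg hα0 hp1.1)
      have hpm : 0 ≤ ((m : ℝ) + 1) * η ^ m := mul_nonneg (by positivity) hp0.1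
      have hn2 : ‖φ x • ((((m : ℝ) + 1) * η ^ m) • (-baryGrad K j))‖
          ≤ α * (((m : ℝ) + 1) * η ^ m) * B := by
        rw [norm_smul, norm_smul, norm_neg, Real.norm_of_nonneg hpm, mul_assoc α]
        exact mul_le_mul hφx (mul_le_mul_of_nonneg_left (hB j) hpm)
          (mul_nonneg hpm (norm_nonneg _)) hα0
      have hn3 : ‖η ^ (m + 1) • fderiv ℝ φ x‖ ≤ η ^ (m + 1) * (α' * wt K x) := by
        rw [norm_smul, Real.norm_of_nonneg hp1.1]
        refine mul_le_mul_of_nonneg_left ((hα' x hx').trans ?_) hp1.1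
        exact le_mul_of_one_le_right hα'0 hw
      have hn4 : ‖(φ x * η ^ (m + 1)) • cutoffDeriv K j x + faceCutoff K (K.erase j) x •
            (φ x • ((((m : ℝ) + 1) * η ^ m) • (-baryGrad K j)) + η ^ (m + 1) • fderiv ℝ φ x)‖
          ≤ (α' + α * (n * B + B)) * wt K x * η ^ (m + 1) +
            α * B * (((m : ℝ) + 1) * η ^ m) := by
        refine (norm_add_le _ _).trans ?_
        have h5 : ‖faceCutoff K (K.erase j) x •
            (φ x • ((((m : ℝ) + 1) * η ^ m) • (-baryGrad K j)) + η ^ (m + 1) • fderiv ℝ φ x)‖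
            ≤ α * (((m : ℝ) + 1) * η ^ m) * B + η ^ (m + 1) * (α' * wt K x) := by
          rw [norm_smul, Real.norm_of_nonneg hc.1]
          exact (mul_le_of_le_one_left (norm_nonneg _) hc.2).trans
            ((norm_add_le _ _).trans (add_le_add hn2 hn3))
        calc _ ≤ α * η ^ (m + 1) * ((n * B + B) * wt K x) +
              (α * (((m : ℝ) + 1) * η ^ m) * B + η ^ (m + 1) * (α' * wt K x)) :=
              add_le_add hn1 h5
          _ = _ := by ring
      have hn5 : ‖d x * (φ x * η ^ (m + 1) * faceCutoff K (K.erase j) x)‖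
          ≤ α * |d x| * η ^ (m + 1) := by
        rw [norm_mul, norm_mul, norm_mul, Real.norm_of_nonneg hc.1, Real.norm_of_nonneg hp1.1,
          Real.norm_eq_abs (d x)]
        calc |d x| * (‖φ x‖ * η ^ (m + 1) * faceCutoff K (K.erase j) x)
            ≤ |d x| * (α * η ^ (m + 1) * 1) :=
              mul_le_mul_of_nonneg_left (mul_le_mul (mul_le_mul_of_nonneg_right hφx hp1.1) hc.2
                hc.1 (mul_nonneg hα0 hp1.1)) (abs_nonneg _)
          _ = _ := by ring
      refine (norm_add_le _ _).trans ((add_le_add hn5 ((ContinuousLinearMap.le_opNorm _ _).trans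
        (mul_le_mul_of_nonneg_right hn4 (norm_nonneg _)))).trans ?_)
      have h6 : α * B * (((m : ℝ) + 1) * η ^ m) * ‖u x‖ ≤ α * B * (((m : ℝ) + 1) * η ^ m) * M :=
        mul_le_mul_of_nonneg_left hux (by
          have := hp0.1
          positivity)
      simp only [hG]
      linarith
    refine hle.trans ?_
    rw [integral_add (hGm m) ((hPm m).const_mul _), integral_const_mul]
    gcongr
    exact hsK.integral_pow_bary_le hn hj m
  have hlim : Tendsto (fun m : ℕ => ∫ x in convexHull ℝ (K : Set (Euc n)),
      G x * (1 - bary K j x) ^ (m + 1)) atTop (𝓝 0) := by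
    have h0 : (0 : ℝ) = ∫ x in convexHull ℝ (K : Set (Euc n)), (0 : ℝ) := by simp
    rw [h0]
    refine tendsto_integral_of_dominated_convergence (fun x => ‖G x‖)
      (fun m => (hGm m).aestronglyMeasurable) hGi.norm (fun m => ?_) ?_
    · filter_upwards [ae_restrict_mem (isCompact_simplex K).measurableSet] with x hx
      rw [norm_mul, Real.norm_of_nonneg (hpb _ x hx).1]
      exact mul_le_of_le_one_right (norm_nonneg _) (hpb _ x hx).2
    · filter_upwards [ae_mem_interior_simplex K] with x hx
      have h1 := hsK.mem_interior_iff.1 hx j hj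
      have h2 := hsK.bary_le_one (interior_subset hx) j
      have h3 := (tendsto_pow_atTop_nhds_zero_of_lt_one (r := 1 - bary K j x) (by linarith)
        (by linarith)).comp (tendsto_add_atTop_nat 1)
      simpa using h3.const_mul (G x)
  have := ge_of_tendsto' (hlim.add_const
    (α * B * M * (cornerConst n * (volume (convexHull ℝ (K : Set (Euc n)))).toReal))) key
  simpa using this

end FluxData

/-! ### Polynomials -/

theorem polyFun_add (P Q : MvPolynomial (Fin n) ℝ) (x : Euc n) :
    polyFun (P + Q) x = polyFun P x + polyFun Q x := by simp [polyFun]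

theorem polyFun_smul (a : ℝ) (P : MvPolynomial (Fin n) ℝ) (x : Euc n) :
    polyFun (a • P) x = a * polyFun P x := by simp [polyFun]

theorem polyFun_sum {ι : Type*} (s : Finset ι) (P : ι → MvPolynomial (Fin n) ℝ) (x : Euc n) :
    polyFun (∑ i ∈ s, P i) x = ∑ i ∈ s, polyFun (P i) x := by simp [polyFun]

theorem polyFun_C (a : ℝ) (x : Euc n) : polyFun (MvPolynomial.C a) x = a := by simp [polyFun]

theorem contDiff_polyFun (P : MvPolynomial (Fin n) ℝ) {k : WithTop ℕ∞} :
    ContDiff ℝ k (polyFun P) := by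
  induction P using MvPolynomial.induction_on with
  | C a =>
    have : polyFun (MvPolynomial.C a : MvPolynomial (Fin n) ℝ) = fun _ => a :=
      funext fun x => polyFun_C a x
    rw [this]; exact contDiff_const
  | add P Q hP hQ =>
    have : polyFun (P + Q) = fun x => polyFun P x + polyFun Q x :=
      funext fun x => polyFun_add P Q x
    rw [this]; exact hP.add hQ
  | mul_X P i hP =>
    have : polyFun (P * MvPolynomial.X i) = fun x => polyFun P x * x i := by
      funext x; simp [polyFun]
    rw [this]
    exact hP.mul (EuclideanSpace.proj (𝕜 := ℝ) i : Euc n →L[ℝ] ℝ).contDiff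

/-- An open set contains a product of intervals, and polynomials that agree on a product of infinite
sets are equal. -/
theorem poly_eq_of_eqOn {P Q : MvPolynomial (Fin n) ℝ} {U : Set (Euc n)} (hU : IsOpen U)
    (hne : U.Nonempty) (h : Set.EqOn (polyFun P) (polyFun Q) U) : P = Q := by
  obtain ⟨x₀, hx₀⟩ := hne
  have hc : Continuous fun t : Fin n → ℝ => (WithLp.toLp 2 t : Euc n) :=
    PiLp.continuous_toLp 2 _
  have hV := hU.preimage hc
  obtain ⟨ε, hε, hball⟩ := Metric.isOpen_iff.1 hV (WithLp.ofLp x₀) hx₀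
  refine MvPolynomial.funext_set (fun i => Metric.ball (x₀ i) ε) (fun i => ?_) fun t ht => ?_
  · rw [Real.ball_eq_Ioo]
    exact Set.Ioo_infinite (by linarith)
  · have h1 : t ∈ Metric.ball (WithLp.ofLp x₀) ε := by
      rw [ball_pi _ hε]; exact ht
    exact h (hball h1)

theorem poly_eq_of_ae_eq {P Q : MvPolynomial (Fin n) ℝ} {U : Set (Euc n)} (hU : IsOpen U)
    (hne : U.Nonempty) (h : ∀ᵐ x ∂(volume.restrict U), polyFun P x = polyFun Q x) : P = Q :=
  poly_eq_of_eqOn hU hne (Measure.eqOn_open_of_ae_eq h hU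
    (contDiff_polyFun (k := 0) P).continuous.continuousOn
    (contDiff_polyFun (k := 0) Q).continuous.continuousOn)

/-- The polynomial `P (x₀ + h y)` in `y`. -/
def affineSubst (x₀ : Euc n) (h : ℝ) (P : MvPolynomial (Fin n) ℝ) : MvPolynomial (Fin n) ℝ :=
  MvPolynomial.bind₁ (fun i => MvPolynomial.C (x₀ i) + MvPolynomial.C h * MvPolynomial.X i) P

theorem polyFun_affineSubst (x₀ : Euc n) (h : ℝ) (P : MvPolynomial (Fin n) ℝ) (y : Euc n) :
    polyFun (affineSubst x₀ h P) y = polyFun P (x₀ + h • y) := by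
  unfold polyFun affineSubst
  induction P using MvPolynomial.induction_on with
  | C a => simp
  | add P Q hP hQ => simp only [map_add, hP, hQ]
  | mul_X P i hP => simp only [map_mul, hP]; simp

theorem totalDegree_affineSubst_le (x₀ : Euc n) (h : ℝ) (P : MvPolynomial (Fin n) ℝ) :
    (affineSubst x₀ h P).totalDegree ≤ P.totalDegree := by
  unfold affineSubst
  conv_lhs => rw [P.as_sum]
  rw [map_sum]
  refine MvPolynomial.totalDegree_finsetSum_le fun s hs => ?_
  rw [MvPolynomial.bind₁_monomial]
  refine (MvPolynomial.totalDegree_mul _ _).trans ?_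
  rw [MvPolynomial.totalDegree_C, zero_add]
  refine (MvPolynomial.totalDegree_finsetProd _ _).trans ?_
  refine le_trans ?_ (MvPolynomial.le_totalDegree hs)
  refine Finset.sum_le_sum fun i _ => ?_
  refine (MvPolynomial.totalDegree_pow _ _).trans ?_
  refine (Nat.mul_le_mul_left _ ?_).trans (mul_one _).le
  refine (MvPolynomial.totalDegree_add _ _).trans (max_le ?_ ?_)
  · rw [MvPolynomial.totalDegree_C]; exact Nat.zero_le _
  · refine (MvPolynomial.totalDegree_mul _ _).trans ?_
    rw [MvPolynomial.totalDegree_C, zero_add, MvPolynomial.totalDegree_X]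

/-- Equivalence of norms on polynomials of degree at most `r`: the coordinate map into `L²` of the
small ball is injective, hence bounded below. The radius `3` of the large ball will cover, after
scaling, the cells that share a vertex with a given one. -/
theorem exists_poly_bound (n r : ℕ) {c : ℝ} (hc : 0 < c) : ∃ C : ℝ, 0 ≤ C ∧
    ∀ P : MvPolynomial (Fin n) ℝ, P.totalDegree ≤ r → ∀ y ∈ Metric.closedBall (0 : Euc n) 3,
      |polyFun P y| ≤ C * Real.sqrt (∫ z in Metric.closedBall (0 : Euc n) c, polyFun P z ^ 2) ∧
      ‖fderiv ℝ (polyFun P) y‖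
        ≤ C * Real.sqrt (∫ z in Metric.closedBall (0 : Euc n) c, polyFun P z ^ 2) := by
  let V := MvPolynomial.restrictTotalDegree (Fin n) ℝ r
  let m := Module.finrank ℝ V
  let b := Module.finBasis ℝ V
  let μ : Measure (Euc n) := volume.restrict (Metric.closedBall (0 : Euc n) c)
  have hmem : ∀ P : MvPolynomial (Fin n) ℝ, MemLp (polyFun P) 2 μ := fun P => by
    have hfin : IsFiniteMeasure μ :=
      ⟨by rw [Measure.restrict_apply_univ]; exact (isCompact_closedBall _ _).measure_lt_top⟩
    obtain ⟨M, hM⟩ := (isCompact_closedBall (0 : Euc n) c).exists_bound_of_continuousOn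
      (contDiff_polyFun (k := 0) P).continuous.continuousOn
    refine MemLp.of_bound (contDiff_polyFun (k := 0) P).continuous.aestronglyMeasurable M ?_
    filter_upwards [ae_restrict_mem Metric.isClosed_closedBall.measurableSet] with x hx using hM x hx
  let Φ : MvPolynomial (Fin n) ℝ →ₗ[ℝ] Lp ℝ 2 μ :=
    { toFun := fun P => (hmem P).toLp
      map_add' := fun P Q => by
        rw [← MemLp.toLp_add]
        congr 1
        funext x; exact polyFun_add P Q x
      map_smul' := fun a P => by
        rw [RingHom.id_apply, ← MemLp.toLp_const_smul]
        congr 1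
        funext x; exact polyFun_smul a P x }
  let L : (Fin m → ℝ) →ₗ[ℝ] Lp ℝ 2 μ := Φ ∘ₗ V.subtype ∘ₗ b.equivFun.symm.toLinearMap
  have hker : LinearMap.ker L = ⊥ := by
    rw [LinearMap.ker_eq_bot']
    intro w hw
    have h1 : Φ (b.equivFun.symm w : V) = 0 := hw
    have h2 : polyFun ((b.equivFun.symm w : V) : MvPolynomial (Fin n) ℝ) =ᵐ[μ] 0 := by
      have := (hmem ((b.equivFun.symm w : V) : MvPolynomial (Fin n) ℝ)).coeFn_toLp
      refine this.symm.trans ?_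
      change (Φ (b.equivFun.symm w : V) : Euc n → ℝ) =ᵐ[μ] 0
      rw [h1]
      exact Lp.coeFn_zero _ _ _
    have h3 : ((b.equivFun.symm w : V) : MvPolynomial (Fin n) ℝ) = 0 := by
      refine poly_eq_of_ae_eq Metric.isOpen_ball ⟨0, Metric.mem_ball_self hc⟩ ?_
      have := ae_mono (Measure.restrict_mono (μ := volume)
        (Metric.ball_subset_closedBall (x := (0 : Euc n)) (ε := c)) le_rfl) h2
      filter_upwards [this] with x hx
      rw [hx]; simp [polyFun]
    have h4 : b.equivFun.symm w = 0 := Subtype.ext h3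
    exact (LinearEquiv.map_eq_zero_iff _).1 h4
  obtain ⟨K₀, hK₀, hanti⟩ := L.exists_antilipschitzWith hker
  have hnorm : ∀ P : MvPolynomial (Fin n) ℝ, ‖Φ P‖ = Real.sqrt (∫ z, polyFun P z ^ 2 ∂μ) := by
    intro P
    rw [norm_eq_sqrt_real_inner, L2.inner_def]
    congr 1
    refine integral_congr_ae ?_
    filter_upwards [(hmem P).coeFn_toLp] with x hx
    change inner ℝ (((hmem P).toLp (polyFun P) : Lp ℝ 2 μ) x)
      (((hmem P).toLp (polyFun P) : Lp ℝ 2 μ) x) = _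
    rw [hx, real_inner_self_eq_norm_sq, Real.norm_eq_abs, sq_abs]
  have hbd : ∀ i, ∃ M, ∀ y ∈ Metric.closedBall (0 : Euc n) 3,
      |polyFun (b i : MvPolynomial (Fin n) ℝ) y| ≤ M ∧
      ‖fderiv ℝ (polyFun (b i : MvPolynomial (Fin n) ℝ)) y‖ ≤ M := by
    intro i
    obtain ⟨M, hM⟩ := (isCompact_closedBall (0 : Euc n) 3).exists_bound_of_continuousOn
      (contDiff_polyFun (k := 1) (b i : MvPolynomial (Fin n) ℝ)).continuous.continuousOn
    obtain ⟨M', hM'⟩ := (isCompact_closedBall (0 : Euc n) 3).exists_bound_of_continuousOn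
      ((contDiff_polyFun (k := 1) (b i : MvPolynomial (Fin n) ℝ)).continuous_fderiv
        one_ne_zero).continuousOn
    exact ⟨max M M', fun y hy => ⟨(hM y hy).trans (le_max_left _ _),
      (hM' y hy).trans (le_max_right _ _)⟩⟩
  choose M hM using hbd
  have hM0 : ∀ i, 0 ≤ M i := fun i =>
    (abs_nonneg _).trans (hM i 0 (Metric.mem_closedBall_self (by norm_num))).1
  refine ⟨(∑ i, M i) * K₀, mul_nonneg (Finset.sum_nonneg fun i _ => hM0 i) K₀.coe_nonneg,
    fun P hP y hy => ?_⟩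
  let v : V := ⟨P, (MvPolynomial.mem_restrictTotalDegree _ _ _).2 hP⟩
  let w := b.equivFun v
  have hLw : L w = Φ P := by
    change Φ (b.equivFun.symm (b.equivFun v) : V) = Φ P
    rw [LinearEquiv.symm_apply_apply]
  have hw : ‖w‖ ≤ K₀ * Real.sqrt (∫ z, polyFun P z ^ 2 ∂μ) := by
    have := hanti.le_mul_dist w 0
    rwa [map_zero, dist_zero_right, dist_zero_right, hLw, hnorm] at this
  have hP' : P = ∑ i, w i • (b i : MvPolynomial (Fin n) ℝ) := by
    have h := congrArg V.subtype (b.sum_equivFun v)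
    rw [map_sum] at h
    exact h.symm
  have hfun : polyFun P = fun x => ∑ i, w i * polyFun (b i : MvPolynomial (Fin n) ℝ) x := by
    funext x
    conv_lhs => rw [hP']
    rw [polyFun_sum]
    exact Finset.sum_congr rfl fun i _ => polyFun_smul _ _ _
  have hfin : ∑ i, ‖w‖ * M i ≤ (∑ i, M i) * K₀ * Real.sqrt (∫ z, polyFun P z ^ 2 ∂μ) := by
    rw [← Finset.mul_sum, mul_comm, mul_assoc]
    exact mul_le_mul_of_nonneg_left hw (Finset.sum_nonneg fun i _ => hM0 i)
  refine ⟨le_trans ?_ hfin, le_trans ?_ hfin⟩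
  · rw [hfun, ← Real.norm_eq_abs]
    refine norm_sum_le_of_le _ fun i _ => ?_
    rw [norm_mul]
    exact mul_le_mul (norm_le_pi_norm w i) (hM i y hy).1 (norm_nonneg _) (norm_nonneg _)
  · have hd : fderiv ℝ (polyFun P) y
        = ∑ i, w i • fderiv ℝ (polyFun (b i : MvPolynomial (Fin n) ℝ)) y := by
      rw [hfun]
      exact (HasFDerivAt.fun_sum fun i _ =>
        (((contDiff_polyFun (k := 1) (b i : MvPolynomial (Fin n) ℝ)).differentiable
          one_ne_zero) y).hasFDerivAt.const_mul (w i)).fderiv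
    rw [hd]
    refine norm_sum_le_of_le _ fun i _ => ?_
    rw [norm_smul]
    exact mul_le_mul (norm_le_pi_norm w i) (hM i y hy).2 (norm_nonneg _) (norm_nonneg _)

/-- The scaled `L²` norm `(h⁻ⁿ ∫_s f²)^{1/2}`. -/
def scaledNorm (h : ℝ) (s : Set (Euc n)) (f : Euc n → ℝ) : ℝ :=
  Real.sqrt ((h ^ n)⁻¹ * ∫ x in s, f x ^ 2)

theorem scaledNorm_nonneg (h : ℝ) (s : Set (Euc n)) (f : Euc n → ℝ) : 0 ≤ scaledNorm h s f :=
  Real.sqrt_nonneg _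

theorem scaledNorm_sq {h : ℝ} (hh : 0 < h) (s : Set (Euc n)) (f : Euc n → ℝ) :
    h ^ n * scaledNorm h s f ^ 2 = ∫ x in s, f x ^ 2 := by
  unfold scaledNorm
  rw [Real.sq_sqrt (mul_nonneg (by positivity) (integral_nonneg fun x => sq_nonneg _)),
    mul_inv_cancel_left₀ (by positivity)]

/-- Inverse estimates for polynomials. -/
theorem exists_inverse_estimate (n r : ℕ) {c : ℝ} (hc : 0 < c) : ∃ C : ℝ, 0 ≤ C ∧
    ∀ P : MvPolynomial (Fin n) ℝ, P.totalDegree ≤ r → ∀ (h : ℝ) (x₀ : Euc n) (s : Set (Euc n)),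
      0 < h → IsCompact s → Metric.closedBall x₀ (c * h) ⊆ s →
      ∀ x ∈ Metric.closedBall x₀ (3 * h), |polyFun P x| ≤ C * scaledNorm h s (polyFun P) ∧
        ‖fderiv ℝ (polyFun P) x‖ ≤ C * h⁻¹ * scaledNorm h s (polyFun P) := by
  obtain ⟨C, hC, hbd⟩ := exists_poly_bound n r hc
  refine ⟨C, hC, fun P hP h x₀ s hh hs hsub x hx => ?_⟩
  let Q := affineSubst x₀ h P
  have hQ := hbd Q ((totalDegree_affineSubst_le x₀ h P).trans hP)
  let y := h⁻¹ • (x - x₀)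
  have hy : y ∈ Metric.closedBall (0 : Euc n) 3 := by
    rw [mem_closedBall_zero_iff, norm_smul, Real.norm_of_nonneg (inv_nonneg.2 hh.le),
      inv_mul_le_iff₀ hh, mul_comm]
    exact mem_closedBall_iff_norm.1 hx
  have hxy : x₀ + h • y = x := by
    simp only [y]
    rw [smul_smul, mul_inv_cancel₀ hh.ne', one_smul, add_sub_cancel]
  have hint : Real.sqrt (∫ z in Metric.closedBall (0 : Euc n) c, polyFun Q z ^ 2)
      ≤ scaledNorm h s (polyFun P) := by
    refine Real.sqrt_le_sqrt ?_
    -- The change of variables `x = x₀ + h z` produces the factor `h⁻ⁿ` of `scaledNorm`.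
    have h1 : ∫ z in Metric.closedBall (0 : Euc n) c, polyFun Q z ^ 2
        = (h ^ n)⁻¹ * ∫ x in Metric.closedBall x₀ (c * h), polyFun P x ^ 2 := by
      simp_rw [Q, polyFun_affineSubst]
      have h2 := Measure.setIntegral_comp_smul_of_pos (volume : Measure (Euc n))
        (fun z => polyFun P (x₀ + z) ^ 2) (Metric.closedBall (0 : Euc n) c) hh
      rw [h2, finrank_euclideanSpace, Fintype.card_fin, smul_eq_mul, smul_closedBall _ _ hc.le,
        smul_zero, Real.norm_of_nonneg hh.le]
      congr 1
      have h3 := (measurePreserving_add_left (volume : Measure (Euc n)) x₀).setIntegral_preimage_emb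
        (MeasurableEquiv.addLeft x₀).measurableEmbedding (fun z => polyFun P z ^ 2)
        (Metric.closedBall x₀ (c * h))
      rw [← h3]
      congr 2
      ext z
      simp [mul_comm]
    rw [h1]
    refine mul_le_mul_of_nonneg_left ?_ (by positivity)
    refine setIntegral_mono_set ?_ (Eventually.of_forall fun x => sq_nonneg _)
      (Eventually.of_forall hsub)
    exact ((contDiff_polyFun (k := 0) P).continuous.pow 2).continuousOn.integrableOn_compact hs
  refine ⟨?_, ?_⟩
  · have := (hQ y hy).1
    rw [polyFun_affineSubst, hxy] at this
    exact this.trans (mul_le_mul_of_nonneg_left hint hC)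
  · have h1 := (hQ y hy).2
    have h2 : fderiv ℝ (polyFun Q) y = h • fderiv ℝ (polyFun P) x := by
      have hd1 : HasFDerivAt (fun z : Euc n => x₀ + h • z)
          (h • ContinuousLinearMap.id ℝ (Euc n)) y :=
        ((ContinuousLinearMap.id ℝ (Euc n)).hasFDerivAt.const_smul h).const_add x₀
      have hd2 : HasFDerivAt (polyFun P) (fderiv ℝ (polyFun P) x) (x₀ + h • y) := by
        rw [hxy]
        exact ((contDiff_polyFun (k := 1) P).differentiable one_ne_zero x).hasFDerivAt
      have hfun : polyFun Q = polyFun P ∘ fun z : Euc n => x₀ + h • z :=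
        funext fun z => polyFun_affineSubst x₀ h P z
      rw [hfun, (hd2.comp y hd1).fderiv]
      ext z
      simp
    rw [h2, norm_smul, Real.norm_of_nonneg hh.le] at h1
    rw [mul_comm C, mul_assoc, ← div_eq_inv_mul, le_div_iff₀ hh, mul_comm]
    exact h1.trans (mul_le_mul_of_nonneg_left hint hC)

/-! ### The finite element space -/

section FiniteElement

variable {Ω : Set (Euc n)} {T : Triangulation Ω} {r : ℕ} {K : Finset (Euc n)}

theorem EqPolyOn.ae_simplex (hK : K ∈ T.cells) {f : Euc n → ℝ} {P : MvPolynomial (Fin n) ℝ}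
    (h : EqPolyOn Ω f K P) :
    ∀ᵐ x ∂(volume.restrict (convexHull ℝ (K : Set (Euc n)))), f x = polyFun P x := by
  filter_upwards [Triangulation.ae_simplex_of_ae hK h,
    ae_restrict_mem (isCompact_simplex K).measurableSet] with x hx hxK using hx hxK

/-- The interior of a cell is open and nonempty. Uniqueness makes the choice in `localPoly` linear
in the function. -/
theorem EqPolyOn.unique (hK : K ∈ T.cells) {f : Euc n → ℝ} {P Q : MvPolynomial (Fin n) ℝ}
    (hP : EqPolyOn Ω f K P) (hQ : EqPolyOn Ω f K Q) : P = Q := by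
  refine poly_eq_of_ae_eq isOpen_interior (Triangulation.isSimplex hK).interior_nonempty ?_
  rw [Measure.restrict_congr_set (interior_ae_eq_simplex K)]
  filter_upwards [hP.ae_simplex hK, hQ.ae_simplex hK] with x h1 h2 using h1.symm.trans h2

theorem EqPolyOn.localPoly_eq (hK : K ∈ T.cells) {f : Euc n → ℝ} {P : MvPolynomial (Fin n) ℝ}
    (hP : EqPolyOn Ω f K P) : localPoly Ω f K = P := by
  have h : ∃ P, EqPolyOn Ω f K P := ⟨P, hP⟩
  unfold localPoly
  rw [dif_pos h]
  exact h.choose_spec.unique hK hP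

theorem eqPolyOn_of_ae {f : Euc n → ℝ} {P : MvPolynomial (Fin n) ℝ}
    (h : ∀ᵐ x ∂(volume.restrict (convexHull ℝ (K : Set (Euc n)))), f x = polyFun P x) :
    EqPolyOn Ω f K P := by
  rw [ae_restrict_iff' (isCompact_simplex K).measurableSet] at h
  exact ae_restrict_of_ae h

/-- The restriction of `f ∈ V_h^r` to `K`, as a polynomial function. -/
abbrev loc (f : Vh T r) (K : Finset (Euc n)) : Euc n → ℝ :=
  localFun Ω (f : Lp ℝ 2 (volume.restrict Ω)) K

theorem eqPolyOn_localPoly (f : Vh T r) (hK : K ∈ T.cells) :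
    EqPolyOn Ω (f : Lp ℝ 2 (volume.restrict Ω)) K
      (localPoly Ω (f : Lp ℝ 2 (volume.restrict Ω)) K) := by
  obtain ⟨P, -, hP⟩ := f.2 K hK
  rwa [hP.localPoly_eq hK]

theorem totalDegree_localPoly_le (f : Vh T r) (hK : K ∈ T.cells) :
    (localPoly Ω (f : Lp ℝ 2 (volume.restrict Ω)) K).totalDegree ≤ r := by
  obtain ⟨P, hP, hfP⟩ := f.2 K hK
  rwa [hfP.localPoly_eq hK]

theorem ae_eq_loc (f : Vh T r) (hK : K ∈ T.cells) :
    ∀ᵐ x ∂(volume.restrict (convexHull ℝ (K : Set (Euc n)))),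
      (f : Lp ℝ 2 (volume.restrict Ω)) x = loc f K x :=
  (eqPolyOn_localPoly f hK).ae_simplex hK

theorem localPoly_add (f g : Vh T r) (hK : K ∈ T.cells) :
    localPoly Ω ((f + g : Vh T r) : Lp ℝ 2 (volume.restrict Ω)) K
      = localPoly Ω (f : Lp ℝ 2 (volume.restrict Ω)) K
        + localPoly Ω (g : Lp ℝ 2 (volume.restrict Ω)) K := by
  refine EqPolyOn.localPoly_eq hK ?_
  filter_upwards [Lp.coeFn_add (f : Lp ℝ 2 (volume.restrict Ω)) g, eqPolyOn_localPoly f hK,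
    eqPolyOn_localPoly g hK] with x hx h1 h2 hxK
  rw [polyFun_add, ← h1 hxK, ← h2 hxK]
  exact hx

theorem localPoly_smul (a : ℝ) (f : Vh T r) (hK : K ∈ T.cells) :
    localPoly Ω ((a • f : Vh T r) : Lp ℝ 2 (volume.restrict Ω)) K
      = a • localPoly Ω (f : Lp ℝ 2 (volume.restrict Ω)) K := by
  refine EqPolyOn.localPoly_eq hK ?_
  filter_upwards [Lp.coeFn_smul a (f : Lp ℝ 2 (volume.restrict Ω)), eqPolyOn_localPoly f hK]
    with x hx h1 hxK
  rw [polyFun_smul, ← h1 hxK]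
  exact hx

theorem loc_add (f g : Vh T r) (hK : K ∈ T.cells) (x : Euc n) :
    loc (f + g) K x = loc f K x + loc g K x := by
  simp only [loc, localFun, localPoly_add f g hK, polyFun_add]

theorem loc_smul (a : ℝ) (f : Vh T r) (hK : K ∈ T.cells) (x : Euc n) :
    loc (a • f) K x = a * loc f K x := by
  simp only [loc, localFun, localPoly_smul a f hK, polyFun_smul]

theorem contDiff_loc (f : Vh T r) (K : Finset (Euc n)) {k : WithTop ℕ∞} : ContDiff ℝ k (loc f K) :=
  contDiff_polyFun _

theorem eq_zero_of_localPoly_eq_zero (f : Vh T r)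
    (h : ∀ K ∈ T.cells, localPoly Ω (f : Lp ℝ 2 (volume.restrict Ω)) K = 0) : f = 0 := by
  apply Subtype.ext
  refine Lp.eq_zero_iff_ae_eq_zero.2 ?_
  have h1 : ∀ᵐ x ∂(volume.restrict Ω), ∀ K ∈ T.cells, x ∈ convexHull ℝ (K : Set (Euc n)) →
      (f : Lp ℝ 2 (volume.restrict Ω)) x = 0 := by
    refine (Filter.eventually_all_finset T.cells).2 fun K hK => ?_
    filter_upwards [eqPolyOn_localPoly f hK] with x hx hxK
    rw [hx hxK, h K hK]; simp [polyFun]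
  filter_upwards [h1, T.ae_mem_interior] with x hx ⟨K, hK, hxK⟩
  exact hx K hK (interior_subset hxK)

instance (T : Triangulation Ω) (r : ℕ) : FiniteDimensional ℝ (Vh T r) := by
  let L : Vh T r →ₗ[ℝ] (T.cells → MvPolynomial.restrictTotalDegree (Fin n) ℝ r) :=
    { toFun := fun f K => ⟨localPoly Ω (f : Lp ℝ 2 (volume.restrict Ω)) K,
        (MvPolynomial.mem_restrictTotalDegree _ _ _).2 (totalDegree_localPoly_le f K.2)⟩
      map_add' := fun f g => funext fun K => Subtype.ext (localPoly_add f g K.2)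
      map_smul' := fun a f => funext fun K => Subtype.ext (localPoly_smul a f K.2) }
  refine FiniteDimensional.of_injective L ((injective_iff_map_eq_zero L).2 fun f hf => ?_)
  exact eq_zero_of_localPoly_eq_zero f fun K hK =>
    congrArg Subtype.val (congrFun hf ⟨K, hK⟩)

theorem Lp.real_inner_eq {μ : Measure (Euc n)} (F G : Lp ℝ 2 μ) :
    inner ℝ F G = ∫ x, F x * G x ∂μ := by
  rw [L2.inner_def]
  refine integral_congr_ae (Eventually.of_forall fun x => ?_)
  exact mul_comm _ _

theorem integrable_Lp_mul {μ : Measure (Euc n)} (F G : Lp ℝ 2 μ) :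
    Integrable (fun x => F x * G x) μ :=
  (Lp.memLp F).integrable_mul (Lp.memLp G)

theorem norm_sq_eq_sum (f : Vh T r) {h : ℝ} (hh : 0 < h) :
    ‖f‖ ^ 2 = ∑ K ∈ T.cells,
      h ^ n * scaledNorm h (convexHull ℝ (K : Set (Euc n))) (loc f K) ^ 2 := by
  have h0 : ‖f‖ = ‖(f : Lp ℝ 2 (volume.restrict Ω))‖ := rfl
  rw [h0, ← real_inner_self_eq_norm_sq, Lp.real_inner_eq,
    T.integral_eq_sum (integrable_Lp_mul _ _)]
  refine Finset.sum_congr rfl fun K hK => ?_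
  rw [scaledNorm_sq hh]
  refine integral_congr_ae ?_
  filter_upwards [ae_eq_loc f hK] with x hx
  rw [hx, sq]

/-- A point of `K` in the interior of `L` must lie on the frontier of `K`, which is null. -/
theorem ae_simplex_notMem {L : Finset (Euc n)} (hK : K ∈ T.cells) (hL : L ∈ T.cells)
    (hne : K ≠ L) : ∀ᵐ x ∂(volume.restrict (convexHull ℝ (L : Set (Euc n)))),
      x ∉ convexHull ℝ (K : Set (Euc n)) := by
  have h1 : ∀ᵐ x ∂(volume.restrict (convexHull ℝ (L : Set (Euc n)))),
      x ∉ frontier (convexHull ℝ (K : Set (Euc n))) :=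
    ae_restrict_of_ae (measure_eq_zero_iff_ae_notMem.1 (volume_frontier_simplex K))
  filter_upwards [h1, ae_mem_interior_simplex L] with x hx hxL hxK
  exact hx ⟨subset_closure hxK, fun h =>
    Set.disjoint_left.1 (Triangulation.disjoint_interior hK hL hne) h hxL⟩

theorem memLp_indicator_polyFun (K : Finset (Euc n)) (P : MvPolynomial (Fin n) ℝ) :
    MemLp ((convexHull ℝ (K : Set (Euc n))).indicator (polyFun P)) 2 (volume.restrict Ω) := by
  have hm := (isCompact_simplex K).measurableSet
  have hfin : IsFiniteMeasure (volume.restrict (convexHull ℝ (K : Set (Euc n)))) :=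
    ⟨by rw [Measure.restrict_apply_univ]; exact (isCompact_simplex K).measure_lt_top⟩
  refine MemLp.restrict _ ((memLp_indicator_iff_restrict hm).2 ?_)
  obtain ⟨M, hM⟩ := (isCompact_simplex K).exists_bound_of_continuousOn
    (contDiff_polyFun (k := 0) P).continuous.continuousOn
  refine MemLp.of_bound (contDiff_polyFun (k := 0) P).continuous.aestronglyMeasurable M ?_
  filter_upwards [ae_restrict_mem hm] with x hx using hM x hx

/-- The element of `V_h^r` that is `P` on the cell `K` and vanishes on the other cells. -/
def cellPoly (T : Triangulation Ω) (hK : K ∈ T.cells) (P : MvPolynomial (Fin n) ℝ)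
    (hP : P.totalDegree ≤ r) : Vh T r :=
  ⟨(memLp_indicator_polyFun (Ω := Ω) K P).toLp, by
    intro L hL
    have hco := Triangulation.ae_simplex_of_ae hL (memLp_indicator_polyFun (Ω := Ω) K P).coeFn_toLp
    by_cases hLK : K = L
    · subst hLK
      refine ⟨P, hP, eqPolyOn_of_ae ?_⟩
      filter_upwards [hco, ae_restrict_mem (isCompact_simplex K).measurableSet] with x hx hxK
      rw [hx, Set.indicator_of_mem hxK]
    · refine ⟨0, by simp, eqPolyOn_of_ae ?_⟩
      filter_upwards [hco, ae_simplex_notMem hK hL hLK] with x hx hxK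
      rw [hx, Set.indicator_of_notMem hxK]
      simp [polyFun]⟩

theorem coe_cellPoly (hK : K ∈ T.cells) (P : MvPolynomial (Fin n) ℝ) (hP : P.totalDegree ≤ r) :
    ((cellPoly T hK P hP : Lp ℝ 2 (volume.restrict Ω)) : Euc n → ℝ)
      =ᵐ[volume.restrict Ω] (convexHull ℝ (K : Set (Euc n))).indicator (polyFun P) :=
  (memLp_indicator_polyFun (Ω := Ω) K P).coeFn_toLp

/-- Testing with functions supported on one cell decouples the `L²` projection into projections on
the cells. -/
theorem inner_cellPoly (hK : K ∈ T.cells) (P : MvPolynomial (Fin n) ℝ) (hP : P.totalDegree ≤ r)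
    (G : Lp ℝ 2 (volume.restrict Ω)) :
    inner ℝ G (cellPoly T hK P hP : Lp ℝ 2 (volume.restrict Ω))
      = ∫ x in convexHull ℝ (K : Set (Euc n)), G x * polyFun P x := by
  rw [Lp.real_inner_eq, T.integral_eq_sum (integrable_Lp_mul _ _),
    Finset.sum_eq_single_of_mem K hK]
  · refine integral_congr_ae ?_
    filter_upwards [Triangulation.ae_simplex_of_ae hK (coe_cellPoly hK P hP),
      ae_restrict_mem (isCompact_simplex K).measurableSet] with x hx hxK
    rw [hx, Set.indicator_of_mem hxK]
  · intro L hL hne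
    rw [← integral_zero (Euc n) ℝ]
    refine integral_congr_ae ?_
    filter_upwards [Triangulation.ae_simplex_of_ae hL (coe_cellPoly hK P hP),
      ae_simplex_notMem hK hL hne.symm] with x hx hxK
    rw [hx, Set.indicator_of_notMem hxK, mul_zero]

end FiniteElement

/-! ### Shape-regular meshes -/

/-- Every element contains a ball of radius `c h` and is contained in the concentric ball of
radius `h`. -/
structure RegularMesh {Ω : Set (Euc n)} (T : Triangulation Ω) (c h : ℝ) : Prop where
  c_pos : 0 < c
  h_pos : 0 < h
  exists_center : ∀ K ∈ T.cells, ∃ x₀ : Euc n,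
    Metric.closedBall x₀ (c * h) ⊆ convexHull ℝ (K : Set (Euc n)) ∧
    convexHull ℝ (K : Set (Euc n)) ⊆ Metric.closedBall x₀ h

theorem IsSimplex.simplexDiam_pos (hn : 1 ≤ n) {K : Finset (Euc n)} (hK : IsSimplex K) :
    0 < simplexDiam K := by
  have hc : 1 < K.card := by rw [hK.card_eq]; omega
  obtain ⟨a, ha, b, hb, hab⟩ := Finset.one_lt_card.1 hc
  exact (dist_pos.2 hab).trans_le (Metric.dist_le_diam_of_mem (isCompact_simplex K).isBounded
    (subset_convexHull ℝ _ ha) (subset_convexHull ℝ _ hb))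

theorem ShapeRegularQuasiUniform.exists_regularMesh (hn : 1 ≤ n) {Ω : Set (Euc n)}
    (hne : Ω.Nonempty) {ι : Type*} {T : ι → Triangulation Ω} (hT : ShapeRegularQuasiUniform T) :
    ∃ c : ℝ, 0 < c ∧ ∀ i, RegularMesh (T i) c (T i).meshSize := by
  obtain ⟨C₁, C₂, h1, h2, hreg⟩ := hT
  -- The hypotheses give inradius at least `h / (C₁ C₂)`. The factor `2` makes the inequality
  -- strict, so that a ball can be extracted from the supremum.
  refine ⟨(2 * (C₁ * C₂))⁻¹, by positivity, fun i => ?_⟩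
  have hle : ∀ K ∈ (T i).cells, simplexDiam K ≤ (T i).meshSize := fun K hK =>
    le_csSup (((T i).cells.finite_toSet.image _).bddAbove) ⟨K, hK, rfl⟩
  have hpos : 0 < (T i).meshSize := by
    obtain ⟨K, hK⟩ := (T i).cells_nonempty hne
    exact ((Triangulation.isSimplex hK).simplexDiam_pos hn).trans_le (hle K hK)
  refine ⟨by positivity, hpos, fun K hK => ?_⟩
  obtain ⟨h3, h4⟩ := hreg i K hK
  have h5 : (2 * (C₁ * C₂))⁻¹ * (T i).meshSize < simplexInradius K := by
    have h6 : (T i).meshSize ≤ C₁ * C₂ * simplexInradius K := by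
      calc (T i).meshSize ≤ C₂ * simplexDiam K := h4
        _ ≤ C₂ * (C₁ * simplexInradius K) := by gcongr
        _ = _ := by ring
    rw [inv_mul_lt_iff₀ (by positivity)]
    nlinarith
  -- The set of admissible radii is nonempty, since otherwise its supremum would be the default
  -- value `0`.
  obtain ⟨ρ, ⟨hρ0, x, hx⟩, hρ⟩ := exists_lt_of_lt_csSup (by
    by_contra hempty
    rw [Set.not_nonempty_iff_eq_empty] at hempty
    unfold simplexInradius at h5
    rw [hempty, Real.sSup_empty] at h5
    exact absurd h5 (not_lt.2 (by positivity))) h5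
  refine ⟨x, (Metric.closedBall_subset_closedBall hρ.le).trans hx, fun y hy => ?_⟩
  exact (Metric.dist_le_diam_of_mem (isCompact_simplex K).isBounded hy
    (hx (Metric.mem_closedBall_self hρ0))).trans (hle K hK)

/-- The volume of the unit ball. -/
def ballVol (n : ℕ) : ℝ := (volume (Metric.closedBall (0 : Euc n) 1)).toReal

theorem ballVol_nonneg (n : ℕ) : 0 ≤ ballVol n := ENNReal.toReal_nonneg

namespace RegularMesh

variable {Ω : Set (Euc n)} {T : Triangulation Ω} {c h : ℝ} {K L : Finset (Euc n)} {r : ℕ}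

/-- An affine function with values in `[0, 1]` on a ball of radius `c h` changes by at most `1` from
the centre. -/
theorem norm_baryGrad_le (hM : RegularMesh T c h) (hK : K ∈ T.cells) (v : Euc n) :
    ‖baryGrad K v‖ ≤ (c * h)⁻¹ := by
  obtain ⟨x₀, hx₀, -⟩ := hM.exists_center K hK
  have hch : 0 < c * h := mul_pos hM.c_pos hM.h_pos
  have hs := Triangulation.isSimplex hK
  refine ContinuousLinearMap.opNorm_le_of_unit_norm (by positivity) fun w hw => ?_
  have h1 : x₀ + (c * h) • w ∈ convexHull ℝ (K : Set (Euc n)) := hx₀ (by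
    rw [mem_closedBall_iff_norm, add_sub_cancel_left, norm_smul, hw, mul_one,
      Real.norm_of_nonneg hch.le])
  have h2 : x₀ ∈ convexHull ℝ (K : Set (Euc n)) := hx₀ (Metric.mem_closedBall_self hch.le)
  have h3 := bary_eq_add K v (x₀ + (c * h) • w) x₀
  rw [add_sub_cancel_left, map_smul, smul_eq_mul] at h3
  have h4 : |c * h * baryGrad K v w| ≤ 1 := by
    rw [abs_le]
    have := hs.bary_nonneg h1 v
    have := hs.bary_le_one h1 v
    have := hs.bary_nonneg h2 v
    have := hs.bary_le_one h2 v
    constructor <;> linarith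
  rw [abs_mul, abs_of_pos hch] at h4
  rw [Real.norm_eq_abs, ← one_div, le_div_iff₀ hch, mul_comm]
  exact h4

theorem volume_le (hM : RegularMesh T c h) (hK : K ∈ T.cells) :
    (volume (convexHull ℝ (K : Set (Euc n)))).toReal ≤ ballVol n * h ^ n := by
  obtain ⟨x₀, -, hx₀⟩ := hM.exists_center K hK
  refine (ENNReal.toReal_mono (isCompact_closedBall x₀ h).measure_lt_top.ne
    (measure_mono hx₀)).trans ?_
  rw [Measure.addHaar_closedBall' _ _ hM.h_pos.le, ENNReal.toReal_mul,
    ENNReal.toReal_ofReal (pow_nonneg hM.h_pos.le _), finrank_euclideanSpace, Fintype.card_fin,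
    mul_comm]
  rfl

/-- Elements with a common vertex lie in a ball whose radius is a multiple of `h`. -/
theorem exists_center_patch (hM : RegularMesh T c h) (hL : L ∈ T.cells) : ∃ x₀ : Euc n,
    Metric.closedBall x₀ (c * h) ⊆ convexHull ℝ (L : Set (Euc n)) ∧
    convexHull ℝ (L : Set (Euc n)) ⊆ Metric.closedBall x₀ h ∧
    ∀ K ∈ T.cells, (K ∩ L).Nonempty →
      convexHull ℝ (K : Set (Euc n)) ⊆ Metric.closedBall x₀ (3 * h) := by
  obtain ⟨x₀, h1, h2⟩ := hM.exists_center L hL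
  refine ⟨x₀, h1, h2, fun K hK ⟨v, hv⟩ y hy => ?_⟩
  obtain ⟨x₁, -, h3⟩ := hM.exists_center K hK
  rw [Finset.mem_inter] at hv
  have hy1 := h3 hy
  have hv1 := h3 (subset_convexHull ℝ _ hv.1)
  have hv2 := h2 (subset_convexHull ℝ _ hv.2)
  rw [Metric.mem_closedBall] at *
  -- The shared vertex `v` is within `2 h` of `y`, through `x₁`, and within `h` of `x₀`.
  linarith [dist_triangle y v x₀, dist_triangle_right y v x₁]

end RegularMesh

/-- The polynomial of `L` is also controlled on neighbouring cells `K`, because averages on a face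
are extended as polynomials into both cells. -/
theorem exists_loc_bound (n r : ℕ) {c : ℝ} (hc : 0 < c) : ∃ C : ℝ, 0 ≤ C ∧
    ∀ {Ω : Set (Euc n)} {T : Triangulation Ω} {h : ℝ}, RegularMesh T c h →
    ∀ (f : Vh T r) {K L : Finset (Euc n)}, K ∈ T.cells → L ∈ T.cells → (K ∩ L).Nonempty →
    ∀ x ∈ convexHull ℝ (K : Set (Euc n)),
      |loc f L x| ≤ C * scaledNorm h (convexHull ℝ (L : Set (Euc n))) (loc f L) ∧
      ‖fderiv ℝ (loc f L) x‖
        ≤ C * h⁻¹ * scaledNorm h (convexHull ℝ (L : Set (Euc n))) (loc f L) := by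
  obtain ⟨C, hC, hinv⟩ := exists_inverse_estimate n r hc
  refine ⟨C, hC, fun {Ω T h} hM f K L hK hL hKL x hx => ?_⟩
  obtain ⟨x₀, h1, h2, h3⟩ := hM.exists_center_patch hL
  exact hinv _ (totalDegree_localPoly_le f hL) h x₀ _ hM.h_pos (isCompact_simplex L) h1 x
    (h3 K hK hKL hx)

/-! ### The `L²` projection onto the finite element space -/

/-- The `L²` projection onto `V_h^r`. -/
def feProj {Ω : Set (Euc n)} (T : Triangulation Ω) (r : ℕ) (G : Lp ℝ 2 (volume.restrict Ω)) :
    Vh T r := (Vh T r).orthogonalProjectionOnto G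

theorem inner_feProj {Ω : Set (Euc n)} {T : Triangulation Ω} {r : ℕ}
    (G : Lp ℝ 2 (volume.restrict Ω)) (v : Vh T r) :
    inner ℝ v (feProj T r G) = inner ℝ (v : Lp ℝ 2 (volume.restrict Ω)) G := by
  rw [real_inner_comm, real_inner_comm G]
  exact (Vh T r).inner_orthogonalProjectionOnto_eq_of_mem_right v G

theorem polyFun_sub_C (P : MvPolynomial (Fin n) ℝ) (a : ℝ) (x : Euc n) :
    polyFun (P - MvPolynomial.C a) x = polyFun P x - a := by simp [polyFun]

/-- Constants belong to `P_r`, so `q`, the projection minus `g x₀`, is itself a test function and `∫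
q² = ∫ (g - g x₀) q`. Young's inequality then bounds `∫ q²` by `(l h)²` times the volume. -/
theorem scaledNorm_feProj_sub_le {Ω : Set (Euc n)} {T : Triangulation Ω} {r : ℕ} {c h : ℝ}
    (hM : RegularMesh T c h) {g : Euc n → ℝ} (hg : MemLp g 2 (volume.restrict Ω)) {l : ℝ}
    (hl : 0 ≤ l) (hlip : ∀ x y, |g x - g y| ≤ l * ‖x - y‖) (hgc : Continuous g)
    {K : Finset (Euc n)} (hK : K ∈ T.cells) {x₀ : Euc n}
    (hx₀ : convexHull ℝ (K : Set (Euc n)) ⊆ Metric.closedBall x₀ h) :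
    scaledNorm h (convexHull ℝ (K : Set (Euc n)))
      (polyFun (localPoly Ω (feProj T r hg.toLp : Lp ℝ 2 (volume.restrict Ω)) K
        - MvPolynomial.C (g x₀))) ≤ l * h * Real.sqrt (ballVol n) := by
  set G : Lp ℝ 2 (volume.restrict Ω) := hg.toLp
  set q := localPoly Ω (feProj T r G : Lp ℝ 2 (volume.restrict Ω)) K - MvPolynomial.C (g x₀)
    with hq
  have hh := hM.h_pos
  have hqd : q.totalDegree ≤ r := (MvPolynomial.totalDegree_sub _ _).trans
    (max_le (totalDegree_localPoly_le _ hK) (by simp))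
  have hqc : Continuous (polyFun q) := (contDiff_polyFun (k := 0) q).continuous
  have hcomp := isCompact_simplex K
  have hint : ∀ {F : Euc n → ℝ}, Continuous F → IntegrableOn F (convexHull ℝ (K : Set (Euc n))) :=
    fun hF => hF.continuousOn.integrableOn_compact hcomp
  have h1 : ∫ x in convexHull ℝ (K : Set (Euc n)), loc (feProj T r G) K x * polyFun q x
      = ∫ x in convexHull ℝ (K : Set (Euc n)), g x * polyFun q x := by
    have h2 := inner_feProj G (cellPoly T hK q hqd)
    have h3 : inner ℝ (cellPoly T hK q hqd) (feProj T r G)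
        = inner ℝ (feProj T r G : Lp ℝ 2 (volume.restrict Ω))
          (cellPoly T hK q hqd : Lp ℝ 2 (volume.restrict Ω)) := real_inner_comm _ _
    rw [h3, real_inner_comm, real_inner_comm G, real_inner_comm, inner_cellPoly,
      inner_cellPoly] at h2
    refine Eq.trans ?_ (h2.trans ?_)
    · refine integral_congr_ae ?_
      filter_upwards [ae_eq_loc (feProj T r G) hK] with x hx
      rw [hx]
    · refine integral_congr_ae ?_
      filter_upwards [Triangulation.ae_simplex_of_ae hK hg.coeFn_toLp] with x hx
      rw [hx]
  have h4 : ∫ x in convexHull ℝ (K : Set (Euc n)), polyFun q x ^ 2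
      = ∫ x in convexHull ℝ (K : Set (Euc n)), (g x - g x₀) * polyFun q x := by
    have e1 : ∀ x, polyFun q x ^ 2
        = loc (feProj T r G) K x * polyFun q x - g x₀ * polyFun q x := fun x => by
      have : polyFun q x = loc (feProj T r G) K x - g x₀ := polyFun_sub_C _ _ _
      rw [sq]; nth_rewrite 1 [this]; ring
    simp_rw [e1, sub_mul]
    have hpc : Continuous (loc (feProj T r G) K) := (contDiff_loc (k := 0) _ K).continuous
    rw [integral_sub (hint (F := fun x => loc (feProj T r G) K x * polyFun q x) (by fun_prop))
      (hint (F := fun x => g x₀ * polyFun q x) (by fun_prop)), h1,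
      integral_sub (hint (F := fun x => g x * polyFun q x) (by fun_prop))
      (hint (F := fun x => g x₀ * polyFun q x) (by fun_prop))]
  have h5 : ∫ x in convexHull ℝ (K : Set (Euc n)), (g x - g x₀) * polyFun q x
      ≤ ∫ x in convexHull ℝ (K : Set (Euc n)), ((l * h) ^ 2 / 2 + polyFun q x ^ 2 / 2) := by
    refine setIntegral_mono_on (hint ((hgc.sub continuous_const).mul hqc))
      (hint (continuous_const.add ((hqc.pow 2).div_const 2))) hcomp.measurableSet fun x hx => ?_
    have h6 : |g x - g x₀| ≤ l * h := (hlip x x₀).trans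
      (mul_le_mul_of_nonneg_left (mem_closedBall_iff_norm.1 (hx₀ hx)) hl)
    have h7 : (g x - g x₀) ^ 2 ≤ (l * h) ^ 2 := sq_le_sq' (abs_le.1 h6).1 (abs_le.1 h6).2
    nlinarith [sq_nonneg (g x - g x₀ - polyFun q x)]
  rw [integral_add (hint continuous_const)
    (hint (F := fun x => polyFun q x ^ 2 / 2) (by fun_prop)),
    setIntegral_const, smul_eq_mul, integral_div, ← h4] at h5
  have h8 : ∫ x in convexHull ℝ (K : Set (Euc n)), polyFun q x ^ 2
      ≤ (l * h) ^ 2 * (ballVol n * h ^ n) := by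
    have h9 := mul_le_mul_of_nonneg_left (hM.volume_le hK) (sq_nonneg (l * h))
    have h10 : volume.real (convexHull ℝ (K : Set (Euc n)))
      = (volume (convexHull ℝ (K : Set (Euc n)))).toReal := rfl
    rw [h10] at h5
    linarith
  unfold scaledNorm
  rw [Real.sqrt_le_left (by positivity), mul_pow, Real.sq_sqrt (ballVol_nonneg n),
    inv_mul_le_iff₀ (by positivity)]
  linarith

/-- The inverse estimate for the projection minus `g x₀` turns the `L²` bound into pointwise bounds;
on the patch of radius `3 h`, `g` itself deviates from `g x₀` by at most `3 l h`. -/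
theorem exists_feProj_bound (n r : ℕ) {c : ℝ} (hc : 0 < c) : ∃ C : ℝ, 0 ≤ C ∧
    ∀ {Ω : Set (Euc n)} {T : Triangulation Ω} {h : ℝ}, RegularMesh T c h →
    ∀ {g : Euc n → ℝ} (hg : MemLp g 2 (volume.restrict Ω)) {l : ℝ}, 0 ≤ l →
    (∀ x y, |g x - g y| ≤ l * ‖x - y‖) → Continuous g →
    ∀ {K L : Finset (Euc n)}, K ∈ T.cells → L ∈ T.cells → (K ∩ L).Nonempty →
    ∀ x ∈ convexHull ℝ (K : Set (Euc n)),
      |loc (feProj T r hg.toLp) L x - g x| ≤ C * l * h ∧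
      ‖fderiv ℝ (loc (feProj T r hg.toLp) L) x‖ ≤ C * l := by
  obtain ⟨C, hC, hinv⟩ := exists_inverse_estimate n r hc
  refine ⟨C * Real.sqrt (ballVol n) + 3, by positivity,
    fun {Ω T h} hM g hg l hl hlip hgc K L hK hL hKL x hx => ?_⟩
  obtain ⟨x₀, h1, h2, h3⟩ := hM.exists_center_patch hL
  have hh := hM.h_pos
  have hsc := scaledNorm_feProj_sub_le (r := r) hM hg hl hlip hgc hL h2
  set q := localPoly Ω (feProj T r hg.toLp : Lp ℝ 2 (volume.restrict Ω)) L - MvPolynomial.C (g x₀)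
    with hq
  have hqd : q.totalDegree ≤ r := (MvPolynomial.totalDegree_sub _ _).trans
    (max_le (totalDegree_localPoly_le _ hL) (by simp))
  have hxb := h3 K hK hKL hx
  obtain ⟨h4, h5⟩ := hinv q hqd h x₀ _ hh (isCompact_simplex L) h1 x hxb
  have hqf : polyFun q = fun x => loc (feProj T r hg.toLp) L x - g x₀ :=
    funext fun x => polyFun_sub_C _ _ _
  have h6 : C * scaledNorm h (convexHull ℝ (L : Set (Euc n))) (polyFun q)
      ≤ C * (l * h * Real.sqrt (ballVol n)) := mul_le_mul_of_nonneg_left hsc hC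
  constructor
  · have h7 : |g x - g x₀| ≤ l * (3 * h) := (hlip x x₀).trans
      (mul_le_mul_of_nonneg_left (mem_closedBall_iff_norm.1 hxb) hl)
    have h8 : |loc (feProj T r hg.toLp) L x - g x₀| ≤ C * (l * h * Real.sqrt (ballVol n)) := by
      have := h4.trans h6
      rwa [hqf] at this
    calc |loc (feProj T r hg.toLp) L x - g x|
        = |(loc (feProj T r hg.toLp) L x - g x₀) - (g x - g x₀)| := by ring_nf
      _ ≤ _ := abs_sub _ _
      _ ≤ C * (l * h * Real.sqrt (ballVol n)) + l * (3 * h) := add_le_add h8 h7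
      _ = _ := by ring
  · have h9 : fderiv ℝ (polyFun q) x = fderiv ℝ (loc (feProj T r hg.toLp) L) x := by
      rw [hqf, fderiv_sub_const]
    rw [h9] at h5
    refine h5.trans ?_
    calc C * h⁻¹ * scaledNorm h (convexHull ℝ (L : Set (Euc n))) (polyFun q)
        = h⁻¹ * (C * scaledNorm h (convexHull ℝ (L : Set (Euc n))) (polyFun q)) := by ring
      _ ≤ h⁻¹ * (C * (l * h * Real.sqrt (ballVol n))) := by gcongr
      _ = C * Real.sqrt (ballVol n) * l := by field_simp
      _ ≤ _ := by nlinarith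

/-! ### Sums over interior faces -/

namespace Triangulation

variable {Ω : Set (Euc n)} {T : Triangulation Ω} {K e : Finset (Euc n)}

theorem mem_interiorFaces : e ∈ T.interiorFaces ↔
    e ∈ T.complex.faces ∧ e.card = n ∧ (T.cellsAt e).card = 2 := by
  simp [interiorFaces]

open Classical in
theorem exists_eq_erase (he : e.card = n) (hK : K ∈ T.cellsAt e) : ∃ j ∈ K, e = K.erase j := by
  obtain ⟨a, ha, rfl⟩ := exists_eq_insert he hK
  refine ⟨a, Finset.mem_insert_self a e, ?_⟩
  convert (Finset.erase_insert ha).symm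

open Classical in
theorem sum_interiorFaces_comm {M : Type*} [AddCommMonoid M]
    (F : Finset (Euc n) → Finset (Euc n) → M) :
    ∑ e ∈ T.interiorFaces, ∑ K ∈ T.cellsAt e, F K e
      = ∑ K ∈ T.cells, ∑ e ∈ T.interiorFaces.filter fun e => e ⊆ K, F K e := by
  refine Finset.sum_comm' fun e K => ?_
  rw [mem_cellsAt, Finset.mem_filter]
  tauto

open Classical in
theorem card_interiorFaces_le (hK : K ∈ T.cells) :
    (T.interiorFaces.filter fun e => e ⊆ K).card ≤ n + 1 := by
  have h : (T.interiorFaces.filter fun e => e ⊆ K) ⊆ K.powersetCard n := fun e he => by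
    rw [Finset.mem_filter, mem_interiorFaces] at he
    exact Finset.mem_powersetCard.2 ⟨he.2, he.1.2.1⟩
  refine (Finset.card_le_card h).trans ?_
  rw [Finset.card_powersetCard, ((T.mem_cells).1 hK).2, Nat.choose_succ_self_right]

/-- Exchange the sums; a cell has at most `n + 1` facets. -/
theorem sum_interiorFaces_le {F : Finset (Euc n) → Finset (Euc n) → ℝ} {b : Finset (Euc n) → ℝ}
    (hb : ∀ K ∈ T.cells, 0 ≤ b K)
    (hF : ∀ e ∈ T.interiorFaces, ∀ K ∈ T.cellsAt e, F K e ≤ b K) :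
    ∑ e ∈ T.interiorFaces, ∑ K ∈ T.cellsAt e, F K e ≤ (n + 1) * ∑ K ∈ T.cells, b K := by
  classical
  refine (Finset.sum_le_sum fun e he => Finset.sum_le_sum fun K hK => hF e he K hK).trans ?_
  rw [sum_interiorFaces_comm fun K _ => b K, Finset.mul_sum]
  refine Finset.sum_le_sum fun K hK => ?_
  rw [Finset.sum_const, nsmul_eq_mul]
  refine mul_le_mul_of_nonneg_right ?_ (hb K hK)
  exact_mod_cast card_interiorFaces_le hK

theorem abs_sum_interiorFaces_le {F : Finset (Euc n) → Finset (Euc n) → ℝ}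
    {b : Finset (Euc n) → ℝ} (hb : ∀ K ∈ T.cells, 0 ≤ b K)
    (hF : ∀ e ∈ T.interiorFaces, ∀ K ∈ T.cellsAt e, |F K e| ≤ b K) :
    |∑ e ∈ T.interiorFaces, ∑ K ∈ T.cellsAt e, F K e| ≤ (n + 1) * ∑ K ∈ T.cells, b K := by
  refine (Finset.abs_sum_le_sum_abs _ _).trans ?_
  refine (Finset.sum_le_sum fun e _ => Finset.abs_sum_le_sum_abs _ _).trans ?_
  exact sum_interiorFaces_le (F := fun K e => |F K e|) hb hF

end Triangulation

/-! ### Green's formula on the mesh -/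

namespace FluxData

variable {Ω : Set (Euc n)} {T : Triangulation Ω} {u : Euc n → Euc n} {d : Euc n → ℝ}
  {K e : Finset (Euc n)} {φ ψ : Euc n → ℝ} {r : ℕ}

theorem integrableOn_norm (hF : FluxData T u d) (hK : K ∈ T.cells) :
    IntegrableOn u (convexHull ℝ (K : Set (Euc n))) := by
  have := hF.isFiniteMeasure
  exact (hF.h0div.memLp.integrable (by norm_num)).mono_measure
    (Triangulation.restrict_simplex_le hK)

theorem integrableOn_fderiv_mul (hF : FluxData T u d) (hK : K ∈ T.cells) (hφ : ContDiff ℝ 1 φ)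
    (hψ : Continuous ψ) :
    IntegrableOn (fun x => fderiv ℝ φ x (u x) * ψ x) (convexHull ℝ (K : Set (Euc n))) := by
  obtain ⟨M, hM⟩ := (isCompact_simplex K).exists_bound_of_continuousOn
    (hφ.continuous_fderiv one_ne_zero).continuousOn
  refine IntegrableOn.mul_continuousOn ?_ hψ.continuousOn (isCompact_simplex K)
  refine Integrable.mono' ((hF.integrableOn_norm hK).norm.const_mul M)
    (integrable_fderiv_apply (hF.aestronglyMeasurable hK) φ) ?_
  filter_upwards [ae_restrict_mem (isCompact_simplex K).measurableSet] with x hx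
  exact (ContinuousLinearMap.le_opNorm _ _).trans
    (mul_le_mul_of_nonneg_right (hM x hx) (norm_nonneg _))

theorem integrableOn_div_mul (hF : FluxData T u d) (hK : K ∈ T.cells) (hψ : Continuous ψ) :
    IntegrableOn (fun x => d x * ψ x) (convexHull ℝ (K : Set (Euc n))) :=
  (hF.integrableOn_div hK).mul_continuousOn hψ.continuousOn (isCompact_simplex K)

/-- A facet belongs to at most two cells, so one that is not interior belongs to exactly one. The
sum of fluxes over its cells, which is zero, is then this single flux. -/
theorem faceFlux_eq_zero_of_notMem (hF : FluxData T u d) (hn : 1 ≤ n) (hK : K ∈ T.cells)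
    (he : e.card = n) (heK : e ⊆ K) (hei : e ∉ T.interiorFaces) (hφ : ContDiff ℝ 1 φ) :
    faceFlux u d K e φ = 0 := by
  have h1 := sum_faceFlux_eq_zero hF.bdd hF.h0div hF.integrable_wt hφ he
  have hmem : K ∈ T.cellsAt e := (T.mem_cellsAt).2 ⟨hK, heK⟩
  have hface : e ∈ T.complex.faces := T.complex.down_closed ((T.mem_cells).1 hK).1 heK
    (Finset.card_pos.1 (by omega))
  have h2 : (T.cellsAt e).card = 1 := by
    have := Triangulation.card_cellsAt_le_two (T := T) hn he
    have h3 : (T.cellsAt e).card ≠ 2 := fun h => hei (Triangulation.mem_interiorFaces.2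
      ⟨hface, he, h⟩)
    have := Finset.card_pos.2 ⟨K, hmem⟩
    omega
  obtain ⟨L, hL⟩ := Finset.card_eq_one.1 h2
  rw [hL, Finset.mem_singleton] at hmem
  rw [hL, Finset.sum_singleton] at h1
  rw [hmem, h1]

open Classical in
theorem sum_faceFlux_eq_sum_interiorFaces (hF : FluxData T u d) (hn : 1 ≤ n)
    {φ : Finset (Euc n) → Euc n → ℝ} (hφ : ∀ K ∈ T.cells, ContDiff ℝ 1 (φ K)) :
    ∑ K ∈ T.cells, ∑ j ∈ K, faceFlux u d K (K.erase j) (φ K)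
      = ∑ e ∈ T.interiorFaces, ∑ K ∈ T.cellsAt e, faceFlux u d K e (φ K) := by
  rw [Triangulation.sum_interiorFaces_comm fun K e => faceFlux u d K e (φ K)]
  refine Finset.sum_congr rfl fun K hK => ?_
  rw [← Finset.sum_image (f := fun e => faceFlux u d K e (φ K)) (s := K) (g := fun j => K.erase j)
    fun i hi j hj hij => Finset.erase_injOn K hi hj hij]
  symm
  refine Finset.sum_subset (fun e he => ?_) fun e he hne => ?_
  · rw [Finset.mem_filter, Triangulation.mem_interiorFaces] at he
    obtain ⟨j, hj, hej⟩ := Triangulation.exists_eq_erase he.1.2.1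
      ((T.mem_cellsAt).2 ⟨hK, he.2⟩)
    exact Finset.mem_image.2 ⟨j, hj, hej.symm⟩
  · obtain ⟨j, hj, rfl⟩ := Finset.mem_image.1 he
    have hsub := Finset.erase_subset j K
    refine hF.faceFlux_eq_zero_of_notMem hn hK ?_ hsub (fun h => hne ?_) (hφ K hK)
    · rw [Finset.card_erase_of_mem hj, ((T.mem_cells).1 hK).2]; rfl
    · exact Finset.mem_filter.2 ⟨h, hsub⟩

/-- Integration by parts on each cell, with the boundary terms regrouped by interior faces. For
continuous `g` the average on a face is `g`, so this says that the form is exact on smooth test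
functions. -/
theorem green (hF : FluxData T u d) (hn : 1 ≤ n) (f : Vh T r) {g : Euc n → ℝ}
    (hg : ContDiff ℝ 1 g) :
    (∑ K ∈ T.cells, ∫ x in convexHull ℝ (K : Set (Euc n)), fderiv ℝ (loc f K) x (u x) * g x)
      - ∑ e ∈ T.interiorFaces, ∑ K ∈ T.cellsAt e, faceFlux u d K e (fun x => loc f K x * g x)
    = - ∫ x in Ω, (f : Lp ℝ 2 (volume.restrict Ω)) x * divMul u d g x := by
  classical
  have hprod : ∀ K, ContDiff ℝ 1 fun x => loc f K x * g x := fun K => (contDiff_loc f K).mul hg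
  rw [← hF.sum_faceFlux_eq_sum_interiorFaces hn (φ := fun K x => loc f K x * g x)
    fun K _ => hprod K]
  have hae : ∀ K ∈ T.cells, (fun x => (f : Lp ℝ 2 (volume.restrict Ω)) x * divMul u d g x)
      =ᵐ[volume.restrict (convexHull ℝ (K : Set (Euc n)))]
      fun x => fderiv ℝ g x (u x) * loc f K x + d x * (loc f K x * g x) := fun K hK => by
    filter_upwards [ae_eq_loc f hK] with x hx
    rw [hx, divMul]; ring
  have i2 : ∀ K ∈ T.cells, IntegrableOn (fun x => fderiv ℝ g x (u x) * loc f K x)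
      (convexHull ℝ (K : Set (Euc n))) := fun K hK =>
    hF.integrableOn_fderiv_mul hK hg (contDiff_loc (k := 0) f K).continuous
  have i3 : ∀ K ∈ T.cells, IntegrableOn (fun x => d x * (loc f K x * g x))
      (convexHull ℝ (K : Set (Euc n))) := fun K hK =>
    hF.integrableOn_div_mul hK (hprod K).continuous
  have i1 : ∀ K ∈ T.cells, IntegrableOn (fun x => fderiv ℝ (loc f K) x (u x) * g x)
      (convexHull ℝ (K : Set (Euc n))) := fun K hK =>
    hF.integrableOn_fderiv_mul hK (contDiff_loc f K) hg.continuous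
  have hint : IntegrableOn (fun x => (f : Lp ℝ 2 (volume.restrict Ω)) x * divMul u d g x) Ω :=
    T.integrableOn_of_cells fun K hK => ((i2 K hK).add (i3 K hK)).congr (hae K hK).symm
  rw [T.integral_eq_sum hint, ← Finset.sum_sub_distrib, ← Finset.sum_neg_distrib]
  refine Finset.sum_congr rfl fun K hK => ?_
  rw [← hF.normalPairing_eq_sum_faceFlux hK (hprod K), integral_congr_ae (hae K hK),
    integral_add (i2 K hK) (i3 K hK)]
  have h1 : normalPairing (convexHull ℝ (K : Set (Euc n))) u d (fun x => loc f K x * g x)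
      = ∫ x in convexHull ℝ (K : Set (Euc n)), (fderiv ℝ (loc f K) x (u x) * g x
        + (fderiv ℝ g x (u x) * loc f K x + d x * (loc f K x * g x))) := by
    refine integral_congr_ae (Eventually.of_forall fun x => ?_)
    have h := fderiv_fun_mul ((contDiff_loc (k := 1) f K).differentiable one_ne_zero x)
      (hg.differentiable one_ne_zero x)
    simp only [h, FunLike.coe_add, FunLike.coe_smul, Pi.add_apply, Pi.smul_apply, smul_eq_mul]
    ring
  have i23 : IntegrableOn (fun x => fderiv ℝ g x (u x) * loc f K x + d x * (loc f K x * g x))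
    (convexHull ℝ (K : Set (Euc n))) := (i2 K hK).add (i3 K hK)
  rw [h1, integral_add (i1 K hK) i23, integral_add (i2 K hK) (i3 K hK)]
  ring

end FluxData

/-! ### Existence and uniqueness of the operator -/

section DirOperator

variable {Ω : Set (Euc n)} {T : Triangulation Ω} {u : Euc n → Euc n} {d : Euc n → ℝ} {r : ℕ}

/-- The average of `g` on the face `e`. -/
abbrev avg (T : Triangulation Ω) (g : Vh T r) (e : Finset (Euc n)) : Euc n → ℝ :=
  average T (g : Lp ℝ 2 (volume.restrict Ω)) e

theorem contDiff_avg (g : Vh T r) (e : Finset (Euc n)) : ContDiff ℝ 1 (avg T g e) :=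
  contDiff_const.mul (ContDiff.sum fun K _ => contDiff_loc g K)

theorem avg_add (g g' : Vh T r) (e : Finset (Euc n)) (x : Euc n) :
    avg T (g + g') e x = avg T g e x + avg T g' e x := by
  simp only [avg, average]
  rw [← mul_add, ← Finset.sum_add_distrib]
  congr 1
  exact Finset.sum_congr rfl fun K hK => loc_add g g' ((T.mem_cellsAt).1 hK).1 x

theorem avg_smul (a : ℝ) (g : Vh T r) (e : Finset (Euc n)) (x : Euc n) :
    avg T (a • g) e x = a * avg T g e x := by
  simp only [avg, average]
  rw [mul_left_comm a]
  congr 1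
  rw [Finset.mul_sum]
  exact Finset.sum_congr rfl fun K hK => loc_smul a g ((T.mem_cellsAt).1 hK).1 x

/-- `dirForm` on the finite element space. -/
abbrev feForm (T : Triangulation Ω) (u : Euc n → Euc n) (d : Euc n → ℝ) (f g : Vh T r) : ℝ :=
  dirForm T u d (f : Lp ℝ 2 (volume.restrict Ω)) (g : Lp ℝ 2 (volume.restrict Ω))

theorem feForm_eq (f g : Vh T r) : feForm T u d f g =
    (∑ K ∈ T.cells, ∫ x in convexHull ℝ (K : Set (Euc n)),
        fderiv ℝ (loc f K) x (u x) * loc g K x)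
      - ∑ e ∈ T.interiorFaces, ∑ K ∈ T.cellsAt e,
        faceFlux u d K e fun x => loc f K x * avg T g e x := rfl

namespace FluxData

theorem faceFlux_cellsAt_add (hF : FluxData T u d) {K e : Finset (Euc n)}
    (he : e ∈ T.interiorFaces) (hK : K ∈ T.cellsAt e) {φ ψ χ : Euc n → ℝ} (hφ : ContDiff ℝ 1 φ)
    (hψ : ContDiff ℝ 1 ψ) (h : ∀ x, χ x = φ x + ψ x) :
    faceFlux u d K e χ = faceFlux u d K e φ + faceFlux u d K e ψ := by
  obtain ⟨j, hj, rfl⟩ :=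
    Triangulation.exists_eq_erase (Triangulation.mem_interiorFaces.1 he).2.1 hK
  rw [funext h]
  exact hF.faceFlux_add ((T.mem_cellsAt).1 hK).1 hj hφ hψ

theorem faceFlux_cellsAt_smul {K e : Finset (Euc n)} (he : e ∈ T.interiorFaces)
    (hK : K ∈ T.cellsAt e) {φ χ : Euc n → ℝ} (hφ : ContDiff ℝ 1 φ) (a : ℝ)
    (h : ∀ x, χ x = a * φ x) : faceFlux u d K e χ = a * faceFlux u d K e φ := by
  obtain ⟨j, hj, rfl⟩ :=
    Triangulation.exists_eq_erase (Triangulation.mem_interiorFaces.1 he).2.1 hK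
  rw [funext h]
  exact faceFlux_smul ((T.mem_cellsAt).1 hK).1 hj hφ a

theorem integrableOn_fderiv_loc (hF : FluxData T u d) (f g : Vh T r) {K : Finset (Euc n)}
    (hK : K ∈ T.cells) : IntegrableOn (fun x => fderiv ℝ (loc f K) x (u x) * loc g K x)
      (convexHull ℝ (K : Set (Euc n))) :=
  hF.integrableOn_fderiv_mul hK (contDiff_loc f K) (contDiff_loc (k := 0) g K).continuous

theorem feForm_add_right (hF : FluxData T u d) (f g g' : Vh T r) :
    feForm T u d f (g + g') = feForm T u d f g + feForm T u d f g' := by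
  rw [feForm_eq, feForm_eq, feForm_eq, sub_add_sub_comm, ← Finset.sum_add_distrib,
    ← Finset.sum_add_distrib]
  congr 1
  · refine Finset.sum_congr rfl fun K hK => ?_
    rw [← integral_add (hF.integrableOn_fderiv_loc f g hK) (hF.integrableOn_fderiv_loc f g' hK)]
    refine integral_congr_ae (Eventually.of_forall fun x => ?_)
    simp only [loc_add g g' hK, mul_add]
  · refine Finset.sum_congr rfl fun e he => ?_
    rw [← Finset.sum_add_distrib]
    refine Finset.sum_congr rfl fun K hK => ?_
    exact hF.faceFlux_cellsAt_add he hK ((contDiff_loc f K).mul (contDiff_avg g e))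
      ((contDiff_loc f K).mul (contDiff_avg g' e)) fun x => by rw [avg_add, mul_add]

theorem feForm_add_left (hF : FluxData T u d) (f f' g : Vh T r) :
    feForm T u d (f + f') g = feForm T u d f g + feForm T u d f' g := by
  rw [feForm_eq, feForm_eq, feForm_eq, sub_add_sub_comm, ← Finset.sum_add_distrib,
    ← Finset.sum_add_distrib]
  congr 1
  · refine Finset.sum_congr rfl fun K hK => ?_
    rw [← integral_add (hF.integrableOn_fderiv_loc f g hK) (hF.integrableOn_fderiv_loc f' g hK)]
    refine integral_congr_ae (Eventually.of_forall fun x => ?_)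
    have h := fderiv_fun_add ((contDiff_loc (k := 1) f K).differentiable one_ne_zero x)
      ((contDiff_loc (k := 1) f' K).differentiable one_ne_zero x)
    have h2 : loc (f + f') K = fun x => loc f K x + loc f' K x := funext (loc_add f f' hK)
    simp only [h2, h, FunLike.coe_add, Pi.add_apply, add_mul]
  · refine Finset.sum_congr rfl fun e he => ?_
    rw [← Finset.sum_add_distrib]
    refine Finset.sum_congr rfl fun K hK => ?_
    exact hF.faceFlux_cellsAt_add he hK ((contDiff_loc f K).mul (contDiff_avg g e))
      ((contDiff_loc f' K).mul (contDiff_avg g e)) fun x => by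
        rw [loc_add f f' ((T.mem_cellsAt).1 hK).1, add_mul]

end FluxData

theorem feForm_smul_right (a : ℝ) (f g : Vh T r) :
    feForm T u d f (a • g) = a * feForm T u d f g := by
  rw [feForm_eq, feForm_eq, mul_sub, Finset.mul_sum, Finset.mul_sum]
  congr 1
  · refine Finset.sum_congr rfl fun K hK => ?_
    rw [← integral_const_mul]
    refine integral_congr_ae (Eventually.of_forall fun x => ?_)
    simp only [loc_smul a g hK, mul_left_comm]
  · refine Finset.sum_congr rfl fun e he => ?_
    rw [Finset.mul_sum]
    refine Finset.sum_congr rfl fun K hK => ?_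
    exact FluxData.faceFlux_cellsAt_smul he hK ((contDiff_loc f K).mul (contDiff_avg g e)) a
      fun x => by rw [avg_smul, mul_left_comm]

theorem feForm_smul_left (a : ℝ) (f g : Vh T r) :
    feForm T u d (a • f) g = a * feForm T u d f g := by
  rw [feForm_eq, feForm_eq, mul_sub, Finset.mul_sum, Finset.mul_sum]
  congr 1
  · refine Finset.sum_congr rfl fun K hK => ?_
    rw [← integral_const_mul]
    refine integral_congr_ae (Eventually.of_forall fun x => ?_)
    have h := fderiv_const_mul ((contDiff_loc (k := 1) f K).differentiable one_ne_zero x) a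
    have h2 : loc (a • f) K = fun x => a * loc f K x := funext (loc_smul a f hK)
    simp only [h2, h, FunLike.coe_smul, Pi.smul_apply, smul_eq_mul, mul_assoc]
  · refine Finset.sum_congr rfl fun e he => ?_
    rw [Finset.mul_sum]
    refine Finset.sum_congr rfl fun K hK => ?_
    exact FluxData.faceFlux_cellsAt_smul he hK ((contDiff_loc f K).mul (contDiff_avg g e)) a
      fun x => by rw [loc_smul a f ((T.mem_cellsAt).1 hK).1, mul_assoc]

/-- Riesz representation in the second argument; linearity in the first follows from uniqueness of
the representative. -/
theorem existsUnique_linearMap_of_bilinear {V : Type*} [NormedAddCommGroup V]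
    [InnerProductSpace ℝ V] [FiniteDimensional ℝ V] (B : V → V → ℝ)
    (add_left : ∀ f f' g, B (f + f') g = B f g + B f' g)
    (smul_left : ∀ (a : ℝ) f g, B (a • f) g = a * B f g)
    (add_right : ∀ f g g', B f (g + g') = B f g + B f g')
    (smul_right : ∀ (a : ℝ) f g, B f (a • g) = a * B f g) :
    ∃! A : V →ₗ[ℝ] V, ∀ f g, inner ℝ (A f) g = B f g := by
  have hex : ∀ f, ∃ w : V, ∀ g, inner ℝ w g = B f g := fun f => by
    let L : V →ₗ[ℝ] ℝ := { toFun := B f, map_add' := add_right f, map_smul' := fun a => smul_right a f }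
    refine ⟨(InnerProductSpace.toDual ℝ V).symm (LinearMap.toContinuousLinearMap L), fun g => ?_⟩
    rw [InnerProductSpace.toDual_symm_apply]
    rfl
  choose R hR using hex
  refine ⟨{ toFun := R, map_add' := fun f f' => ?_, map_smul' := fun a f => ?_ }, hR,
    fun A hA => ?_⟩
  · refine ext_inner_right ℝ fun g => ?_
    rw [inner_add_left, hR, hR, hR, add_left]
  · refine ext_inner_right ℝ fun g => ?_
    rw [RingHom.id_apply, real_inner_smul_left, hR, hR, smul_left]
  · refine LinearMap.ext fun f => ext_inner_right ℝ fun g => ?_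
    rw [hA f g]
    exact (hR f g).symm

theorem FluxData.existsUnique_isDirOperator (hF : FluxData T u d) (r : ℕ) :
    ∃! A : Vh T r →ₗ[ℝ] Vh T r, IsDirOperator T r u d A :=
  existsUnique_linearMap_of_bilinear (feForm T u d) hF.feForm_add_left feForm_smul_left
    hF.feForm_add_right feForm_smul_right

end DirOperator

/-! ### Integrability of the vector field against the weights -/

/-- Two Young inequalities: `F a W ≤ F² W ^ (1 + 2/p) + a² W ^ (1 - 2/p)`, and the weighted mean
inequality for `a²` and `W ^ (1 - 2/p)`. The exponent `1 + 2/p` is below `2` because `p > 2`, so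
with `W = wt K` the right side is integrable. -/
theorem mul_mul_le_weighted {p F a W : ℝ} (hp : 2 < p) (ha : 0 ≤ a) (hW : 1 ≤ W) :
    F * (a * W) ≤ F ^ 2 * W ^ (1 + 2 / p) + a ^ p + W := by
  have hp0 : 0 < p := by linarith
  have hW0 : 0 < W := by linarith
  have h2p : 2 / p < 1 := (div_lt_one hp0).2 hp
  have h2p0 : 0 < 2 / p := by positivity
  have h1 := Real.geom_mean_le_arith_mean2_weighted h2p0.le (sub_nonneg.2 h2p.le)
    (Real.rpow_nonneg ha p) hW0.le (by ring)
  have h2 : (a ^ p) ^ (2 / p) = a ^ 2 := by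
    rw [← Real.rpow_mul ha, mul_div_cancel₀ _ hp0.ne', Real.rpow_two]
  rw [h2] at h1
  have h3 : W ^ (1 + 2 / p) * W ^ (1 - 2 / p) = W ^ 2 := by
    rw [← Real.rpow_add hW0, ← Real.rpow_two]; congr 1; ring
  have h4 := Real.rpow_nonneg ha p
  set X := W ^ (1 + 2 / p)
  set Y := W ^ (1 - 2 / p)
  have hX : 0 < X := Real.rpow_pos_of_pos hW0 _
  have hY : 0 < Y := Real.rpow_pos_of_pos hW0 _
  have h5 : F * (a * W) ≤ F ^ 2 * X + a ^ 2 * Y := by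
    have h6 : W = Real.sqrt X * Real.sqrt Y := by
      rw [← Real.sqrt_mul hX.le, h3, Real.sqrt_sq hW0.le]
    have h7 := Real.sq_sqrt hX.le
    have h8 := Real.sq_sqrt hY.le
    rw [h6]
    set s := Real.sqrt X
    set t := Real.sqrt Y
    rw [← h7, ← h8]
    nlinarith [sq_nonneg (F * s - a * t), sq_nonneg (F * s), sq_nonneg (a * t)]
  have h9 : 2 / p * a ^ p ≤ a ^ p := mul_le_of_le_one_left h4 h2p.le
  have h10 : (1 - 2 / p) * W ≤ W := mul_le_of_le_one_left hW0.le (by linarith)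
  linarith

/-- The integral of `|div u| + |u| wt` over a simplex. -/
def cellMass (u : Euc n → Euc n) (d : Euc n → ℝ) (K : Finset (Euc n)) : ℝ :=
  ∫ x in convexHull ℝ (K : Set (Euc n)), (|d x| + ‖u x‖ * wt K x)

theorem cellMass_nonneg (u : Euc n → Euc n) (d : Euc n → ℝ) (K : Finset (Euc n)) :
    0 ≤ cellMass u d K :=
  integral_nonneg fun _ => add_nonneg (abs_nonneg _) (mul_nonneg (norm_nonneg _) (wt_nonneg _ _))

/-- Global substitute for a Cauchy–Schwarz inequality between the `F K` and the masses. When `F K`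
is the local size of a finite element function, the sum of squares is its `L²` norm, and no negative
power of `h` appears. -/
theorem exists_cellMass_bound (n : ℕ) {p : ℝ} (hp : 2 < p) : ∃ C : ℝ, 0 ≤ C ∧
    ∀ {Ω : Set (Euc n)} {T : Triangulation Ω} {u : Euc n → Euc n} {d : Euc n → ℝ},
    Bornology.IsBounded Ω → MemLp u (ENNReal.ofReal p) (volume.restrict Ω) →
    MemLp d 2 (volume.restrict Ω) →
    (∀ K ∈ T.cells,
      IntegrableOn (fun x => ‖u x‖ * wt K x) (convexHull ℝ (K : Set (Euc n)))) ∧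
    ∀ F : Finset (Euc n) → ℝ,
      ∑ K ∈ T.cells, F K * cellMass u d K
        ≤ C * ∑ K ∈ T.cells, F K ^ 2 * (volume (convexHull ℝ (K : Set (Euc n)))).toReal
          + ((∫ x in Ω, d x ^ 2) + (∫ x in Ω, ‖u x‖ ^ p) + C * (volume Ω).toReal) := by
  have hp0 : 0 < p := by linarith
  obtain ⟨C₁, hC₁, hw1⟩ := exists_integral_wt_rpow_le n one_pos one_lt_two
  obtain ⟨C₂, hC₂, hw2⟩ := exists_integral_wt_rpow_le n (s := 1 + 2 / p) (by positivity) (by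
    have := (div_lt_one hp0).2 hp; linarith)
  refine ⟨1 + C₁ + C₂, by positivity, fun {Ω T u d} hb hu hd => ?_⟩
  have hfin : IsFiniteMeasure (volume.restrict Ω) :=
    ⟨by rw [Measure.restrict_apply_univ]; exact hb.measure_lt_top⟩
  have iu : IntegrableOn (fun x => ‖u x‖ ^ p) Ω := by
    have := hu.integrable_norm_rpow (by simpa using hp0) ENNReal.ofReal_ne_top
    rwa [ENNReal.toReal_ofReal hp0.le] at this
  have id2 : IntegrableOn (fun x => d x ^ 2) Ω := hd.integrable_sq
  have iuK : ∀ K ∈ T.cells, IntegrableOn (fun x => ‖u x‖ ^ p) (convexHull ℝ (K : Set (Euc n))) :=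
    fun K hK => Integrable.mono_measure iu (Triangulation.restrict_simplex_le hK)
  have idK : ∀ K ∈ T.cells, IntegrableOn (fun x => d x ^ 2) (convexHull ℝ (K : Set (Euc n))) :=
    fun K hK => Integrable.mono_measure id2 (Triangulation.restrict_simplex_le hK)
  have iw1 : ∀ K ∈ T.cells, IntegrableOn (wt K) (convexHull ℝ (K : Set (Euc n))) :=
    fun K hK => by simpa using (hw1 K (Triangulation.isSimplex hK)).1
  have iw2 := fun K (hK : K ∈ T.cells) => (hw2 K (Triangulation.isSimplex hK)).1
  have hwt : ∀ K ∈ T.cells,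
      IntegrableOn (fun x => ‖u x‖ * wt K x) (convexHull ℝ (K : Set (Euc n))) := fun K hK => by
    refine Integrable.mono' (((iw2 K hK).add (iuK K hK)).add (iw1 K hK)) ?_ ?_
    · exact ((hu.aestronglyMeasurable.mono_measure
        (Triangulation.restrict_simplex_le hK)).norm).mul
          (measurable_wt K).aestronglyMeasurable
    · filter_upwards [ae_mem_interior_simplex K] with x hx
      have := mul_mul_le_weighted (F := 1) hp (norm_nonneg (u x))
        ((Triangulation.isSimplex hK).one_le_wt hx)
      rw [Real.norm_of_nonneg (mul_nonneg (norm_nonneg _) (wt_nonneg _ _))]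
      simp only [Pi.add_apply]
      linarith
  refine ⟨hwt, fun F => ?_⟩
  have idabs : ∀ K ∈ T.cells, IntegrableOn (fun x => |d x|) (convexHull ℝ (K : Set (Euc n))) :=
    fun K hK => (Integrable.mono_measure (hd.integrable (by norm_num))
      (Triangulation.restrict_simplex_le hK)).abs
  have hvol : ∑ K ∈ T.cells, (volume (convexHull ℝ (K : Set (Euc n)))).toReal
      = (volume Ω).toReal := by
    have := T.integral_eq_sum (F := fun _ => (1 : ℝ)) (integrable_const _)
    simpa [Measure.real] using this.symm
  rw [T.integral_eq_sum id2, T.integral_eq_sum iu, ← hvol, Finset.mul_sum, Finset.mul_sum,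
    ← Finset.sum_add_distrib, ← Finset.sum_add_distrib, ← Finset.sum_add_distrib]
  refine Finset.sum_le_sum fun K hK => ?_
  have hs := Triangulation.isSimplex hK
  set V := (volume (convexHull ℝ (K : Set (Euc n)))).toReal with hV
  have hV0 : 0 ≤ V := ENNReal.toReal_nonneg
  have hfinK : IsFiniteMeasure (volume.restrict (convexHull ℝ (K : Set (Euc n)))) :=
    ⟨by rw [Measure.restrict_apply_univ]; exact (isCompact_simplex K).measure_lt_top⟩
  have hle : F K * cellMass u d K ≤ ∫ x in convexHull ℝ (K : Set (Euc n)),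
      ((F K ^ 2 + d x ^ 2) + (F K ^ 2 * wt K x ^ (1 + 2 / p) + ‖u x‖ ^ p + wt K x)) := by
    unfold cellMass
    rw [← integral_const_mul]
    refine integral_mono_ae (((idabs K hK).add (hwt K hK)).const_mul _)
      (((integrable_const _).add (idK K hK)).add
        ((((iw2 K hK).const_mul _).add (iuK K hK)).add (iw1 K hK))) ?_
    filter_upwards [ae_mem_interior_simplex K] with x hx
    have h1 := mul_mul_le_weighted (F := F K) hp (norm_nonneg (u x)) (hs.one_le_wt hx)
    have h2 : F K * |d x| ≤ F K ^ 2 + d x ^ 2 := by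
      nlinarith [sq_nonneg (F K - |d x|), sq_abs (d x), sq_nonneg (F K), sq_nonneg (d x)]
    linarith
  refine hle.trans ?_
  have e1 : IntegrableOn (fun x => F K ^ 2 + d x ^ 2) (convexHull ℝ (K : Set (Euc n))) :=
    (integrable_const _).add (idK K hK)
  have e2 : IntegrableOn (fun x => F K ^ 2 * wt K x ^ (1 + 2 / p) + ‖u x‖ ^ p)
    (convexHull ℝ (K : Set (Euc n))) := ((iw2 K hK).const_mul _).add (iuK K hK)
  have e3 : IntegrableOn (fun x => F K ^ 2 * wt K x ^ (1 + 2 / p) + ‖u x‖ ^ p + wt K x)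
    (convexHull ℝ (K : Set (Euc n))) := e2.add (iw1 K hK)
  rw [integral_add e1 e3, integral_add (integrable_const _) (idK K hK), integral_add e2 (iw1 K hK),
    integral_add ((iw2 K hK).const_mul _) (iuK K hK), setIntegral_const, smul_eq_mul,
    integral_const_mul]
  have h1 := (hw1 K hs).2
  simp only [Real.rpow_one] at h1
  have h2 := mul_le_mul_of_nonneg_left (hw2 K hs).2 (sq_nonneg (F K))
  have h3 : volume.real (convexHull ℝ (K : Set (Euc n))) = V := rfl
  rw [h3]
  nlinarith [mul_nonneg hC₁ hV0, mul_nonneg hC₂ hV0, mul_nonneg (sq_nonneg (F K)) hV0,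
    mul_nonneg hC₁ (mul_nonneg (sq_nonneg (F K)) hV0)]

namespace FluxData

variable {Ω : Set (Euc n)} {T : Triangulation Ω} {u : Euc n → Euc n} {d : Euc n → ℝ}
  {K e : Finset (Euc n)} {φ : Euc n → ℝ}

theorem integrableOn_mass (hF : FluxData T u d) (hK : K ∈ T.cells) :
    IntegrableOn (fun x => |d x| + ‖u x‖ * wt K x) (convexHull ℝ (K : Set (Euc n))) :=
  (hF.integrableOn_div hK).abs.add (hF.integrable_wt K hK)

theorem abs_faceFlux_le_cellMass (hF : FluxData T u d) {c h : ℝ} (hM : RegularMesh T c h)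
    (he : e ∈ T.interiorFaces) (hK : K ∈ T.cellsAt e) (hφ : ContDiff ℝ 1 φ) {α α' β : ℝ}
    (hα : ∀ x ∈ convexHull ℝ (K : Set (Euc n)), |φ x| ≤ α)
    (hα' : ∀ x ∈ convexHull ℝ (K : Set (Euc n)), ‖fderiv ℝ φ x‖ ≤ α')
    (hβ : α ≤ β) (hβ' : α' + α * (n * (c * h)⁻¹ + (c * h)⁻¹) ≤ β) :
    |faceFlux u d K e φ| ≤ β * cellMass u d K := by
  obtain ⟨j, hj, rfl⟩ :=
    Triangulation.exists_eq_erase (Triangulation.mem_interiorFaces.1 he).2.1 hK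
  have hK' := ((T.mem_cellsAt).1 hK).1
  refine (hF.abs_faceFlux_le hK' hj hφ hα hα' (hM.norm_baryGrad_le hK')).trans ?_
  unfold cellMass
  rw [← integral_const_mul]
  refine setIntegral_mono (((hF.integrableOn_div hK').abs.const_mul _).add
    ((hF.integrable_wt K hK').const_mul _)) ((hF.integrableOn_mass hK').const_mul _) fun x => ?_
  have h1 := mul_le_mul_of_nonneg_right hβ (abs_nonneg (d x))
  have h2 := mul_le_mul_of_nonneg_right hβ' (mul_nonneg (norm_nonneg (u x)) (wt_nonneg K x))
  simp only
  linarith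

theorem abs_integral_fderiv_mul_le (hF : FluxData T u d) (hK : K ∈ T.cells) {ψ : Euc n → ℝ}
    {β : ℝ} (h : ∀ x ∈ convexHull ℝ (K : Set (Euc n)), ‖fderiv ℝ φ x‖ * |ψ x| ≤ β) :
    |∫ x in convexHull ℝ (K : Set (Euc n)), fderiv ℝ φ x (u x) * ψ x| ≤ β * cellMass u d K := by
  unfold cellMass
  rw [← integral_const_mul, ← Real.norm_eq_abs]
  refine norm_integral_le_of_norm_le ((hF.integrableOn_mass hK).const_mul _) ?_
  filter_upwards [ae_mem_interior_simplex K] with x hx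
  have hβ := h x (interior_subset hx)
  have hβ0 : 0 ≤ β := (mul_nonneg (norm_nonneg _) (abs_nonneg _)).trans hβ
  have h1 : ‖fderiv ℝ φ x (u x) * ψ x‖ ≤ ‖fderiv ℝ φ x‖ * |ψ x| * ‖u x‖ := by
    rw [norm_mul, Real.norm_eq_abs (ψ x), mul_right_comm]
    exact mul_le_mul_of_nonneg_right (ContinuousLinearMap.le_opNorm _ _) (abs_nonneg _)
  have h2 : ‖u x‖ ≤ |d x| + ‖u x‖ * wt K x := by
    nlinarith [abs_nonneg (d x), norm_nonneg (u x),
      (Triangulation.isSimplex hK).one_le_wt hx]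
  exact h1.trans (mul_le_mul hβ h2 (norm_nonneg _) hβ0)

end FluxData

/-! ### The consistency error -/

theorem lipschitz_of_norm_fderiv_le {g : Euc n → ℝ} (hg : ContDiff ℝ 1 g) {l : ℝ}
    (hl : ∀ x, ‖fderiv ℝ g x‖ ≤ l) (x y : Euc n) : |g x - g y| ≤ l * ‖x - y‖ :=
  convex_univ.norm_image_sub_le_of_norm_fderiv_le
    (fun z _ => hg.differentiable one_ne_zero z) (fun z _ => hl z) (Set.mem_univ y) (Set.mem_univ x)

theorem norm_fderiv_mul_le {a b : Euc n → ℝ} (ha : ContDiff ℝ 1 a) (hb : ContDiff ℝ 1 b)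
    {x : Euc n} {α α' β β' : ℝ} (h1 : |a x| ≤ α) (h2 : ‖fderiv ℝ a x‖ ≤ α') (h3 : |b x| ≤ β)
    (h4 : ‖fderiv ℝ b x‖ ≤ β') : ‖fderiv ℝ (fun y => a y * b y) x‖ ≤ α * β' + β * α' := by
  rw [fderiv_fun_mul (ha.differentiable one_ne_zero x) (hb.differentiable one_ne_zero x)]
  refine (norm_add_le _ _).trans (add_le_add ?_ ?_)
  · rw [norm_smul]
    exact mul_le_mul h1 h4 (norm_nonneg _) ((abs_nonneg _).trans h1)
  · rw [norm_smul]
    exact mul_le_mul h3 h2 (norm_nonneg _) ((abs_nonneg _).trans h3)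

theorem norm_fderiv_sub_le {a b : Euc n → ℝ} (ha : ContDiff ℝ 1 a) (hb : ContDiff ℝ 1 b)
    {x : Euc n} {α β : ℝ} (h1 : ‖fderiv ℝ a x‖ ≤ α) (h2 : ‖fderiv ℝ b x‖ ≤ β) :
    ‖fderiv ℝ (fun y => a y - b y) x‖ ≤ α + β := by
  rw [fderiv_fun_sub (ha.differentiable one_ne_zero x) (hb.differentiable one_ne_zero x)]
  exact (norm_sub_le _ _).trans (add_le_add h1 h2)

section Consistency

variable {Ω : Set (Euc n)} {T : Triangulation Ω} {u : Euc n → Euc n} {d : Euc n → ℝ} {r : ℕ}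
  {c h : ℝ} {g : Euc n → ℝ}

namespace Triangulation

theorem inter_nonempty_of_mem_cellsAt (hn : 1 ≤ n) {e K L : Finset (Euc n)}
    (he : e ∈ T.interiorFaces) (hK : K ∈ T.cellsAt e) (hL : L ∈ T.cellsAt e) :
    (K ∩ L).Nonempty := by
  obtain ⟨v, hv⟩ := Finset.card_pos.1 (by
    rw [(mem_interiorFaces.1 he).2.1]; omega : 0 < e.card)
  exact ⟨v, Finset.mem_inter.2 ⟨((T.mem_cellsAt).1 hK).2 hv, ((T.mem_cellsAt).1 hL).2 hv⟩⟩

theorem inter_self_nonempty {K : Finset (Euc n)} (hK : K ∈ T.cells) :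
    (K ∩ K).Nonempty := by
  rw [Finset.inter_self]
  exact Finset.card_pos.1 (by rw [((T.mem_cells).1 hK).2]; omega)

end Triangulation

/-- An interior face has exactly two cells, so the weights `1 / 2` add up to `1`. -/
theorem avg_sub_eq (G : Vh T r) {e : Finset (Euc n)} (he : e ∈ T.interiorFaces) (x : Euc n) :
    avg T G e x - g x = (1 / 2) * ∑ L ∈ T.cellsAt e, (loc G L x - g x) := by
  rw [Finset.sum_sub_distrib, Finset.sum_const, (Triangulation.mem_interiorFaces.1 he).2.2]
  simp only [avg, average, loc]
  ring

theorem abs_avg_sub_le {G : Vh T r} {e : Finset (Euc n)} (he : e ∈ T.interiorFaces) {x : Euc n}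
    {β : ℝ} (h : ∀ L ∈ T.cellsAt e, |loc G L x - g x| ≤ β) : |avg T G e x - g x| ≤ β := by
  rw [avg_sub_eq G he, abs_mul]
  have h1 := (Finset.abs_sum_le_sum_abs (fun L => loc G L x - g x) (T.cellsAt e)).trans
    (Finset.sum_le_sum h)
  rw [Finset.sum_const, (Triangulation.mem_interiorFaces.1 he).2.2, nsmul_eq_mul] at h1
  norm_num at h1 ⊢
  linarith

theorem norm_fderiv_avg_le {G : Vh T r} {e : Finset (Euc n)} (he : e ∈ T.interiorFaces) {x : Euc n}
    {β : ℝ} (h : ∀ L ∈ T.cellsAt e, ‖fderiv ℝ (loc G L) x‖ ≤ β) :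
    ‖fderiv ℝ (avg T G e) x‖ ≤ β := by
  have h0 : fderiv ℝ (avg T G e) x
      = (1 / 2 : ℝ) • ∑ L ∈ T.cellsAt e, fderiv ℝ (loc G L) x := by
    refine HasFDerivAt.fderiv ?_
    exact (HasFDerivAt.fun_sum fun L _ =>
      ((contDiff_loc (k := 1) G L).differentiable one_ne_zero x).hasFDerivAt).const_mul (1 / 2)
  rw [h0, norm_smul]
  have h1 := norm_sum_le_of_le _ h
  rw [Finset.sum_const, (Triangulation.mem_interiorFaces.1 he).2.2, nsmul_eq_mul] at h1
  norm_num at h1 ⊢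
  linarith

namespace FluxData

/-- By `green` the integral is minus the form with `g` in place of `G` and of its face averages.
Thus only the differences from `g` remain. -/
theorem feForm_add_integral_eq (hF : FluxData T u d) (hn : 1 ≤ n) (f G : Vh T r)
    (hg : ContDiff ℝ 1 g) :
    feForm T u d f G + ∫ x in Ω, (f : Lp ℝ 2 (volume.restrict Ω)) x * divMul u d g x
      = (∑ K ∈ T.cells, ∫ x in convexHull ℝ (K : Set (Euc n)),
          fderiv ℝ (loc f K) x (u x) * (loc G K x - g x))
        - ∑ e ∈ T.interiorFaces, ∑ K ∈ T.cellsAt e,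
          faceFlux u d K e fun x => loc f K x * (avg T G e x - g x) := by
  have h1 := hF.green hn f hg
  have h2 : ∑ K ∈ T.cells, ∫ x in convexHull ℝ (K : Set (Euc n)),
        fderiv ℝ (loc f K) x (u x) * (loc G K x - g x)
      = (∑ K ∈ T.cells, ∫ x in convexHull ℝ (K : Set (Euc n)),
          fderiv ℝ (loc f K) x (u x) * loc G K x)
        - ∑ K ∈ T.cells, ∫ x in convexHull ℝ (K : Set (Euc n)),
          fderiv ℝ (loc f K) x (u x) * g x := by
    rw [← Finset.sum_sub_distrib]
    refine Finset.sum_congr rfl fun K hK => ?_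
    rw [← integral_sub (hF.integrableOn_fderiv_loc f G hK)
      (hF.integrableOn_fderiv_mul hK (contDiff_loc f K) hg.continuous)]
    simp_rw [mul_sub]
  have h3 : ∑ e ∈ T.interiorFaces, ∑ K ∈ T.cellsAt e,
        faceFlux u d K e (fun x => loc f K x * avg T G e x)
      = (∑ e ∈ T.interiorFaces, ∑ K ∈ T.cellsAt e,
          faceFlux u d K e fun x => loc f K x * (avg T G e x - g x))
        + ∑ e ∈ T.interiorFaces, ∑ K ∈ T.cellsAt e,
          faceFlux u d K e fun x => loc f K x * g x := by
    rw [← Finset.sum_add_distrib]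
    refine Finset.sum_congr rfl fun e he => ?_
    rw [← Finset.sum_add_distrib]
    refine Finset.sum_congr rfl fun K hK => ?_
    exact hF.faceFlux_cellsAt_add he hK ((contDiff_loc f K).mul ((contDiff_avg G e).sub hg))
      ((contDiff_loc f K).mul hg) fun x => by ring
  rw [feForm_eq, h2, h3]
  linarith

/-- The sizes balance: `a` loses a factor `h⁻¹` under differentiation, `b` is of order `h` with
bounded gradient, and the gradient of the cutoff is of order `(n + 1) / (c h)` times `wt`. All
powers of `h` cancel. -/
theorem abs_faceFlux_mul_le (hF : FluxData T u d) (hM : RegularMesh T c h) (h1 : h ≤ 1)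
    {e K : Finset (Euc n)} (he : e ∈ T.interiorFaces) (hK : K ∈ T.cellsAt e) {a b : Euc n → ℝ}
    (ha : ContDiff ℝ 1 a) (hb : ContDiff ℝ 1 b) {α A : ℝ} (hα0 : 0 ≤ α) (hA0 : 0 ≤ A)
    (hα : ∀ x ∈ convexHull ℝ (K : Set (Euc n)), |a x| ≤ α ∧ ‖fderiv ℝ a x‖ ≤ α * h⁻¹)
    (hA : ∀ x ∈ convexHull ℝ (K : Set (Euc n)), |b x| ≤ A * h ∧ ‖fderiv ℝ b x‖ ≤ A) :
    |faceFlux u d K e fun x => a x * b x| ≤ α * A * (2 + (n + 1) / c) * cellMass u d K := by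
  have hh := hM.h_pos
  have hc := hM.c_pos
  have hαA := mul_nonneg hα0 hA0
  refine hF.abs_faceFlux_le_cellMass hM he hK (ha.mul hb) (α := α * (A * h)) (α' := 2 * (α * A))
    (fun x hx => ?_) (fun x hx => ?_) ?_ ?_
  · rw [abs_mul]
    exact mul_le_mul (hα x hx).1 (hA x hx).1 (abs_nonneg _) hα0
  · refine (norm_fderiv_mul_le ha hb (hα x hx).1 (hα x hx).2 (hA x hx).1 (hA x hx).2).trans
      (le_of_eq ?_)
    field_simp; ring
  · have h2 : α * (A * h) ≤ α * A := by
      rw [← mul_assoc]; exact mul_le_of_le_one_right hαA h1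
    have h3 : 0 ≤ α * A * ((n + 1) / c) := by positivity
    nlinarith
  · refine le_of_eq ?_
    field_simp
    try ring

end FluxData

/-- `V_h^r`-projections approximate `g` up to the boundary of every element, and so do their
averages on the faces. -/
structure ApproxOn (T : Triangulation Ω) (g : Euc n → ℝ) (G : Vh T r) (A h : ℝ) : Prop where
  nonneg : 0 ≤ A
  cell : ∀ K ∈ T.cells, ∀ x ∈ convexHull ℝ (K : Set (Euc n)),
    |loc G K x - g x| ≤ A * h ∧ ‖fderiv ℝ (fun y => loc G K y - g y) x‖ ≤ A
  face : ∀ e ∈ T.interiorFaces, ∀ K ∈ T.cellsAt e, ∀ x ∈ convexHull ℝ (K : Set (Euc n)),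
    |avg T G e x - g x| ≤ A * h ∧ ‖fderiv ℝ (fun y => avg T G e y - g y) x‖ ≤ A

theorem exists_approxOn (hn : 1 ≤ n) (r : ℕ) (hc : 0 < c) : ∃ C : ℝ, 0 ≤ C ∧
    ∀ {Ω : Set (Euc n)} {T : Triangulation Ω} {h : ℝ}, RegularMesh T c h →
    ∀ {g : Euc n → ℝ} (hg2 : MemLp g 2 (volume.restrict Ω)), ContDiff ℝ 1 g →
    ∀ {l : ℝ}, (∀ x, ‖fderiv ℝ g x‖ ≤ l) →
    ApproxOn T g (feProj T r hg2.toLp) (C * l) h := by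
  obtain ⟨C, hC, hb⟩ := exists_feProj_bound n r hc
  -- The additional `1` accounts for the gradient of `g`, which is at most `l`.
  refine ⟨C + 1, by positivity, fun {Ω T h} hM g hg2 hg l hl => ?_⟩
  have hh := hM.h_pos
  have hl0 : 0 ≤ l := (norm_nonneg _).trans (hl 0)
  have hlh : C * l * h ≤ (C + 1) * l * h := by nlinarith [mul_nonneg hl0 hh.le]
  have key := fun {K L : Finset (Euc n)} (hK : K ∈ T.cells) (hL : L ∈ T.cells) hKL =>
    hb hM hg2 hl0 (lipschitz_of_norm_fderiv_le hg hl) hg.continuous hK hL hKL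
  refine ⟨by positivity, fun K hK x hx => ?_, fun e he K hK x hx => ?_⟩
  · obtain ⟨h1, h2⟩ := key hK hK (Triangulation.inter_self_nonempty hK) x hx
    refine ⟨h1.trans hlh, (norm_fderiv_sub_le (contDiff_loc _ K) hg h2 (hl x)).trans ?_⟩
    linarith
  · have hK' := ((T.mem_cellsAt).1 hK).1
    have h1 := fun L (hL : L ∈ T.cellsAt e) => key hK' ((T.mem_cellsAt).1 hL).1
      (Triangulation.inter_nonempty_of_mem_cellsAt hn he hK hL) x hx
    refine ⟨(abs_avg_sub_le he fun L hL => (h1 L hL).1).trans hlh,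
      (norm_fderiv_sub_le (contDiff_avg _ e) hg
        (norm_fderiv_avg_le he fun L hL => (h1 L hL).2) (hl x)).trans ?_⟩
    linarith

namespace FluxData

/-- The consistency error is bounded by the masses of the elements. -/
theorem abs_error_le_sum (hF : FluxData T u d) (hn : 1 ≤ n) (hM : RegularMesh T c h) (h1 : h ≤ 1)
    (hg : ContDiff ℝ 1 g) {G : Vh T r} {A : ℝ} (hG : ApproxOn T g G A h) (f : Vh T r)
    {F : Finset (Euc n) → ℝ} (hF0 : ∀ K, 0 ≤ F K)
    (hf : ∀ K ∈ T.cells, ∀ x ∈ convexHull ℝ (K : Set (Euc n)),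
      |loc f K x| ≤ F K ∧ ‖fderiv ℝ (loc f K) x‖ ≤ F K * h⁻¹) :
    |feForm T u d f G + ∫ x in Ω, (f : Lp ℝ 2 (volume.restrict Ω)) x * divMul u d g x|
      ≤ A * (1 + (n + 1) * (2 + (n + 1) / c)) * ∑ K ∈ T.cells, F K * cellMass u d K := by
  have hh := hM.h_pos
  have hc := hM.c_pos
  have hA := hG.nonneg
  rw [hF.feForm_add_integral_eq hn f G hg]
  refine (abs_sub _ _).trans ?_
  have e1 : |∑ K ∈ T.cells, ∫ x in convexHull ℝ (K : Set (Euc n)),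
      fderiv ℝ (loc f K) x (u x) * (loc G K x - g x)|
      ≤ A * ∑ K ∈ T.cells, F K * cellMass u d K := by
    rw [Finset.mul_sum]
    refine (Finset.abs_sum_le_sum_abs _ _).trans (Finset.sum_le_sum fun K hK => ?_)
    rw [← mul_assoc]
    refine hF.abs_integral_fderiv_mul_le hK fun x hx => ?_
    refine (mul_le_mul (hf K hK x hx).2 (hG.cell K hK x hx).1 (abs_nonneg _)
      (mul_nonneg (hF0 K) (by positivity))).trans (le_of_eq ?_)
    field_simp
  have e2 : |∑ e ∈ T.interiorFaces, ∑ K ∈ T.cellsAt e,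
      faceFlux u d K e fun x => loc f K x * (avg T G e x - g x)|
      ≤ (n + 1) * ∑ K ∈ T.cells, F K * A * (2 + (n + 1) / c) * cellMass u d K := by
    refine Triangulation.abs_sum_interiorFaces_le (fun K hK => ?_) fun e he K hK => ?_
    · have := hF0 K
      have := cellMass_nonneg u d K
      positivity
    · exact hF.abs_faceFlux_mul_le hM h1 he hK (contDiff_loc f K) ((contDiff_avg G e).sub hg)
        (hF0 K) hA (hf K ((T.mem_cellsAt).1 hK).1) (hG.face e he K hK)
  have e3 : ∑ K ∈ T.cells, F K * A * (2 + (n + 1) / c) * cellMass u d K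
      = A * (2 + (n + 1) / c) * ∑ K ∈ T.cells, F K * cellMass u d K := by
    rw [Finset.mul_sum]; exact Finset.sum_congr rfl fun K _ => by ring
  rw [e3] at e2
  refine (add_le_add e1 e2).trans (le_of_eq ?_)
  ring

/-- The consistency error is small on approximations of a smooth function. -/
theorem abs_error_le_of_approxOn (hF : FluxData T u d) (hn : 1 ≤ n) (hM : RegularMesh T c h)
    (h1 : h ≤ 1) (hg : ContDiff ℝ 1 g) {G : Vh T r} {A : ℝ} (hG : ApproxOn T g G A h)
    {φ : Euc n → ℝ} (hφ : ContDiff ℝ 1 φ) {f : Vh T r} {B l : ℝ} (hf : ApproxOn T φ f B h)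
    (hl : ∀ x, ‖fderiv ℝ φ x‖ ≤ l) :
    |feForm T u d f G + ∫ x in Ω, (f : Lp ℝ 2 (volume.restrict Ω)) x * divMul u d g x|
      ≤ h * (A * (B + l + (n + 1) * (B * (2 + (n + 1) / c)))) * ∑ K ∈ T.cells, cellMass u d K := by
  have hh := hM.h_pos
  have hc := hM.c_pos
  have hA := hG.nonneg
  have hB := hf.nonneg
  rw [hF.feForm_add_integral_eq hn f G hg]
  refine (abs_sub _ _).trans ?_
  have e1 : |∑ K ∈ T.cells, ∫ x in convexHull ℝ (K : Set (Euc n)),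
      fderiv ℝ (loc f K) x (u x) * (loc G K x - g x)|
      ≤ (B + l) * (A * h) * ∑ K ∈ T.cells, cellMass u d K := by
    rw [Finset.mul_sum]
    refine (Finset.abs_sum_le_sum_abs _ _).trans (Finset.sum_le_sum fun K hK => ?_)
    refine hF.abs_integral_fderiv_mul_le hK fun x hx => ?_
    refine mul_le_mul ?_ (hG.cell K hK x hx).1 (abs_nonneg _)
      (add_nonneg hB ((norm_nonneg _).trans (hl x)))
    have h2 : loc f K = fun y => (loc f K y - φ y) + φ y := funext fun y => by ring
    rw [h2, fderiv_fun_add (((contDiff_loc (k := 1) f K).sub hφ).differentiable one_ne_zero x)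
      (hφ.differentiable one_ne_zero x)]
    exact (norm_add_le _ _).trans (add_le_add (hf.cell K hK x hx).2 (hl x))
  -- The product `φ (avg - g)` is the same function on both sides of the face, so its two fluxes
  -- cancel. Subtracting it replaces `loc f K` by the small difference `loc f K - φ`, which gains
  -- the factor `h`.
  have e2 : ∑ e ∈ T.interiorFaces, ∑ K ∈ T.cellsAt e,
        faceFlux u d K e (fun x => loc f K x * (avg T G e x - g x))
      = ∑ e ∈ T.interiorFaces, ∑ K ∈ T.cellsAt e,
        faceFlux u d K e fun x => (loc f K x - φ x) * (avg T G e x - g x) := by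
    refine Finset.sum_congr rfl fun e he => ?_
    have h3 := sum_faceFlux_eq_zero hF.bdd hF.h0div hF.integrable_wt
      (hφ.mul ((contDiff_avg G e).sub hg)) (Triangulation.mem_interiorFaces.1 he).2.1
    rw [← add_zero (∑ K ∈ T.cellsAt e, faceFlux u d K e fun x =>
      (loc f K x - φ x) * (avg T G e x - g x)), ← h3, ← Finset.sum_add_distrib]
    refine Finset.sum_congr rfl fun K hK => ?_
    exact hF.faceFlux_cellsAt_add he hK
      (((contDiff_loc f K).sub hφ).mul ((contDiff_avg G e).sub hg))
      (hφ.mul ((contDiff_avg G e).sub hg)) fun x => by ring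
  have e3 : |∑ e ∈ T.interiorFaces, ∑ K ∈ T.cellsAt e,
      faceFlux u d K e fun x => (loc f K x - φ x) * (avg T G e x - g x)|
      ≤ (n + 1) * ∑ K ∈ T.cells, B * h * A * (2 + (n + 1) / c) * cellMass u d K := by
    refine Triangulation.abs_sum_interiorFaces_le (fun K hK => ?_) fun e he K hK => ?_
    · have := cellMass_nonneg u d K
      positivity
    · refine hF.abs_faceFlux_mul_le hM h1 he hK ((contDiff_loc f K).sub hφ)
        ((contDiff_avg G e).sub hg) (by positivity) hA (fun x hx => ?_) (hG.face e he K hK)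
      have h4 := hf.cell K ((T.mem_cellsAt).1 hK).1 x hx
      refine ⟨h4.1, h4.2.trans (le_of_eq ?_)⟩
      field_simp
  rw [← Finset.mul_sum] at e3
  rw [e2]
  refine (add_le_add e1 e3).trans (le_of_eq ?_)
  ring

end FluxData

end Consistency

/-! ### Consistency -/

theorem memLp_of_contDiff {Ω : Set (Euc n)} {g : Euc n → ℝ} (hg : ContDiff ℝ 1 g)
    (hgs : HasCompactSupport g) : MemLp g 2 (volume.restrict Ω) :=
  (hg.continuous.memLp_of_hasCompactSupport (μ := volume) hgs).restrict Ω

theorem memLp_divMul {Ω : Set (Euc n)} {u : Euc n → Euc n} {d g : Euc n → ℝ}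
    (hu : MemLp u 2 (volume.restrict Ω)) (hd : MemLp d 2 (volume.restrict Ω))
    (hg : ContDiff ℝ 1 g) (hgs : HasCompactSupport g) :
    MemLp (divMul u d g) 2 (volume.restrict Ω) := by
  obtain ⟨M, hM⟩ := hgs.exists_bound_of_continuous hg.continuous
  obtain ⟨l, hl⟩ := (hgs.fderiv ℝ).exists_bound_of_continuous (hg.continuous_fderiv one_ne_zero)
  refine MemLp.add (f := fun x => fderiv ℝ g x (u x)) (g := fun x => g x * d x) ?_ ?_
  · exact hu.of_le_mul (integrable_fderiv_apply hu.aestronglyMeasurable g)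
      (Eventually.of_forall fun x => (ContinuousLinearMap.le_opNorm _ _).trans
        (mul_le_mul_of_nonneg_right (hl x) (norm_nonneg _)))
  · refine hd.of_le_mul (hg.continuous.aestronglyMeasurable.mul hd.aestronglyMeasurable)
      (Eventually.of_forall fun x => ?_) (c := M)
    rw [norm_mul]
    exact mul_le_mul_of_nonneg_right (hM x) (norm_nonneg _)

/-- A function on a normed space that is homogeneous and bounded on the unit sphere is bounded by a
multiple of the norm. -/
theorem abs_le_mul_norm_of_homogeneous {V : Type*} [NormedAddCommGroup V] [NormedSpace ℝ V]
    {E : V → ℝ} (hE : ∀ (a : ℝ) f, E (a • f) = a * E f) {C : ℝ}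
    (h : ∀ f, ‖f‖ = 1 → |E f| ≤ C) (f : V) : |E f| ≤ C * ‖f‖ := by
  by_cases hf : ‖f‖ = 0
  · rw [norm_eq_zero] at hf
    have := hE 0 f
    rw [zero_smul, zero_mul] at this
    rw [hf, this]; simp
  · have h1 := h (‖f‖⁻¹ • f) (by rw [norm_smul, norm_inv, norm_norm, inv_mul_cancel₀ hf])
    rw [hE, abs_mul, abs_inv, abs_norm, inv_mul_le_iff₀ (lt_of_le_of_ne (norm_nonneg _)
      (Ne.symm hf))] at h1
    rwa [mul_comm]

section Consistency

variable {Ω : Set (Euc n)} {u : Euc n → Euc n} {d : Euc n → ℝ} {c : ℝ}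

/-- The consistency error of the form on `f`, tested with `g` and its approximation `G`. -/
def consistencyError {T : Triangulation Ω} {r : ℕ} (u : Euc n → Euc n) (d g : Euc n → ℝ)
    (f G : Vh T r) : ℝ :=
  feForm T u d f G + ∫ x in Ω, (f : Lp ℝ 2 (volume.restrict Ω)) x * divMul u d g x

theorem consistencyError_smul {T : Triangulation Ω} {r : ℕ} {g : Euc n → ℝ} (a : ℝ)
    (f G : Vh T r) :
    consistencyError u d g (a • f) G = a * consistencyError u d g f G := by
  unfold consistencyError
  rw [feForm_smul_left, mul_add, ← integral_const_mul]
  congr 1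
  refine integral_congr_ae ?_
  filter_upwards [Lp.coeFn_smul a (f : Lp ℝ 2 (volume.restrict Ω))] with x hx
  rw [Submodule.coe_smul, hx, Pi.smul_apply, smul_eq_mul, mul_assoc]

theorem consistencyError_add {T : Triangulation Ω} {r : ℕ} {g : Euc n → ℝ}
    (hF : FluxData T u d) (hg : MemLp (divMul u d g) 2 (volume.restrict Ω)) (f f' G : Vh T r) :
    consistencyError u d g (f + f') G
      = consistencyError u d g f G + consistencyError u d g f' G := by
  unfold consistencyError
  have hi : ∀ f : Vh T r, Integrable (fun x => (f : Lp ℝ 2 (volume.restrict Ω)) x * divMul u d g x)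
    (volume.restrict Ω) := fun f => (Lp.memLp _).integrable_mul hg
  rw [hF.feForm_add_left, add_add_add_comm, ← integral_add (hi f) (hi f')]
  congr 1
  refine integral_congr_ae ?_
  filter_upwards [Lp.coeFn_add (f : Lp ℝ 2 (volume.restrict Ω)) f'] with x hx
  rw [Submodule.coe_add, hx, Pi.add_apply, add_mul]

theorem norm_feProj_sub_le [IsFiniteMeasure (volume.restrict Ω)] {T : Triangulation Ω} {r : ℕ}
    {φ : Euc n → ℝ} (hφ : MemLp φ 2 (volume.restrict Ω)) {B h : ℝ} {f : Vh T r}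
    (hf : ApproxOn T φ f B h) (hh : 0 < h) :
    ‖(f : Lp ℝ 2 (volume.restrict Ω)) - hφ.toLp‖
      ≤ (volume.restrict Ω).real Set.univ ^ (1 / 2 : ℝ) * (B * h) := by
  refine (Lp.norm_le_of_ae_bound (mul_nonneg hf.nonneg hh.le) ?_).trans (le_of_eq ?_)
  · have h1 : ∀ᵐ x ∂(volume.restrict Ω), ∀ K ∈ T.cells, x ∈ convexHull ℝ (K : Set (Euc n)) →
        (f : Lp ℝ 2 (volume.restrict Ω)) x = loc f K x :=
      (Filter.eventually_all_finset T.cells).2 fun K hK => eqPolyOn_localPoly f hK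
    filter_upwards [Lp.coeFn_sub (f : Lp ℝ 2 (volume.restrict Ω)) hφ.toLp, hφ.coeFn_toLp, h1,
      T.ae_mem_interior] with x h2 h3 h4 ⟨K, hK, hxK⟩
    rw [h2, Pi.sub_apply, h3, h4 K hK (interior_subset hxK)]
    exact (hf.cell K hK x (interior_subset hxK)).1
  · congr 1
    norm_num [measureUnivNNReal, Measure.real]
    rfl

/-- The two ingredients of a density argument: stability of the error functional uniformly in `h`,
and convergence of order `h` on projections of smooth functions. -/
theorem exists_consistencyError_bounds (hn : 1 ≤ n) (hΩ : Bornology.IsBounded Ω)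
    (hu : IsH0Div Ω u d) {p : ℝ} (hp : 2 < p)
    (hup : MemLp u (ENNReal.ofReal p) (volume.restrict Ω)) (r : ℕ) (hc : 0 < c)
    {g : Euc n → ℝ} (hg : ContDiff ℝ 1 g) (hgs : HasCompactSupport g) :
    (∃ C : ℝ, 0 ≤ C ∧ ∀ {T : Triangulation Ω} {h : ℝ}, RegularMesh T c h → h ≤ 1 →
      ∀ f : Vh T r, |consistencyError u d g f
        (feProj T r (memLp_of_contDiff hg hgs).toLp)| ≤ C * ‖f‖) ∧
    ∀ {φ : Euc n → ℝ} (hφ : ContDiff ℝ 1 φ) (hφs : HasCompactSupport φ),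
      ∃ C : ℝ, ∀ {T : Triangulation Ω} {h : ℝ}, RegularMesh T c h → h ≤ 1 →
        |consistencyError u d g (feProj T r (memLp_of_contDiff hφ hφs).toLp)
          (feProj T r (memLp_of_contDiff hg hgs).toLp)| ≤ C * h ∧
        ‖(feProj T r (memLp_of_contDiff hφ hφs).toLp : Lp ℝ 2 (volume.restrict Ω))
          - (memLp_of_contDiff hφ hφs).toLp‖ ≤ C * h := by
  have hfin : IsFiniteMeasure (volume.restrict Ω) :=
    ⟨by rw [Measure.restrict_apply_univ]; exact hΩ.measure_lt_top⟩
  obtain ⟨C₁, hC₁, hloc⟩ := exists_loc_bound n r hc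
  obtain ⟨C₂, hC₂, happ⟩ := exists_approxOn hn r hc
  obtain ⟨C₃, hC₃, hmass⟩ := exists_cellMass_bound n hp
  have hFD : ∀ T : Triangulation Ω, FluxData T u d := fun T =>
    ⟨hΩ, hu, (hmass (T := T) hΩ hup hu.memLp_div).1⟩
  set D := (∫ x in Ω, d x ^ 2) + (∫ x in Ω, ‖u x‖ ^ p) + C₃ * (volume Ω).toReal with hD
  have hD0 : 0 ≤ D := by
    have h1 : 0 ≤ ∫ x in Ω, d x ^ 2 := integral_nonneg fun x => sq_nonneg _
    have h2 : 0 ≤ ∫ x in Ω, ‖u x‖ ^ p :=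
      integral_nonneg fun x => Real.rpow_nonneg (norm_nonneg _) _
    positivity
  obtain ⟨l, hl⟩ := (hgs.fderiv ℝ).exists_bound_of_continuous (hg.continuous_fderiv one_ne_zero)
  have hl0 : 0 ≤ l := (norm_nonneg _).trans (hl 0)
  have hbV := ballVol_nonneg n
  have happg := fun {T : Triangulation Ω} {h : ℝ} (hM : RegularMesh T c h) =>
    happ hM (memLp_of_contDiff hg hgs) hg hl
  set A := C₂ * l with hA
  have hA0 : 0 ≤ A := by positivity
  constructor
  · refine ⟨A * (1 + (n + 1) * (2 + (n + 1) / c)) * (C₃ * (C₁ ^ 2 * ballVol n) + D),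
      by positivity, fun {T h} hM h1 f => ?_⟩
    -- The mass bound is quadratic plus a constant, hence useful only for `‖f‖ = 1`; homogeneity
    -- gives the linear bound.
    refine abs_le_mul_norm_of_homogeneous
      (E := fun f => consistencyError u d g f (feProj T r (memLp_of_contDiff hg hgs).toLp))
      (fun a f => consistencyError_smul a f _) (fun f hf => ?_) f
    have hh := hM.h_pos
    set F : Finset (Euc n) → ℝ := fun K =>
      C₁ * scaledNorm h (convexHull ℝ (K : Set (Euc n))) (loc f K) with hFdef
    refine ((hFD T).abs_error_le_sum hn hM h1 hg (happg hM) f (F := F)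
      (fun K => mul_nonneg hC₁ (scaledNorm_nonneg _ _ _)) fun K hK x hx => ?_).trans ?_
    · obtain ⟨h2, h3⟩ := hloc hM f hK hK (Triangulation.inter_self_nonempty hK) x hx
      exact ⟨h2, h3.trans (le_of_eq (by simp only [F]; ring))⟩
    · refine mul_le_mul_of_nonneg_left ?_ (by positivity)
      refine ((hmass hΩ hup hu.memLp_div).2 F).trans ?_
      refine add_le_add (mul_le_mul_of_nonneg_left ?_ hC₃) le_rfl
      have h2 := norm_sq_eq_sum f hh
      have hf' : ‖f‖ = 1 := hf
      rw [hf', one_pow] at h2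
      -- The `1` is `‖f‖²`, written as a sum over the cells so that the inequality can be checked
      -- termwise.
      rw [← mul_one (C₁ ^ 2 * ballVol n), h2, Finset.mul_sum]
      refine Finset.sum_le_sum fun K hK => ?_
      refine (mul_le_mul_of_nonneg_left (hM.volume_le hK) (sq_nonneg _)).trans (le_of_eq ?_)
      simp only [F]; ring
  · intro φ hφ hφs
    obtain ⟨m, hm⟩ := (hφs.fderiv ℝ).exists_bound_of_continuous
      (hφ.continuous_fderiv one_ne_zero)
    have hm0 : 0 ≤ m := (norm_nonneg _).trans (hm 0)
    have happφ := fun {T : Triangulation Ω} {h : ℝ} (hM : RegularMesh T c h) =>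
      happ hM (memLp_of_contDiff hφ hφs) hφ hm
    set B := C₂ * m with hB
    have hB0 : 0 ≤ B := by positivity
    set E₁ := A * (B + m + (n + 1) * (B * (2 + (n + 1) / c))) * (C₃ * (volume Ω).toReal + D)
      with hE₁
    set E₂ := (volume.restrict Ω).real Set.univ ^ (1 / 2 : ℝ) * B with hE₂
    refine ⟨max E₁ E₂, fun {T h} hM h1 => ?_⟩
    have hh := hM.h_pos
    constructor
    · refine ((hFD T).abs_error_le_of_approxOn hn hM h1 hg (happg hM) hφ (happφ hM) hm).trans ?_
      refine le_trans ?_ (mul_le_mul_of_nonneg_right (le_max_left E₁ E₂) hh.le)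
      rw [mul_assoc, mul_comm h]
      refine mul_le_mul_of_nonneg_right ?_ hh.le
      refine mul_le_mul_of_nonneg_left ?_ (by positivity)
      have h2 := (hmass (T := T) hΩ hup hu.memLp_div).2 fun _ => 1
      have hvol : ∑ K ∈ T.cells, (volume (convexHull ℝ (K : Set (Euc n)))).toReal
          = (volume Ω).toReal := by
        have := T.integral_eq_sum (F := fun _ => (1 : ℝ)) (integrable_const _)
        simpa [Measure.real] using this.symm
      simp only [one_mul, one_pow, hvol] at h2
      exact h2
    · refine (norm_feProj_sub_le (memLp_of_contDiff hφ hφs) (happφ hM) hh).trans ?_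
      rw [← mul_assoc]
      exact mul_le_mul_of_nonneg_right (le_max_right E₁ E₂) hh.le

end Consistency

/-! ### From the error bounds to consistency of the operator. -/

section Consistency

variable {Ω : Set (Euc n)} {u : Euc n → Euc n} {d : Euc n → ℝ} {c : ℝ}

/-- Since `A fh` is in `V_h^r`, `g` may be replaced by its projection, which turns the pairing into
the form. The distributional side is moved from `f` to `fh` at the cost of an inner product with
`div (g u) ∈ L²`. -/
theorem integral_dirOperator_sub_distDeriv {T : Triangulation Ω} {r : ℕ}
    {A : Vh T r →ₗ[ℝ] Vh T r} (hA : IsDirOperator T r u d A) {g : Euc n → ℝ}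
    (hg : MemLp g 2 (volume.restrict Ω)) (hD : MemLp (divMul u d g) 2 (volume.restrict Ω))
    (f : Lp ℝ 2 (volume.restrict Ω)) (fh : Vh T r) :
    (∫ x in Ω, (A fh : Lp ℝ 2 (volume.restrict Ω)) x * g x) - distDeriv Ω u d f g
      = consistencyError u d g fh (feProj T r hg.toLp)
        + inner ℝ (f - (fh : Lp ℝ 2 (volume.restrict Ω))) hD.toLp := by
  have h0 : ∀ (F : Lp ℝ 2 (volume.restrict Ω)) {ψ : Euc n → ℝ}
      (hψ : MemLp ψ 2 (volume.restrict Ω)), inner ℝ F hψ.toLp = ∫ x in Ω, F x * ψ x := by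
    intro F ψ hψ
    rw [Lp.real_inner_eq]
    refine integral_congr_ae ?_
    filter_upwards [hψ.coeFn_toLp] with x hx
    rw [hx]
  have h1 : ∫ x in Ω, (A fh : Lp ℝ 2 (volume.restrict Ω)) x * g x
      = feForm T u d fh (feProj T r hg.toLp) := by
    rw [← h0 _ hg, ← inner_feProj]
    exact hA fh _
  rw [h1, inner_sub_left, h0 _ hD, h0 _ hD]
  simp only [distDeriv, consistencyError]
  ring

/-- Approximate `f` by a smooth `φ`. The error at `fh` minus the projection of `φ` is at most `C`
times its norm, hence small; the error at the projection is `O(h)`. -/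
theorem isConsistent_of_isDirOperator (hn : 1 ≤ n) (hΩ : Bornology.IsBounded Ω)
    (hu : IsH0Div Ω u d) {p : ℝ} (hp : 2 < p)
    (hup : MemLp u (ENNReal.ofReal p) (volume.restrict Ω)) (r : ℕ)
    {ι : Type*} {l : Filter ι} {T : ι → Triangulation Ω} {h : ι → ℝ} (hc : 0 < c)
    (hM : ∀ i, RegularMesh (T i) c (h i)) (hh : Tendsto h l (𝓝 0))
    {A : ∀ i, Vh (T i) r →ₗ[ℝ] Vh (T i) r} (hA : ∀ i, IsDirOperator (T i) r u d (A i)) :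
    IsConsistent l T r u d A := by
  intro f fh hf g hg
  have hg1 : ContDiff ℝ 1 g := hg.smooth.of_le (by simp)
  have hD := memLp_divMul hu.memLp hu.memLp_div hg1 hg.compact
  have hfin : IsFiniteMeasure (volume.restrict Ω) :=
    ⟨by rw [Measure.restrict_apply_univ]; exact hΩ.measure_lt_top⟩
  have hFD : ∀ i, FluxData (T i) u d := fun i => by
    obtain ⟨C, -, hC⟩ := exists_cellMass_bound n hp
    exact ⟨hΩ, hu, (hC hΩ hup hu.memLp_div).1⟩
  simp_rw [fun i => integral_dirOperator_sub_distDeriv (hA i) (memLp_of_contDiff hg1 hg.compact)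
    hD f (fh i)]
  rw [← add_zero (0 : ℝ)]
  refine Tendsto.add ?_ ?_
  · obtain ⟨⟨C, hC, hbd⟩, hsmall⟩ := exists_consistencyError_bounds hn hΩ hu hp hup r hc hg1
      hg.compact
    rw [Metric.tendsto_nhds]
    intro ε hε
    -- The tolerance makes `C ‖f - Φ‖ ≤ ε / 2`, with `C + 1` to avoid dividing by zero. The support
    -- of `φ` need not lie in `Ω`.
    obtain ⟨φ, hφs, hφ, hfφ⟩ := (Lp.memLp f).exist_eLpNorm_sub_le ENNReal.ofNat_ne_top one_le_two
      (show 0 < ε / (2 * (C + 1)) by positivity)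
    have hφ1 : ContDiff ℝ 1 φ := hφ.of_le (by simp)
    set Φ := (memLp_of_contDiff (Ω := Ω) hφ1 hφs).toLp with hΦ
    have hfΦ : ‖f - Φ‖ ≤ ε / (2 * (C + 1)) := by
      rw [Lp.norm_def]
      refine ENNReal.toReal_le_of_le_ofReal (by positivity) (le_trans (le_of_eq ?_) hfφ)
      refine eLpNorm_congr_ae ?_
      filter_upwards [Lp.coeFn_sub f Φ, (memLp_of_contDiff (Ω := Ω) hφ1 hφs).coeFn_toLp]
        with x h1 h2
      rw [h1, Pi.sub_apply, Pi.sub_apply, h2]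
    obtain ⟨C', hC'⟩ := hsmall hφ1 hφs
    have hlim : Tendsto (fun i => C * ‖f - (fh i : Lp ℝ 2 (volume.restrict Ω))‖
        + (C * C' + C') * h i) l (𝓝 0) := by
      have := (hf.const_mul C).add (hh.const_mul (C * C' + C'))
      simpa using this
    filter_upwards [(tendsto_order.1 hlim).2 (ε / 2) (by positivity),
      (tendsto_order.1 hh).2 1 one_pos] with i h1 h2
    obtain ⟨h3, h4⟩ := hC' (hM i) h2.le
    set P : Vh (T i) r := feProj (T i) r Φ
    rw [dist_zero_right, Real.norm_eq_abs]
    have h5 := consistencyError_add (hFD i) hD (fh i - P) P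
      (feProj (T i) r (memLp_of_contDiff hg1 hg.compact).toLp)
    rw [sub_add_cancel] at h5
    rw [h5]
    have h6 := hbd (hM i) h2.le (fh i - P)
    have h7 : ‖fh i - P‖ ≤ ‖f - (fh i : Lp ℝ 2 (volume.restrict Ω))‖ + ‖f - Φ‖ + C' * h i := by
      have e1 : ‖fh i - P‖ = ‖(fh i : Lp ℝ 2 (volume.restrict Ω)) - (P : Vh (T i) r)‖ := rfl
      have e2 : (fh i : Lp ℝ 2 (volume.restrict Ω)) - (P : Vh (T i) r)
        = -(f - (fh i : Lp ℝ 2 (volume.restrict Ω))) + (f - Φ) - (((P : Vh (T i) r) : Lp ℝ 2 (volume.restrict Ω)) - Φ) := by abel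
      rw [e1, e2]
      refine (norm_sub_le _ _).trans (add_le_add ((norm_add_le _ _).trans ?_) h4)
      rw [norm_neg]
    have h8 := mul_le_mul_of_nonneg_left h7 hC
    have h9 : C * ‖f - Φ‖ ≤ ε / 2 := by
      calc C * ‖f - Φ‖ ≤ C * (ε / (2 * (C + 1))) := mul_le_mul_of_nonneg_left hfΦ hC
        _ = (C / (C + 1)) * (ε / 2) := by field_simp
        _ ≤ 1 * (ε / 2) := by
          refine mul_le_mul_of_nonneg_right ?_ (by positivity)
          rw [div_le_one (by positivity)]; linarith
        _ = ε / 2 := one_mul _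
    refine (abs_add_le _ _).trans_lt ?_
    have h10 := add_le_add (h6.trans h8) h3
    refine h10.trans_lt ?_
    linarith
  · refine squeeze_zero_norm (fun i => (norm_inner_le_norm _ _)) ?_
    simpa using hf.mul_const ‖hD.toLp‖

end Consistency

/-! ### Bounded vector fields -/

section Bounded

variable {Ω : Set (Euc n)} {u : Euc n → Euc n} {d : Euc n → ℝ} {c : ℝ}

/-- For bounded `u`, a volume term costs `h⁻¹` for the gradient and a face term costs `(c h)⁻¹` from
`abs_faceFlux_le_of_bounded`. Products of local norms are bounded by sums of squares, to be made
bilinear afterwards by homogeneity. -/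
theorem FluxData.abs_feForm_le_of_bounded (hn : 1 ≤ n) {T : Triangulation Ω} {r : ℕ}
    (hF : FluxData T u d) {h M : ℝ} (hM : RegularMesh T c h) (hM0 : 0 ≤ M)
    (hu : ∀ᵐ x ∂(volume.restrict Ω), ‖u x‖ ≤ M) {C : ℝ} (hC : 0 ≤ C)
    (hloc : ∀ (f : Vh T r) {K L : Finset (Euc n)}, K ∈ T.cells → L ∈ T.cells →
      (K ∩ L).Nonempty → ∀ x ∈ convexHull ℝ (K : Set (Euc n)),
        |loc f L x| ≤ C * scaledNorm h (convexHull ℝ (L : Set (Euc n))) (loc f L) ∧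
        ‖fderiv ℝ (loc f L) x‖
          ≤ C * h⁻¹ * scaledNorm h (convexHull ℝ (L : Set (Euc n))) (loc f L)) (f g : Vh T r) :
    |feForm T u d f g| ≤ C ^ 2 * M * ballVol n * (1 + (n + 1) * (cornerConst n / c)) * h⁻¹
      * (‖f‖ ^ 2 + ‖g‖ ^ 2) := by
  have hh := hM.h_pos
  have hc := hM.c_pos
  have hbV := ballVol_nonneg n
  have hcc := cornerConst_nonneg n
  set F : Finset (Euc n) → ℝ := fun K => scaledNorm h (convexHull ℝ (K : Set (Euc n))) (loc f K)
  set G : Finset (Euc n) → ℝ := fun K => scaledNorm h (convexHull ℝ (K : Set (Euc n))) (loc g K)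
  have hF0 : ∀ K, 0 ≤ F K := fun K => scaledNorm_nonneg _ _ _
  have hG0 : ∀ K, 0 ≤ G K := fun K => scaledNorm_nonneg _ _ _
  have hsum : h ^ n * ∑ K ∈ T.cells, (F K ^ 2 + G K ^ 2) = ‖f‖ ^ 2 + ‖g‖ ^ 2 := by
    rw [norm_sq_eq_sum f hh, norm_sq_eq_sum g hh, Finset.sum_add_distrib, mul_add,
      Finset.mul_sum, Finset.mul_sum]
  rw [feForm_eq]
  refine (abs_sub _ _).trans ?_
  have e1 : |∑ K ∈ T.cells, ∫ x in convexHull ℝ (K : Set (Euc n)),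
      fderiv ℝ (loc f K) x (u x) * loc g K x|
      ≤ C ^ 2 * M * ballVol n * h⁻¹ * (h ^ n * ∑ K ∈ T.cells, (F K ^ 2 + G K ^ 2)) := by
    rw [Finset.mul_sum, Finset.mul_sum]
    refine (Finset.abs_sum_le_sum_abs _ _).trans (Finset.sum_le_sum fun K hK => ?_)
    have hb : ∀ᵐ x ∂(volume.restrict (convexHull ℝ (K : Set (Euc n)))),
        ‖fderiv ℝ (loc f K) x (u x) * loc g K x‖ ≤ C * h⁻¹ * F K * M * (C * G K) := by
      filter_upwards [Triangulation.ae_simplex_of_ae hK hu,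
        ae_restrict_mem (isCompact_simplex K).measurableSet] with x hx hxK
      have hKK := Triangulation.inter_self_nonempty hK
      rw [norm_mul]
      have h1 := (hloc f hK hK hKK x hxK).2
      refine mul_le_mul ((ContinuousLinearMap.le_opNorm _ _).trans
        (mul_le_mul h1 hx (norm_nonneg _) ((norm_nonneg _).trans h1)))
        (hloc g hK hK hKK x hxK).1 (norm_nonneg _) ?_
      have := hF0 K
      positivity
    have hfinK : IsFiniteMeasure (volume.restrict (convexHull ℝ (K : Set (Euc n)))) :=
      ⟨by rw [Measure.restrict_apply_univ]; exact (isCompact_simplex K).measure_lt_top⟩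
    have h2 := norm_integral_le_of_norm_le_const hb
    rw [Real.norm_eq_abs, Measure.real, Measure.restrict_apply_univ] at h2
    refine h2.trans ?_
    have hFK := hF0 K
    have hGK := hG0 K
    refine (mul_le_mul_of_nonneg_left (hM.volume_le hK) (by positivity)).trans ?_
    have h3 : F K * G K ≤ F K ^ 2 + G K ^ 2 := by nlinarith [sq_nonneg (F K - G K)]
    calc C * h⁻¹ * F K * M * (C * G K) * (ballVol n * h ^ n)
        = C ^ 2 * M * ballVol n * h⁻¹ * (h ^ n * (F K * G K)) := by ring
      _ ≤ _ := by gcongr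
  have e2 : |∑ e ∈ T.interiorFaces, ∑ K ∈ T.cellsAt e,
      faceFlux u d K e fun x => loc f K x * avg T g e x|
      ≤ C ^ 2 * M * ballVol n * (cornerConst n / c) * h⁻¹ * ((n + 1) * (h ^ n *
        ∑ K ∈ T.cells, (F K ^ 2 + G K ^ 2))) := by
    set κ := C ^ 2 * M * ballVol n * (cornerConst n / c) * h⁻¹ * h ^ n with hκ
    have hκ0 : 0 ≤ κ := by positivity
    have hflux : ∀ e ∈ T.interiorFaces, ∀ K ∈ T.cellsAt e,
        |faceFlux u d K e fun x => loc f K x * avg T g e x|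
          ≤ κ * (F K ^ 2 + (1 / 2) * ∑ L ∈ T.cellsAt e, G L ^ 2) := by
      intro e he K hKe
      have hK := ((T.mem_cellsAt).1 hKe).1
      have hcard := (Triangulation.mem_interiorFaces.1 he).2.2
      have hFK := hF0 K
      set S := (1 / 2) * ∑ L ∈ T.cellsAt e, G L with hS
      have hS0 : 0 ≤ S := mul_nonneg (by norm_num) (Finset.sum_nonneg fun L _ => hG0 L)
      have hα : ∀ x ∈ convexHull ℝ (K : Set (Euc n)),
          |loc f K x * avg T g e x| ≤ C * F K * (C * S) := by
        intro x hx
        rw [abs_mul]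
        refine mul_le_mul (hloc f hK hK (Triangulation.inter_self_nonempty hK) x hx).1 ?_
          (abs_nonneg _) (by positivity)
        have h1 : |avg T g e x| ≤ (1 / 2) * ∑ L ∈ T.cellsAt e, C * G L := by
          simp only [avg, average]
          rw [abs_mul, abs_of_pos (by norm_num : (0 : ℝ) < 1 / 2)]
          refine mul_le_mul_of_nonneg_left ((Finset.abs_sum_le_sum_abs _ _).trans
            (Finset.sum_le_sum fun L hL => ?_)) (by norm_num)
          exact (hloc g hK ((T.mem_cellsAt).1 hL).1
            (Triangulation.inter_nonempty_of_mem_cellsAt hn he hKe hL) x hx).1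
        refine h1.trans (le_of_eq ?_)
        rw [hS, ← Finset.mul_sum]; ring
      have hkey : F K * S ≤ F K ^ 2 + (1 / 2) * ∑ L ∈ T.cellsAt e, G L ^ 2 := by
        have h1 : F K * ∑ L ∈ T.cellsAt e, G L
            ≤ ∑ L ∈ T.cellsAt e, (F K ^ 2 + G L ^ 2) := by
          rw [Finset.mul_sum]
          exact Finset.sum_le_sum fun L _ => by nlinarith [sq_nonneg (F K - G L)]
        rw [Finset.sum_add_distrib, Finset.sum_const, hcard, nsmul_eq_mul] at h1
        push_cast at h1
        rw [hS]
        linarith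
      obtain ⟨j, hj, rfl⟩ :=
        Triangulation.exists_eq_erase (Triangulation.mem_interiorFaces.1 he).2.1 hKe
      refine (hF.abs_faceFlux_le_of_bounded hn hK hj ((contDiff_loc f K).mul (contDiff_avg g _))
        hα (hM.norm_baryGrad_le hK) hu).trans ?_
      calc C * F K * (C * S) * (c * h)⁻¹ * M *
            (cornerConst n * (volume (convexHull ℝ (K : Set (Euc n)))).toReal)
          ≤ C * F K * (C * S) * (c * h)⁻¹ * M * (cornerConst n * (ballVol n * h ^ n)) := by
            have := hM.volume_le hK
            gcongr
        _ = κ * (F K * S) := by rw [hκ, mul_inv]; ring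
        _ ≤ _ := mul_le_mul_of_nonneg_left hkey hκ0
    refine (Finset.abs_sum_le_sum_abs _ _).trans ?_
    refine (Finset.sum_le_sum fun e _ => Finset.abs_sum_le_sum_abs _ _).trans ?_
    refine (Finset.sum_le_sum fun e he => Finset.sum_le_sum (hflux e he)).trans ?_
    -- The mean over the two cells does not depend on `K`, so summing it over both cells restores
    -- the full sum of the `G L ^ 2`.
    have h4 : ∀ e ∈ T.interiorFaces,
        ∑ K ∈ T.cellsAt e, κ * (F K ^ 2 + (1 / 2) * ∑ L ∈ T.cellsAt e, G L ^ 2)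
          = ∑ K ∈ T.cellsAt e, κ * (F K ^ 2 + G K ^ 2) := fun e he => by
      rw [← Finset.mul_sum, ← Finset.mul_sum, Finset.sum_add_distrib, Finset.sum_add_distrib,
        Finset.sum_const, (Triangulation.mem_interiorFaces.1 he).2.2, nsmul_eq_mul]
      push_cast; ring
    rw [Finset.sum_congr rfl h4]
    refine (Triangulation.sum_interiorFaces_le (b := fun K => κ * (F K ^ 2 + G K ^ 2))
      (fun K _ => by positivity) fun e he K hK => le_rfl).trans (le_of_eq ?_)
    rw [← Finset.mul_sum, hκ]; ring
  rw [hsum] at e1 e2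
  refine (add_le_add e1 e2).trans (le_of_eq ?_)
  ring

/-- Normalising `f` and `g` in turn converts the bound by `‖f‖² + ‖g‖²` into one by `2 ‖f‖ ‖g‖`;
then take `g = A f` and divide by `‖A f‖`. -/
theorem exists_dirOperator_bound (hn : 1 ≤ n) (r : ℕ) (hc : 0 < c) {M : ℝ} (hM0 : 0 ≤ M)
    (hu : ∀ᵐ x ∂(volume.restrict Ω), ‖u x‖ ≤ M) : ∃ C : ℝ, 0 ≤ C ∧
    ∀ {T : Triangulation Ω} {h : ℝ}, FluxData T u d → RegularMesh T c h →
    ∀ {A : Vh T r →ₗ[ℝ] Vh T r}, IsDirOperator T r u d A → ∀ f, ‖A f‖ ≤ C * h⁻¹ * ‖f‖ := by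
  obtain ⟨C, hC, hloc⟩ := exists_loc_bound n r hc
  have hbV := ballVol_nonneg n
  have hcc := cornerConst_nonneg n
  refine ⟨2 * (C ^ 2 * M * ballVol n * (1 + (n + 1) * (cornerConst n / c))), by positivity,
    fun {T h} hF hM A hA f => ?_⟩
  have hh := hM.h_pos
  set κ := C ^ 2 * M * ballVol n * (1 + (n + 1) * (cornerConst n / c)) with hκ
  have h1 : ∀ f g : Vh T r, |feForm T u d f g| ≤ κ * h⁻¹ * (‖f‖ ^ 2 + ‖g‖ ^ 2) := fun f g =>
    hF.abs_feForm_le_of_bounded hn hM hM0 hu hC (hloc hM) f g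
  have h2 : ∀ f g : Vh T r, ‖f‖ = 1 → |feForm T u d f g| ≤ 2 * κ * h⁻¹ * ‖g‖ := fun f g hf =>
    abs_le_mul_norm_of_homogeneous (E := fun g => feForm T u d f g)
      (fun a g => feForm_smul_right a f g) (fun g hg => by
        have hg' : ‖g‖ = 1 := hg
        have := h1 f g
        rw [hf, hg'] at this
        linarith) g
  have h3 : |feForm T u d f (A f)| ≤ 2 * κ * h⁻¹ * ‖A f‖ * ‖f‖ :=
    abs_le_mul_norm_of_homogeneous (E := fun f' => feForm T u d f' (A f))
      (fun a f' => feForm_smul_left a f' (A f)) (fun f' hf' => h2 f' (A f) hf') f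
  have h4 : feForm T u d f (A f) = ‖A f‖ ^ 2 := by
    rw [← real_inner_self_eq_norm_sq]; exact (hA f (A f)).symm
  rw [h4, abs_of_nonneg (sq_nonneg _)] at h3
  by_cases h5 : ‖A f‖ = 0
  · rw [h5]; have := norm_nonneg f; positivity
  · have h6 : 0 < ‖A f‖ := lt_of_le_of_ne (norm_nonneg _) (Ne.symm h5)
    refine le_of_mul_le_mul_left ?_ h6
    linarith

end Bounded

/-! ### Comparison with another consistent operator. -/

section PerturbedOperator

variable {Ω : Set (Euc n)} {u : Euc n → Euc n} {d : Euc n → ℝ} {c : ℝ}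

theorem l2Dist_eq_norm {g : Euc n → ℝ} (hg : MemLp g 2 (volume.restrict Ω))
    (G : Lp ℝ 2 (volume.restrict Ω)) : l2Dist Ω g G = ‖G - hg.toLp‖ := by
  rw [norm_sub_rev, Lp.norm_def, l2Dist]
  congr 1
  refine eLpNorm_congr_ae ?_
  filter_upwards [Lp.coeFn_sub hg.toLp G, hg.coeFn_toLp] with x h1 h2
  rw [h1, Pi.sub_apply, h2]

/-- The estimates use real powers of `‖u‖`, and `p` may be infinite. On a bounded set the exponent
can be lowered; `3` is an arbitrary number above `2`. -/
theorem exists_real_exponent {Ω : Set (Euc n)} (hΩ : Bornology.IsBounded Ω) {p : ℝ≥0∞}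
    (hp : 2 < p) (hup : MemLp u p (volume.restrict Ω)) :
    ∃ q : ℝ, 2 < q ∧ MemLp u (ENNReal.ofReal q) (volume.restrict Ω) := by
  have hfin : IsFiniteMeasure (volume.restrict Ω) :=
    ⟨by rw [Measure.restrict_apply_univ]; exact hΩ.measure_lt_top⟩
  have h3 : min p 3 ≠ ⊤ := ne_top_of_le_ne_top ENNReal.ofNat_ne_top (min_le_right p 3)
  refine ⟨(min p 3).toReal, ?_, ?_⟩
  · have h1 : (2 : ℝ≥0∞) < min p 3 := lt_min hp (by norm_num)
    have := (ENNReal.toReal_lt_toReal ENNReal.ofNat_ne_top h3).2 h1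
    simpa using this
  · rw [ENNReal.ofReal_toReal h3]
    exact hup.mono_exponent (min_le_left _ _)

-- Split `gh = g + (gh - g)`. Against `g` the two consistency limits cancel. Against `gh - g`, which
-- is `o(h)` in `L²`, both operators contribute at most `O(h⁻¹) · o(h)`; for `Au` this uses that
-- `‖fh‖` is eventually bounded, as `fh` converges.
set_option maxHeartbeats 800000 in
theorem tendsto_inner_sub_of_isConsistent {r : ℕ} {ι : Type*} {l : Filter ι}
    {T : ι → Triangulation Ω} {A Au : ∀ i, Vh (T i) r →ₗ[ℝ] Vh (T i) r}
    (hA : IsConsistent l T r u d A) (hAu : IsConsistent l T r u d Au) {κ : ℝ}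
    (hκ : ∀ i f, ‖Au i f‖ ≤ κ * (T i).meshSize⁻¹ * ‖f‖) (hκ0 : 0 ≤ κ)
    (hpos : ∀ i, 0 < (T i).meshSize) {f : Lp ℝ 2 (volume.restrict Ω)} {g : Euc n → ℝ}
    (hg : IsTest Ω g) {fh gh : ∀ i, Vh (T i) r}
    (hf : Tendsto (fun i => ‖(fh i : Lp ℝ 2 (volume.restrict Ω)) - f‖) l (𝓝 0))
    (hgh : Tendsto (fun i =>
      (T i).meshSize⁻¹ * l2Dist Ω g (gh i : Lp ℝ 2 (volume.restrict Ω))) l (𝓝 0))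
    {C : ℝ} (hC : ∀ i, ‖A i (fh i)‖ ≤ C * (T i).meshSize⁻¹) :
    Tendsto (fun i => inner ℝ (A i (fh i) - Au i (fh i)) (gh i)) l (𝓝 0) := by
  have hg2 : MemLp g 2 (volume.restrict Ω) :=
    memLp_of_contDiff (hg.smooth.of_le (by simp)) hg.compact
  set G := hg2.toLp
  simp_rw [l2Dist_eq_norm hg2] at hgh
  have hf' : Tendsto (fun i => ‖f - (fh i : Lp ℝ 2 (volume.restrict Ω))‖) l (𝓝 0) := by
    simpa only [norm_sub_rev] using hf
  have h1 := (hA f fh hf' g hg).sub (hAu f fh hf' g hg)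
  simp only [sub_sub_sub_cancel_right, sub_zero] at h1
  have hin : ∀ F : Lp ℝ 2 (volume.restrict Ω), ∫ x in Ω, F x * g x = inner ℝ F G := fun F => by
    rw [Lp.real_inner_eq]
    refine integral_congr_ae ?_
    filter_upwards [hg2.coeFn_toLp] with x hx
    rw [hx]
  simp_rw [hin] at h1
  have h2 : Tendsto (fun i => inner ℝ (A i (fh i) : Lp ℝ 2 (volume.restrict Ω))
      ((gh i : Lp ℝ 2 (volume.restrict Ω)) - G)) l (𝓝 0) := by
    refine squeeze_zero_norm (a := fun i => C * ((T i).meshSize⁻¹ *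
      ‖(gh i : Lp ℝ 2 (volume.restrict Ω)) - G‖)) (fun i => ?_) (by simpa using hgh.const_mul C)
    refine (norm_inner_le_norm _ _).trans ?_
    rw [← mul_assoc]
    exact mul_le_mul_of_nonneg_right (hC i) (norm_nonneg _)
  have h3 : Tendsto (fun i => inner ℝ (Au i (fh i) : Lp ℝ 2 (volume.restrict Ω))
      ((gh i : Lp ℝ 2 (volume.restrict Ω)) - G)) l (𝓝 0) := by
    refine squeeze_zero_norm (a := fun i =>
      κ * (‖(fh i : Lp ℝ 2 (volume.restrict Ω)) - f‖ + ‖f‖) * ((T i).meshSize⁻¹ *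
        ‖(gh i : Lp ℝ 2 (volume.restrict Ω)) - G‖)) (fun i => ?_) ?_
    · refine (norm_inner_le_norm _ _).trans ?_
      rw [← mul_assoc]
      refine mul_le_mul_of_nonneg_right ((hκ i (fh i)).trans ?_) (norm_nonneg _)
      have h4 : ‖fh i‖ ≤ ‖(fh i : Lp ℝ 2 (volume.restrict Ω)) - f‖ + ‖f‖ := by
        have := norm_add_le ((fh i : Lp ℝ 2 (volume.restrict Ω)) - f) f
        rwa [sub_add_cancel] at this
      rw [mul_right_comm]
      exact mul_le_mul_of_nonneg_right (mul_le_mul_of_nonneg_left h4 hκ0)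
        (inv_nonneg.2 (hpos i).le)
    · have := ((hf.add_const ‖f‖).const_mul κ).mul hgh
      simpa using this
  have h5 := (h1.add h2).sub h3
  rw [add_zero, sub_zero] at h5
  refine h5.congr fun i => ?_
  have h6 : inner ℝ (A i (fh i) - Au i (fh i)) (gh i)
      = inner ℝ ((A i (fh i) : Lp ℝ 2 (volume.restrict Ω)) - Au i (fh i))
        (gh i : Lp ℝ 2 (volume.restrict Ω)) := rfl
  rw [h6, inner_sub_left, inner_sub_right, inner_sub_right]
  ring

end PerturbedOperator

end FEDirDeriv

end

/-! ### The theorem. -/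

theorem proposition3p2 {n : ℕ} (hn : 1 ≤ n) {Ω : Set (FEDirDeriv.Euc n)}
    (hΩ : IsOpen Ω) (hΩb : Bornology.IsBounded Ω)
    {ι : Type*} (l : Filter ι) (T : ι → FEDirDeriv.Triangulation Ω)
    (hT : FEDirDeriv.ShapeRegularQuasiUniform T)
    (hh : Tendsto (fun i => (T i).meshSize) l (𝓝 0))
    (r : ℕ) (p : ℝ≥0∞) (hp : 2 < p)
    (u : FEDirDeriv.Euc n → FEDirDeriv.Euc n) (d : FEDirDeriv.Euc n → ℝ)
    (hu : FEDirDeriv.IsH0Div Ω u d) (hup : MemLp u p (volume.restrict Ω)) :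
    (∀ i, ∃! A : FEDirDeriv.Vh (T i) r →ₗ[ℝ] FEDirDeriv.Vh (T i) r,
      FEDirDeriv.IsDirOperator (T i) r u d A) ∧
    ∀ Au : ∀ i, FEDirDeriv.Vh (T i) r →ₗ[ℝ] FEDirDeriv.Vh (T i) r,
      (∀ i, FEDirDeriv.IsDirOperator (T i) r u d (Au i)) →
      FEDirDeriv.IsConsistent l T r u d Au ∧
      (1 ≤ r → p = (⊤ : ℝ≥0∞) →
        ∀ A : ∀ i, FEDirDeriv.Vh (T i) r →ₗ[ℝ] FEDirDeriv.Vh (T i) r,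
          FEDirDeriv.IsConsistent l T r u d A →
          ∀ (f : Lp ℝ 2 (volume.restrict Ω)) (g : FEDirDeriv.Euc n → ℝ),
            FEDirDeriv.IsTest Ω g →
            ∀ fh gh : ∀ i, FEDirDeriv.Vh (T i) r,
              Tendsto (fun i => ‖(fh i : Lp ℝ 2 (volume.restrict Ω)) - f‖) l (𝓝 0) →
              Tendsto (fun i =>
                (T i).meshSize⁻¹ *
                    FEDirDeriv.l2Dist Ω g (gh i : Lp ℝ 2 (volume.restrict Ω))
                  + FEDirDeriv.brokenH1Dist (T i) g (gh i : Lp ℝ 2 (volume.restrict Ω)))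
                l (𝓝 0) →
              (∃ C : ℝ, ∀ i, ‖A i (fh i)‖ ≤ C * (T i).meshSize⁻¹) →
              Tendsto (fun i => inner ℝ (A i (fh i) - Au i (fh i)) (gh i)) l (𝓝 0)) := by
  obtain ⟨q, hq, huq⟩ := FEDirDeriv.exists_real_exponent hΩb hp hup
  have hFD : ∀ i, FEDirDeriv.FluxData (T i) u d := fun i => by
    obtain ⟨C, -, hC⟩ := FEDirDeriv.exists_cellMass_bound n hq
    exact ⟨hΩb, hu, (hC hΩb huq hu.memLp_div).1⟩
  refine ⟨fun i => (hFD i).existsUnique_isDirOperator r, fun Au hAu => ?_⟩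
  -- If `Ω` is empty there are no cells and `meshSize` is `sSup ∅ = 0`, so `RegularMesh` fails; all
  -- integrals vanish instead.
  rcases Ω.eq_empty_or_nonempty with rfl | hne
  · refine ⟨fun f fh _ g _ => ?_, ?_⟩
    · simp only [FEDirDeriv.distDeriv, Measure.restrict_empty, integral_zero_measure, neg_zero,
        sub_zero]
      exact tendsto_const_nhds
    intro _ _ A _ f g _ fh gh _ _ _
    have hz : ∀ i, inner ℝ (A i (fh i) - Au i (fh i)) (gh i) = (0 : ℝ) := fun i =>
      (FEDirDeriv.Lp.real_inner_eq _ _).trans (by simp)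
    simp only [hz]
    exact tendsto_const_nhds
  obtain ⟨c, hc, hM⟩ := hT.exists_regularMesh hn hne
  have hcons : FEDirDeriv.IsConsistent l T r u d Au :=
    FEDirDeriv.isConsistent_of_isDirOperator hn hΩb hu hq huq r hc hM hh hAu
  refine ⟨hcons, ?_⟩
  rintro - rfl A hA f g hg fh gh hf hgh ⟨C, hC⟩
  have hbd : ∀ᵐ x ∂(volume.restrict Ω), ‖u x‖ ≤ (eLpNorm u ⊤ (volume.restrict Ω)).toReal := by
    rw [eLpNorm_exponent_top]
    have htop : eLpNormEssSup u (volume.restrict Ω) ≠ ⊤ := by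
      rw [← eLpNorm_exponent_top]; exact hup.2.ne
    filter_upwards [ae_le_eLpNormEssSup (f := u) (μ := volume.restrict Ω)] with x hx
    rw [← toReal_enorm]
    exact ENNReal.toReal_mono htop hx
  obtain ⟨κ, hκ0, hκ⟩ := FEDirDeriv.exists_dirOperator_bound (d := d) hn r hc
    ENNReal.toReal_nonneg hbd
  refine FEDirDeriv.tendsto_inner_sub_of_isConsistent hA hcons
    (fun i f => hκ (hFD i) (hM i) (hAu i) f) hκ0 (fun i => (hM i).h_pos) hg hf ?_ hC
  refine squeeze_zero (fun i => mul_nonneg (inv_nonneg.2 (hM i).h_pos.le) ENNReal.toReal_nonneg)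
    (fun i => ?_) hgh
  exact le_add_of_nonneg_right (Real.sqrt_nonneg _)
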